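/- Let $m\ge 1$. Let $e_1,\dots,e_m$ generate the complexified Clifford algebra $\mathbb{C}_m=\mathbb{C}\otimes\mathbb{R}_{0,m}$, $e_je_k+e_ke_j=-2\delta_{jk}$; let $\underline{\partial}=\sum_j e_j\partial_{x_j}$ be the Dirac operator in $\mathbb{R}^m$, $r=|\underline{x}|$ and $\underline{\omega}=\underline{x}/|\underline{x}|=\sum_j e_j\omega_j$. For $\lambda\in\mathbb{C}$ let $T_\lambda=\mathrm{Fp}\,r^\lambda$ and $U_\lambda=\mathrm{Fp}\,r^\lambda\underline{\omega}$ be the tempered distributions $$\langle T_\lambda,\phi\rangle=\mathrm{Fp}\int_0^\infty r^{\lambda+m-1}\int_{S^{m-1}}\phi(r\underline{\omega})\,dS(\underline{\omega})\,dr,\qquad \langle U_\lambda,\phi\rangle=\mathrm{Fp}\int_0^\infty r^{\lambda+m-1}\int_{S^{m-1}}\underline{\omega}\,\phi(r\underline{\omega})\,dS(\underline{\omega})\,dr$$ (Hadamard finite part), and put $$T^*_\lambda=\frac{\pi^{\frac{\lambda+m}{2}}}{\Gamma(\frac{\lambda+m}{2})}\,T_\lambda\ \ (\lambda\ne -m-2l),\qquad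 T^*_{-m-2l}=\frac{\pi^{\frac m2-l}}{2^{2l}\,\Gamma(\frac m2+l)}(-\Delta_m)^l\delta,$$ $$U^*_\lambda=\frac{\pi^{\frac{\lambda+m+1}{2}}}{\Gamma(\frac{\lambda+m+1}{2})}\,U_\lambda\ \ (\lambda\ne -m-2l-1),\qquad U^*_{-m-2l-1}=-\frac{\pi^{\frac m2-l}}{2^{2l+1}\,\Gamma(\frac m2+l+1)}\,\underline{\partial}^{2l+1}\delta,$$ $l=0,1,2,\dots$ Define $$(-\Delta_m)^\beta\delta=2^{2\beta}\,\frac{\Gamma(\frac{m+2\beta}{2})}{\pi^{\frac{m-2\beta}{2}}}\,T^*_{-m-2\beta}\quad\Big(\beta\ne-\frac m2-n\Big),\qquad(-\Delta_m)^\beta H=-2^{2\beta}\,\frac{\Gamma(\frac{m+2\beta+1}{2})}{\pi^{\frac{m-2\beta+1}{2}}}\,U^*_{-m-2\beta}\quad\Big(\beta\ne-\frac{m+1}2-n\Big),$$ $n=0,1,2,\dots$ **Proposition.** For $\alpha,\beta\in\mathbb{C}$ such that $\alpha$ and $\beta$ are different from $-\frac{m+1}{2}-n$ and $\alpha+\beta$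 is different from $-\frac m2-n$, $n=0,1,2,\dots$, one has $$(-\Delta_m)^\alpha H*(-\Delta_m)^\beta H=(-\Delta_m)^{\alpha+\beta}\delta .$$ The convolution is understood as follows. (i) If $\mathrm{Re}(\alpha+\beta)>-\frac m2$, or if $\alpha$ or $\beta$ lies in $\{\frac12,\frac32,\frac52,\dots\}$ (so that one factor is supported at the origin), it is the convolution of tempered distributions in the usual sense: $S*T=R$ means that $(S*\phi)*(T*\psi)=(R*\phi)*\psi$ for all $\phi,\psi\in\mathcal{S}(\mathbb{R}^m)$, with absolutely convergent convolution integrals of the smooth functions $S*\phi$, $T*\psi$ and $R*\phi$, $\psi$. (ii) For general $\alpha,\beta$ it is the analytic continuation in the parameters: the set $D$ of all admissible $(\alpha,\beta)$ is open and connected in $\mathbb{C}^2$, the families $(-\Delta_m)^\alpha H$, $(-\Delta_m)^\beta H$ and $(-\Delta_m)^{\alpha+\beta}\delta$ are weakly holomorphic on $D$, and on a non-empty open subset of $D$ the last one is the convolution of the first two in the usual sense. -/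

import Mathlib

open scoped SchwartzMap LineDeriv

noncomputable section

namespace CliffordKernel

open MeasureTheory Set

/-- Euclidean space `ℝ^m`. -/
abbrev E (m : ℕ) : Type := EuclideanSpace ℝ (Fin m)

/-- The quadratic form `v ↦ -∑ v_j ^ 2` on `ℂ^m`. -/
def negSq (m : ℕ) : QuadraticForm ℂ (Fin m → ℂ) :=
  QuadraticMap.weightedSumSquares ℂ (fun _ : Fin m => (-1 : ℂ))

/-- The complexification of the real Clifford algebra `ℝ_{0,m}`: it is generated by
`e_1, …, e_m` subject to `e_j e_k + e_k e_j = -2 δ_{jk}`. Complex coefficients are needed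
since the kernels depend on complex parameters. -/
abbrev Cl (m : ℕ) : Type := CliffordAlgebra (negSq m)

/-- The basis vector `e_j` of the Clifford algebra. -/
def e {m : ℕ} (j : Fin m) : Cl m := CliffordAlgebra.ι (negSq m) (Pi.single j 1)

theorem e_mul_e_add {m : ℕ} (j k : Fin m) :
    (e j * e k + e k * e j : Cl m) = algebraMap ℂ (Cl m) (if j = k then -2 else 0) := by
  rw [e, e, CliffordAlgebra.ι_mul_ι_add_swap]
  congr 1
  simp only [QuadraticMap.polar, negSq, QuadraticMap.weightedSumSquares_apply, Pi.add_apply,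
    smul_eq_mul, ← Finset.sum_sub_distrib]
  have h : ∀ i : Fin m, (-1 * (((Pi.single j 1 : Fin m → ℂ) i + (Pi.single k 1 : Fin m → ℂ) i) *
      ((Pi.single j 1 : Fin m → ℂ) i + (Pi.single k 1 : Fin m → ℂ) i))
      - -1 * ((Pi.single j 1 : Fin m → ℂ) i * (Pi.single j 1 : Fin m → ℂ) i)
      - -1 * ((Pi.single k 1 : Fin m → ℂ) i * (Pi.single k 1 : Fin m → ℂ) i))
      = if i = j then (if j = k then (-2 : ℂ) else 0) else 0 := by
    intro i
    by_cases h1 : i = j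
    · subst h1
      by_cases h2 : i = k
      · subst h2; simp; norm_num
      · simp [h2]
    · simp [h1, Pi.single_apply]
  rw [Finset.sum_congr rfl (fun i _ => h i)]
  simp

/-- The Clifford algebra, a finite-dimensional complex vector space, with its canonical
vector space topology. -/
instance (m : ℕ) : TopologicalSpace (Cl m) := moduleTopology ℂ (Cl m)

instance (m : ℕ) : IsModuleTopology ℂ (Cl m) := ⟨rfl⟩

instance (m : ℕ) : IsTopologicalAddGroup (Cl m) := IsModuleTopology.topologicalAddGroup ℂ (Cl m)

/-- Clifford algebra valued tempered distributions on `ℝ^m`. -/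
abbrev Dist (m : ℕ) : Type := 𝓢'(E m, Cl m)

/-- The continuous linear map `z ↦ z • a`. -/
def smulRight {m : ℕ} (a : Cl m) : ℂ →L[ℂ] Cl m where
  toLinearMap := LinearMap.toSpanSingleton ℂ (Cl m) a
  cont := IsModuleTopology.continuous_of_linearMap _

/-- Left multiplication by `a`. -/
def mulLeft {m : ℕ} (a : Cl m) : Cl m →L[ℂ] Cl m where
  toLinearMap := LinearMap.mulLeft ℂ a
  cont := IsModuleTopology.continuous_of_linearMap _

/-- The Clifford valued distribution `S a`, for a scalar distribution `S` and a Clifford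
number `a`: `⟨S a, φ⟩ = ⟨S, φ⟩ a`. -/
def Dist.ofScalar {m : ℕ} (S : 𝓢'(E m, ℂ)) (a : Cl m) : Dist m :=
  PointwiseConvergenceCLM.postcomp (E := 𝓢(E m, ℂ)) (smulRight a) S

/-- The delta distribution, with values in the scalars of the Clifford algebra. -/
def delta (m : ℕ) : Dist m := Dist.ofScalar (TemperedDistribution.delta 0) 1

/-- The Dirac operator `∂ = ∑ e_j ∂_j`, acting from the left. -/
def dirac {m : ℕ} (S : Dist m) : Dist m :=
  ∑ j : Fin m, PointwiseConvergenceCLM.postcomp (E := 𝓢(E m, ℂ)) (mulLeft (e j))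
    (∂_{EuclideanSpace.single j (1 : ℝ)} S)

/-- The operator `-Δ_m`. -/
def negLaplacian {m : ℕ} (S : Dist m) : Dist m := -(Laplacian.laplacian S)

/-! ### Spherical means and finite parts -/

/-- The unit sphere of `ℝ^m`. -/
abbrev Sph (m : ℕ) : Type := Metric.sphere (0 : E m) 1

/-- The surface measure of the unit sphere. -/
def surf (m : ℕ) : Measure (Sph m) := (volume : Measure (E m)).toSphere

instance (m : ℕ) : IsFiniteMeasure (surf m) := by unfold surf; infer_instance

/-- The area `σ_m` of the unit sphere. -/
def area (m : ℕ) : ℝ := (surf m).real univ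

/-- The weighted spherical mean `r ↦ (1 / σ_m) ∫ w(ω) φ(r ω) dS(ω)`. -/
def sphMean {m : ℕ} (w : C(Sph m, ℂ)) (φ : 𝓢(E m, ℂ)) (r : ℝ) : ℂ :=
  (area m : ℂ)⁻¹ * ∫ ω : Sph m, w ω * φ (r • (ω : E m)) ∂(surf m)

/-- Hadamard's finite part `Fp ∫_0^∞ r ^ μ g(r) dr`: the Taylor polynomial of `g` at `0` of
degree `< N` is subtracted on `(0, 1)`, where `N` is so large that the difference is integrable,
and the finite part of the integral of its terms over `(0, 1)` is added again; the term with
`r ^ (-1)`, whose integral over `(ε, 1)` is a multiple of `log ε`, contributes nothing. -/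
def finitePart (μ : ℂ) (g : ℝ → ℂ) : ℂ :=
  (∫ r in Ioc (0 : ℝ) 1, (r : ℂ) ^ μ *
      (g r - ∑ k ∈ Finset.range ⌈-μ.re⌉₊, iteratedDeriv k g 0 / (k.factorial : ℂ) * (r : ℂ) ^ k))
    + (∫ r in Ioi (1 : ℝ), (r : ℂ) ^ μ * g r)
    + ∑ k ∈ Finset.range ⌈-μ.re⌉₊,
        if μ + k + 1 = 0 then 0
        else iteratedDeriv k g 0 / (k.factorial : ℂ) / (μ + k + 1)

variable {m : ℕ}

/-- The `k`-th derivative of the spherical mean (see `iteratedDeriv_sphMean`). -/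
def sphMeanDeriv (w : C(Sph m, ℂ)) (φ : 𝓢(E m, ℂ)) (k : ℕ) (r : ℝ) : ℂ :=
  (area m : ℂ)⁻¹ * ∫ ω : Sph m,
    w ω * iteratedFDeriv ℝ k φ (r • (ω : E m)) (fun _ => (ω : E m)) ∂(surf m)

theorem sphere_norm (ω : Sph m) : ‖(ω : E m)‖ = 1 := by simp

theorem continuous_integrand (w : C(Sph m, ℂ)) (φ : 𝓢(E m, ℂ)) (k : ℕ) (r : ℝ) :
    Continuous fun ω : Sph m =>
      w ω * iteratedFDeriv ℝ k φ (r • (ω : E m)) (fun _ => (ω : E m)) := by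
  have h1 : Continuous fun ω : Sph m => iteratedFDeriv ℝ k φ (r • (ω : E m)) :=
    ((φ.smooth ⊤).continuous_iteratedFDeriv (mod_cast le_top)).comp (by fun_prop)
  have h2 : Continuous fun ω : Sph m => (fun _ : Fin k => (ω : E m)) := by fun_prop
  exact w.continuous.mul (continuous_eval.comp (h1.prodMk h2))

theorem norm_integrand_le (w : C(Sph m, ℂ)) (φ : 𝓢(E m, ℂ)) (k : ℕ) (r : ℝ) (ω : Sph m) :
    ‖w ω * iteratedFDeriv ℝ k φ (r • (ω : E m)) (fun _ => (ω : E m))‖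
      ≤ ‖w‖ * SchwartzMap.seminorm ℂ 0 k φ := by
  rw [norm_mul]
  refine mul_le_mul (w.norm_coe_le_norm ω) ?_ (norm_nonneg _) (norm_nonneg _)
  refine (ContinuousMultilinearMap.le_opNorm _ _).trans ?_
  simp only [sphere_norm, Finset.prod_const_one, mul_one]
  exact SchwartzMap.norm_iteratedFDeriv_le_seminorm ℂ φ k _

theorem integrable_integrand (w : C(Sph m, ℂ)) (φ : 𝓢(E m, ℂ)) (k : ℕ) (r : ℝ) :
    Integrable (fun ω : Sph m =>
      w ω * iteratedFDeriv ℝ k φ (r • (ω : E m)) (fun _ => (ω : E m))) (surf m) :=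
  (integrable_const (‖w‖ * SchwartzMap.seminorm ℂ 0 k φ)).mono'
    (continuous_integrand w φ k r).aestronglyMeasurable
    (Filter.Eventually.of_forall fun ω => norm_integrand_le w φ k r ω)

theorem hasDerivAt_sphMeanDeriv (w : C(Sph m, ℂ)) (φ : 𝓢(E m, ℂ)) (k : ℕ) (r : ℝ) :
    HasDerivAt (sphMeanDeriv w φ k) (sphMeanDeriv w φ (k + 1) r) r := by
  unfold sphMeanDeriv
  refine HasDerivAt.const_mul _ ?_
  refine (hasDerivAt_integral_of_dominated_loc_of_deriv_le (𝕜 := ℝ) (s := univ)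
    (bound := fun _ => ‖w‖ * SchwartzMap.seminorm ℂ 0 (k + 1) φ)
    (F' := fun r ω => w ω * iteratedFDeriv ℝ (k + 1) φ (r • (ω : E m)) (fun _ => (ω : E m)))
    Filter.univ_mem ?_ (integrable_integrand w φ k r)
    (continuous_integrand w φ (k + 1) r).aestronglyMeasurable ?_ (integrable_const _) ?_).2
  · exact Filter.Eventually.of_forall fun x =>
      (continuous_integrand w φ k x).aestronglyMeasurable
  · exact Filter.Eventually.of_forall fun ω x _ => norm_integrand_le w φ (k + 1) x ω
  · refine Filter.Eventually.of_forall fun ω x _ => HasDerivAt.const_mul _ ?_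
    have hd : DifferentiableAt ℝ (iteratedFDeriv ℝ k φ) (x • (ω : E m)) :=
      ((φ.smooth ⊤).differentiable_iteratedFDeriv (mod_cast ENat.natCast_lt_top k)) _
    have hl : HasDerivAt (fun t : ℝ => t • (ω : E m)) (ω : E m) x := by
      simpa using (hasDerivAt_id x).smul_const (ω : E m)
    have h := hd.hasFDerivAt.comp_hasDerivAt x hl
    have h2 := ((ContinuousMultilinearMap.apply ℝ (fun _ : Fin k => E m) ℂ
      (fun _ => (ω : E m))).hasFDerivAt (x := iteratedFDeriv ℝ k φ (x • (ω : E m)))).comp_hasDerivAt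
        x h
    rw [iteratedFDeriv_succ_apply_left]
    exact h2

theorem sphMeanDeriv_zero (w : C(Sph m, ℂ)) (φ : 𝓢(E m, ℂ)) :
    sphMeanDeriv w φ 0 = sphMean w φ := by
  ext r
  simp [sphMeanDeriv, sphMean]

theorem iteratedDeriv_sphMean (w : C(Sph m, ℂ)) (φ : 𝓢(E m, ℂ)) (k : ℕ) :
    iteratedDeriv k (sphMean w φ) = sphMeanDeriv w φ k := by
  induction k with
  | zero => rw [iteratedDeriv_zero, sphMeanDeriv_zero]
  | succ k ih =>
    rw [iteratedDeriv_succ, ih]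
    ext r
    exact (hasDerivAt_sphMeanDeriv w φ k r).deriv

theorem sphMeanDeriv_add (w : C(Sph m, ℂ)) (φ ψ : 𝓢(E m, ℂ)) (k : ℕ) (r : ℝ) :
    sphMeanDeriv w (φ + ψ) k r = sphMeanDeriv w φ k r + sphMeanDeriv w ψ k r := by
  unfold sphMeanDeriv
  rw [← mul_add, ← integral_add (integrable_integrand w φ k r) (integrable_integrand w ψ k r)]
  congr 1
  refine integral_congr_ae (Filter.Eventually.of_forall fun ω => ?_)
  have h : iteratedFDeriv ℝ k (⇑(φ + ψ)) (r • (ω : E m))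
      = iteratedFDeriv ℝ k φ (r • (ω : E m)) + iteratedFDeriv ℝ k ψ (r • (ω : E m)) := by
    have hφ : ContDiffAt ℝ k (⇑φ) (r • (ω : E m)) := (φ.smooth k).contDiffAt
    have hψ : ContDiffAt ℝ k (⇑ψ) (r • (ω : E m)) := (ψ.smooth k).contDiffAt
    exact iteratedFDeriv_add_apply hφ hψ
  simp only [h, _root_.add_apply, mul_add]

theorem sphMeanDeriv_smul (w : C(Sph m, ℂ)) (c : ℂ) (φ : 𝓢(E m, ℂ)) (k : ℕ) (r : ℝ) :
    sphMeanDeriv w (c • φ) k r = c * sphMeanDeriv w φ k r := by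
  unfold sphMeanDeriv
  rw [mul_left_comm, ← integral_const_mul c]
  congr 1
  refine integral_congr_ae (Filter.Eventually.of_forall fun ω => ?_)
  have h : iteratedFDeriv ℝ k (⇑(c • φ)) (r • (ω : E m))
      = c • iteratedFDeriv ℝ k (⇑φ) (r • (ω : E m)) := by
    have hφ : ContDiffAt ℝ k (⇑φ) (r • (ω : E m)) := (φ.smooth k).contDiffAt
    exact iteratedFDeriv_const_smul_apply hφ
  simp only [h, _root_.smul_apply, smul_eq_mul]
  ring

theorem sphMean_add (w : C(Sph m, ℂ)) (φ ψ : 𝓢(E m, ℂ)) (r : ℝ) :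
    sphMean w (φ + ψ) r = sphMean w φ r + sphMean w ψ r := by
  simpa only [sphMeanDeriv_zero] using sphMeanDeriv_add w φ ψ 0 r

theorem sphMean_smul (w : C(Sph m, ℂ)) (c : ℂ) (φ : 𝓢(E m, ℂ)) (r : ℝ) :
    sphMean w (c • φ) r = c * sphMean w φ r := by
  simpa only [sphMeanDeriv_zero] using sphMeanDeriv_smul w c φ 0 r

/-- A constant in the seminorm estimates of spherical means. -/
def meanConst (w : C(Sph m, ℂ)) : ℝ := |(area m)⁻¹| * (‖w‖ * area m)

theorem area_nonneg (m : ℕ) : 0 ≤ area m := measureReal_nonneg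

theorem meanConst_nonneg (w : C(Sph m, ℂ)) : 0 ≤ meanConst w := by
  have := area_nonneg m
  unfold meanConst; positivity

theorem norm_sphMeanDeriv_le (w : C(Sph m, ℂ)) (φ : 𝓢(E m, ℂ)) (k : ℕ) (r : ℝ) :
    ‖sphMeanDeriv w φ k r‖ ≤ meanConst w * SchwartzMap.seminorm ℂ 0 k φ := by
  unfold sphMeanDeriv meanConst
  rw [norm_mul, mul_assoc]
  refine mul_le_mul (by simp) ?_ (norm_nonneg _) (abs_nonneg _)
  refine (norm_integral_le_of_norm_le_const
    (Filter.Eventually.of_forall fun ω => norm_integrand_le w φ k r ω)).trans (le_of_eq ?_)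
  unfold area; ring

theorem norm_sphMean_decay (w : C(Sph m, ℂ)) (φ : 𝓢(E m, ℂ)) (k : ℕ) {r : ℝ} (hr : 0 ≤ r) :
    r ^ k * ‖sphMean w φ r‖ ≤ meanConst w * SchwartzMap.seminorm ℂ k 0 φ := by
  unfold sphMean meanConst
  have h : ‖∫ ω : Sph m, ((r ^ k : ℝ) : ℂ) * (w ω * φ (r • (ω : E m))) ∂(surf m)‖
      ≤ ‖w‖ * SchwartzMap.seminorm ℂ k 0 φ * (surf m).real univ := by
    refine norm_integral_le_of_norm_le_const (Filter.Eventually.of_forall fun ω => ?_)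
    have h1 := SchwartzMap.norm_pow_mul_le_seminorm ℂ φ k (r • (ω : E m))
    rw [norm_smul, sphere_norm, mul_one, Real.norm_of_nonneg hr] at h1
    rw [norm_mul, norm_mul, Complex.norm_real, Real.norm_of_nonneg (pow_nonneg hr k)]
    calc r ^ k * (‖w ω‖ * ‖φ (r • (ω : E m))‖) = ‖w ω‖ * (r ^ k * ‖φ (r • (ω : E m))‖) := by ring
      _ ≤ ‖w‖ * SchwartzMap.seminorm ℂ k 0 φ :=
        mul_le_mul (w.norm_coe_le_norm ω) h1 (by positivity) (norm_nonneg _)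
  rw [integral_const_mul, norm_mul, Complex.norm_real, Real.norm_of_nonneg (pow_nonneg hr k)] at h
  rw [norm_mul, norm_inv, Complex.norm_real, Real.norm_eq_abs, ← abs_inv]
  calc r ^ k * (|(area m)⁻¹| * ‖∫ ω : Sph m, w ω * φ (r • (ω : E m)) ∂(surf m)‖)
      = |(area m)⁻¹| * (r ^ k * ‖∫ ω : Sph m, w ω * φ (r • (ω : E m)) ∂(surf m)‖) := by ring
    _ ≤ |(area m)⁻¹| * (‖w‖ * SchwartzMap.seminorm ℂ k 0 φ * (surf m).real univ) :=
        mul_le_mul_of_nonneg_left h (abs_nonneg _)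
    _ = _ := by unfold area; ring

/-- The Taylor remainder of a function given with its derivatives. -/
theorem taylor_bound (N : ℕ) : ∀ (G : ℕ → ℝ → ℂ) (M : ℝ),
    (∀ k r, HasDerivAt (G k) (G (k + 1) r) r) → (∀ r, ‖G N r‖ ≤ M) →
    ∀ r ∈ Icc (0 : ℝ) 1,
      ‖G 0 r - ∑ k ∈ Finset.range N, G k 0 / (k.factorial : ℂ) * (r : ℂ) ^ k‖ ≤ M * r ^ N := by
  induction N with
  | zero => intro G M _ hM r _; simpa using hM r
  | succ N ih =>
    intro G M hG hM r hr
    have hM0 : 0 ≤ M := (norm_nonneg _).trans (hM 0)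
    have ih' := ih (fun k => G (k + 1)) M (fun k r => hG (k + 1) r) hM
    let h : ℝ → ℂ := fun r =>
      G 0 r - ∑ k ∈ Finset.range (N + 1), G k 0 / (k.factorial : ℂ) * (r : ℂ) ^ k
    have hd : ∀ x : ℝ, HasDerivAt h
        (G 1 x - ∑ k ∈ Finset.range N, G (k + 1) 0 / (k.factorial : ℂ) * (x : ℂ) ^ k) x := by
      intro x
      refine (hG 0 x).sub ?_
      have hs : HasDerivAt (fun r : ℝ =>
          ∑ k ∈ Finset.range (N + 1), G k 0 / (k.factorial : ℂ) * (r : ℂ) ^ k)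
          (∑ k ∈ Finset.range (N + 1),
            G k 0 / (k.factorial : ℂ) * ((k : ℂ) * (x : ℂ) ^ (k - 1))) x := by
        refine HasDerivAt.fun_sum fun k _ => HasDerivAt.const_mul _ ?_
        simpa using (hasDerivAt_pow k (x : ℂ)).comp_ofReal
      refine hs.congr_deriv ?_
      rw [Finset.sum_range_succ']
      simp only [Nat.cast_zero, zero_mul, mul_zero, add_zero, Nat.add_sub_cancel]
      refine Finset.sum_congr rfl fun k _ => ?_
      rw [Nat.factorial_succ]
      have h1 : ((k : ℂ) + 1) ≠ 0 := by exact_mod_cast Nat.succ_ne_zero k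
      have h2 : (k.factorial : ℂ) ≠ 0 := by exact_mod_cast k.factorial_ne_zero
      push_cast
      field_simp
    have h0 : h 0 = 0 := by
      simp only [h]
      rw [Finset.sum_range_succ']
      simp
    have hb : ∀ x ∈ Icc (0 : ℝ) r, ‖deriv h x‖ ≤ M * r ^ N := by
      intro x hx
      rw [(hd x).deriv]
      refine (ih' x ⟨hx.1, hx.2.trans hr.2⟩).trans ?_
      exact mul_le_mul_of_nonneg_left (pow_le_pow_left₀ hx.1 hx.2 N) hM0
    have := Convex.norm_image_sub_le_of_norm_deriv_le (f := h) (s := Icc 0 r) (x := 0) (y := r)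
      (fun x _ => (hd x).differentiableAt) hb (convex_Icc 0 r) ⟨le_rfl, hr.1⟩ ⟨hr.1, le_rfl⟩
    rw [h0, sub_zero, sub_zero, Real.norm_of_nonneg hr.1] at this
    calc _ ≤ M * r ^ N * r := this
      _ = M * r ^ (N + 1) := by ring

theorem continuous_sphMean (w : C(Sph m, ℂ)) (φ : 𝓢(E m, ℂ)) : Continuous (sphMean w φ) := by
  rw [← sphMeanDeriv_zero]
  exact continuous_iff_continuousAt.2 fun r => (hasDerivAt_sphMeanDeriv w φ 0 r).continuousAt

theorem continuousOn_cpow (μ : ℂ) : ContinuousOn (fun r : ℝ => (r : ℂ) ^ μ) (Ioi 0) := by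
  intro r hr
  refine ContinuousAt.continuousWithinAt ?_
  exact (Complex.continuous_ofReal.continuousAt).cpow continuousAt_const
    (Complex.ofReal_mem_slitPlane.2 hr)

/-- The integrand of the finite part near the origin. -/
def innerFun (μ : ℂ) (w : C(Sph m, ℂ)) (φ : 𝓢(E m, ℂ)) (r : ℝ) : ℂ :=
  (r : ℂ) ^ μ * (sphMean w φ r - ∑ k ∈ Finset.range ⌈-μ.re⌉₊,
    sphMeanDeriv w φ k 0 / (k.factorial : ℂ) * (r : ℂ) ^ k)

theorem norm_innerFun_le (μ : ℂ) (w : C(Sph m, ℂ)) (φ : 𝓢(E m, ℂ)) {r : ℝ}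
    (hr : r ∈ Ioc (0 : ℝ) 1) :
    ‖innerFun μ w φ r‖ ≤ meanConst w * SchwartzMap.seminorm ℂ 0 ⌈-μ.re⌉₊ φ := by
  have h := taylor_bound ⌈-μ.re⌉₊ (sphMeanDeriv w φ) _ (hasDerivAt_sphMeanDeriv w φ)
    (norm_sphMeanDeriv_le w φ ⌈-μ.re⌉₊) r ⟨hr.1.le, hr.2⟩
  rw [sphMeanDeriv_zero] at h
  unfold innerFun
  have hA : 0 ≤ meanConst w * SchwartzMap.seminorm ℂ 0 ⌈-μ.re⌉₊ φ :=
    (norm_nonneg _).trans (norm_sphMeanDeriv_le w φ ⌈-μ.re⌉₊ 0)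
  rw [norm_mul, Complex.norm_cpow_eq_rpow_re_of_pos hr.1]
  calc _ ≤ r ^ μ.re * (meanConst w * SchwartzMap.seminorm ℂ 0 ⌈-μ.re⌉₊ φ * r ^ ⌈-μ.re⌉₊) :=
        mul_le_mul_of_nonneg_left h (Real.rpow_nonneg hr.1.le _)
    _ = (meanConst w * SchwartzMap.seminorm ℂ 0 ⌈-μ.re⌉₊ φ) * r ^ (μ.re + (⌈-μ.re⌉₊ : ℕ)) := by
        rw [Real.rpow_add hr.1, Real.rpow_natCast]; ring
    _ ≤ (meanConst w * SchwartzMap.seminorm ℂ 0 ⌈-μ.re⌉₊ φ) * 1 := by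
        refine mul_le_mul_of_nonneg_left ?_ hA
        refine Real.rpow_le_one hr.1.le hr.2 ?_
        have := Nat.le_ceil (-μ.re)
        linarith
    _ = _ := mul_one _

theorem integrableOn_innerFun (μ : ℂ) (w : C(Sph m, ℂ)) (φ : 𝓢(E m, ℂ)) :
    IntegrableOn (innerFun μ w φ) (Ioc 0 1) := by
  refine Integrable.mono' (g := fun _ => meanConst w * SchwartzMap.seminorm ℂ 0 ⌈-μ.re⌉₊ φ)
    (integrable_const _) ?_ ?_
  · have hs : MeasurableSet (Ioc (0 : ℝ) 1) := measurableSet_Ioc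
    refine ContinuousOn.aestronglyMeasurable ?_ hs
    refine ((continuousOn_cpow μ).mono Ioc_subset_Ioi_self).mul (Continuous.continuousOn ?_)
    have := continuous_sphMean w φ
    fun_prop
  · refine (ae_restrict_iff' measurableSet_Ioc).2 (Filter.Eventually.of_forall fun r hr => ?_)
    exact norm_innerFun_le μ w φ hr

theorem norm_outer_le (μ : ℂ) (w : C(Sph m, ℂ)) (φ : 𝓢(E m, ℂ)) {r : ℝ}
    (hr : r ∈ Ioi (1 : ℝ)) :
    ‖(r : ℂ) ^ μ * sphMean w φ r‖
      ≤ meanConst w * SchwartzMap.seminorm ℂ (⌈μ.re⌉₊ + 2) 0 φ * r ^ (-2 : ℝ) := by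
  have hr0 : (0 : ℝ) < r := (zero_lt_one' ℝ).trans hr
  have h := norm_sphMean_decay w φ (⌈μ.re⌉₊ + 2) hr0.le
  rw [norm_mul, Complex.norm_cpow_eq_rpow_re_of_pos hr0]
  have h1 : r ^ μ.re ≤ r ^ (⌈μ.re⌉₊ + 2) * r ^ (-2 : ℝ) := by
    rw [← Real.rpow_natCast, ← Real.rpow_add hr0]
    refine Real.rpow_le_rpow_of_exponent_le (le_of_lt hr) ?_
    have := Nat.le_ceil μ.re
    push_cast; linarith
  calc r ^ μ.re * ‖sphMean w φ r‖
      ≤ (r ^ (⌈μ.re⌉₊ + 2) * r ^ (-2 : ℝ)) * ‖sphMean w φ r‖ :=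
        mul_le_mul_of_nonneg_right h1 (norm_nonneg _)
    _ = (r ^ (⌈μ.re⌉₊ + 2) * ‖sphMean w φ r‖) * r ^ (-2 : ℝ) := by ring
    _ ≤ _ := mul_le_mul_of_nonneg_right h (Real.rpow_nonneg hr0.le _)

theorem integrableOn_outer (μ : ℂ) (w : C(Sph m, ℂ)) (φ : 𝓢(E m, ℂ)) :
    IntegrableOn (fun r : ℝ => (r : ℂ) ^ μ * sphMean w φ r) (Ioi 1) := by
  refine Integrable.mono' (((integrableOn_Ioi_rpow_of_lt (a := -2) (by norm_num)
    (zero_lt_one' ℝ))).const_mul (meanConst w * SchwartzMap.seminorm ℂ (⌈μ.re⌉₊ + 2) 0 φ)) ?_ ?_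
  · have hs : MeasurableSet (Ioi (1 : ℝ)) := measurableSet_Ioi
    refine ContinuousOn.aestronglyMeasurable ?_ hs
    exact ((continuousOn_cpow μ).mono (Ioi_subset_Ioi (zero_le_one' ℝ))).mul
      (continuous_sphMean w φ).continuousOn
  · refine (ae_restrict_iff' measurableSet_Ioi).2 (Filter.Eventually.of_forall fun r hr => ?_)
    exact norm_outer_le μ w φ hr

theorem finitePart_sphMean (μ : ℂ) (w : C(Sph m, ℂ)) (φ : 𝓢(E m, ℂ)) :
    finitePart μ (sphMean w φ) = (∫ r in Ioc (0 : ℝ) 1, innerFun μ w φ r)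
      + (∫ r in Ioi (1 : ℝ), (r : ℂ) ^ μ * sphMean w φ r)
      + ∑ k ∈ Finset.range ⌈-μ.re⌉₊, if μ + k + 1 = 0 then 0
        else sphMeanDeriv w φ k 0 / (k.factorial : ℂ) / (μ + k + 1) := by
  simp only [finitePart, iteratedDeriv_sphMean, innerFun]

theorem finitePart_add (μ : ℂ) (w : C(Sph m, ℂ)) (φ ψ : 𝓢(E m, ℂ)) :
    finitePart μ (sphMean w (φ + ψ))
      = finitePart μ (sphMean w φ) + finitePart μ (sphMean w ψ) := by
  simp only [finitePart_sphMean]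
  have h1 : (∫ r in Ioc (0 : ℝ) 1, innerFun μ w (φ + ψ) r)
      = (∫ r in Ioc (0 : ℝ) 1, innerFun μ w φ r) + ∫ r in Ioc (0 : ℝ) 1, innerFun μ w ψ r := by
    rw [← integral_add (integrableOn_innerFun μ w φ) (integrableOn_innerFun μ w ψ)]
    refine integral_congr_ae (Filter.Eventually.of_forall fun r => ?_)
    simp only [innerFun, sphMean_add, sphMeanDeriv_add, add_div, add_mul, Finset.sum_add_distrib]
    ring
  have h2 : (∫ r in Ioi (1 : ℝ), (r : ℂ) ^ μ * sphMean w (φ + ψ) r)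
      = (∫ r in Ioi (1 : ℝ), (r : ℂ) ^ μ * sphMean w φ r)
        + ∫ r in Ioi (1 : ℝ), (r : ℂ) ^ μ * sphMean w ψ r := by
    rw [← integral_add (integrableOn_outer μ w φ) (integrableOn_outer μ w ψ)]
    simp only [sphMean_add, mul_add]
  have h3 : (∑ k ∈ Finset.range ⌈-μ.re⌉₊, if μ + k + 1 = 0 then 0
        else sphMeanDeriv w (φ + ψ) k 0 / (k.factorial : ℂ) / (μ + k + 1))
      = (∑ k ∈ Finset.range ⌈-μ.re⌉₊, if μ + k + 1 = 0 then 0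
        else sphMeanDeriv w φ k 0 / (k.factorial : ℂ) / (μ + k + 1))
      + ∑ k ∈ Finset.range ⌈-μ.re⌉₊, if μ + k + 1 = 0 then 0
        else sphMeanDeriv w ψ k 0 / (k.factorial : ℂ) / (μ + k + 1) := by
    rw [← Finset.sum_add_distrib]
    refine Finset.sum_congr rfl fun k _ => ?_
    split_ifs
    · simp
    · rw [sphMeanDeriv_add, add_div, add_div]
  rw [h1, h2, h3]; ring

theorem finitePart_smul (μ : ℂ) (w : C(Sph m, ℂ)) (c : ℂ) (φ : 𝓢(E m, ℂ)) :
    finitePart μ (sphMean w (c • φ)) = c * finitePart μ (sphMean w φ) := by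
  simp only [finitePart_sphMean]
  have h1 : (∫ r in Ioc (0 : ℝ) 1, innerFun μ w (c • φ) r)
      = c * ∫ r in Ioc (0 : ℝ) 1, innerFun μ w φ r := by
    rw [← integral_const_mul]
    refine integral_congr_ae (Filter.Eventually.of_forall fun r => ?_)
    simp only [innerFun, sphMean_smul, sphMeanDeriv_smul, mul_div_assoc, mul_assoc,
      ← Finset.mul_sum]
    ring
  have h2 : (∫ r in Ioi (1 : ℝ), (r : ℂ) ^ μ * sphMean w (c • φ) r)
      = c * ∫ r in Ioi (1 : ℝ), (r : ℂ) ^ μ * sphMean w φ r := by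
    rw [← integral_const_mul]
    refine integral_congr_ae (Filter.Eventually.of_forall fun r => ?_)
    simp only [sphMean_smul]
    ring
  have h3 : (∑ k ∈ Finset.range ⌈-μ.re⌉₊, if μ + k + 1 = 0 then 0
        else sphMeanDeriv w (c • φ) k 0 / (k.factorial : ℂ) / (μ + k + 1))
      = c * ∑ k ∈ Finset.range ⌈-μ.re⌉₊, if μ + k + 1 = 0 then 0
        else sphMeanDeriv w φ k 0 / (k.factorial : ℂ) / (μ + k + 1) := by
    rw [Finset.mul_sum]
    refine Finset.sum_congr rfl fun k _ => ?_
    split_ifs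
    · simp
    · rw [sphMeanDeriv_smul, mul_div_assoc, mul_div_assoc]
  rw [h1, h2, h3]; ring

theorem finitePart_bound (μ : ℂ) (w : C(Sph m, ℂ)) :
    ∃ (s : Finset (ℕ × ℕ)) (C : ℝ), 0 ≤ C ∧ ∀ φ : 𝓢(E m, ℂ),
      ‖finitePart μ (sphMean w φ)‖ ≤ C * s.sup (schwartzSeminormFamily ℂ (E m) ℂ) φ := by
  classical
  let N := ⌈-μ.re⌉₊
  let K := ⌈μ.re⌉₊ + 2
  let s : Finset (ℕ × ℕ) := insert (K, 0) ((Finset.range (N + 1)).image fun k => (0, k))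
  let c : ℕ → ℝ := fun k => ‖((k.factorial : ℂ))⁻¹ * (μ + k + 1)⁻¹‖
  let J : ℝ := ∫ r in Ioi (1 : ℝ), r ^ (-2 : ℝ)
  have hJ : 0 ≤ J := setIntegral_nonneg measurableSet_Ioi fun r hr =>
    Real.rpow_nonneg ((zero_le_one' ℝ).trans (le_of_lt hr)) _
  have hw := meanConst_nonneg w
  refine ⟨s, meanConst w * (1 + J + ∑ k ∈ Finset.range N, c k), ?_, fun φ => ?_⟩
  · have : 0 ≤ ∑ k ∈ Finset.range N, c k := Finset.sum_nonneg fun k _ => norm_nonneg _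
    positivity
  set P := s.sup (schwartzSeminormFamily ℂ (E m) ℂ) φ with hP
  have hle : ∀ i ∈ s, SchwartzMap.seminorm ℂ i.1 i.2 φ ≤ P := fun i hi => by
    have h : schwartzSeminormFamily ℂ (E m) ℂ i ≤ s.sup (schwartzSeminormFamily ℂ (E m) ℂ) :=
      Finset.le_sup hi
    exact h φ
  have hk : ∀ k ≤ N, SchwartzMap.seminorm ℂ 0 k φ ≤ P := fun k hkN =>
    hle (0, k) (Finset.mem_insert_of_mem
      (Finset.mem_image_of_mem _ (Finset.mem_range.2 (Nat.lt_succ_of_le hkN))))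
  have hK : SchwartzMap.seminorm ℂ K 0 φ ≤ P := hle (K, 0) (Finset.mem_insert_self _ _)
  have h1 : ‖∫ r in Ioc (0 : ℝ) 1, innerFun μ w φ r‖ ≤ meanConst w * P := by
    have := norm_setIntegral_le_of_norm_le_const (μ := volume) (s := Ioc (0 : ℝ) 1)
      (f := innerFun μ w φ) (C := meanConst w * P) (by simp)
      (fun r hr => (norm_innerFun_le μ w φ hr).trans
        (mul_le_mul_of_nonneg_left (hk N le_rfl) hw))
    simpa using this
  have h2 : ‖∫ r in Ioi (1 : ℝ), (r : ℂ) ^ μ * sphMean w φ r‖ ≤ meanConst w * P * J := by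
    rw [← integral_const_mul]
    refine norm_integral_le_of_norm_le ((integrableOn_Ioi_rpow_of_lt (a := -2) (by norm_num)
      zero_lt_one).const_mul _) ?_
    refine (ae_restrict_iff' measurableSet_Ioi).2 (Filter.Eventually.of_forall fun r hr => ?_)
    refine (norm_outer_le μ w φ hr).trans ?_
    refine mul_le_mul_of_nonneg_right (mul_le_mul_of_nonneg_left hK hw) ?_
    exact Real.rpow_nonneg ((zero_le_one' ℝ).trans (le_of_lt hr)) _
  have h3 : ‖∑ k ∈ Finset.range N, if μ + k + 1 = 0 then 0
        else sphMeanDeriv w φ k 0 / (k.factorial : ℂ) / (μ + k + 1)‖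
      ≤ meanConst w * P * ∑ k ∈ Finset.range N, c k := by
    refine (norm_sum_le _ _).trans ?_
    rw [Finset.mul_sum]
    refine Finset.sum_le_sum fun k hkN => ?_
    have hb : ‖sphMeanDeriv w φ k 0‖ ≤ meanConst w * P :=
      (norm_sphMeanDeriv_le w φ k 0).trans
        (mul_le_mul_of_nonneg_left (hk k (Finset.mem_range.1 hkN).le) hw)
    have hc : 0 ≤ c k := norm_nonneg _
    split_ifs
    · rw [norm_zero]
      exact mul_nonneg ((norm_nonneg _).trans hb) hc
    · rw [div_div, div_eq_mul_inv, norm_mul, mul_inv]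
      exact mul_le_mul_of_nonneg_right hb hc
  rw [finitePart_sphMean]
  calc _ ≤ meanConst w * P + meanConst w * P * J + meanConst w * P * ∑ k ∈ Finset.range N, c k :=
        norm_add₃_le.trans (add_le_add (add_le_add h1 h2) h3)
    _ = _ := by ring

/-- The scalar tempered distribution `σ_m ⟨Fp r_+ ^ (λ + m - 1), (1 / σ_m) ∫ w(ω) φ(r ω) dS(ω)⟩`,
that is `Fp |x| ^ λ w(x / |x|)`. -/
def fpRadial (w : C(Sph m, ℂ)) (lam : ℂ) : 𝓢'(E m, ℂ) :=
  ContinuousLinearMap.toPointwiseConvergenceCLM ℂ (RingHom.id ℂ) 𝓢(E m, ℂ) ℂ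
    (SchwartzMap.mkCLMtoNormedSpace (𝕜 := ℂ) (σ := RingHom.id ℂ)
      (fun φ => (area m : ℂ) * finitePart (lam + m - 1) (sphMean w φ))
      (fun φ ψ => by rw [finitePart_add, mul_add])
      (fun c φ => by rw [finitePart_smul, RingHom.id_apply, smul_eq_mul]; ring)
      (by
        obtain ⟨s, C, hC, h⟩ := finitePart_bound (lam + m - 1) w
        refine ⟨s, |area m| * C, by positivity, fun φ => ?_⟩
        rw [norm_mul, Complex.norm_real, Real.norm_eq_abs, mul_assoc]
        exact mul_le_mul_of_nonneg_left (h φ) (abs_nonneg _)))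

theorem fpRadial_apply (w : C(Sph m, ℂ)) (lam : ℂ) (φ : 𝓢(E m, ℂ)) :
    fpRadial w lam φ = (area m : ℂ) * finitePart (lam + m - 1) (sphMean w φ) := rfl

/-- The coordinate `ω_j` on the unit sphere. -/
def coord (j : Fin m) : C(Sph m, ℂ) where
  toFun ω := (((ω : E m) j : ℝ) : ℂ)
  continuous_toFun := by fun_prop

variable (m)

/-- The distribution `T_λ = Fp r ^ λ`. -/
def T (lam : ℂ) : Dist m := Dist.ofScalar (fpRadial 1 lam) 1

/-- The distribution `U_λ = Fp r ^ λ ω`, where `ω = x / |x| = ∑ e_j ω_j`. -/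
def U (lam : ℂ) : Dist m := ∑ j : Fin m, Dist.ofScalar (fpRadial (coord j) lam) (e j)

open Classical in
/-- The normalized distribution `T*_λ`. -/
def Tstar (lam : ℂ) : Dist m :=
  if h : ∃ l : ℕ, lam = -m - 2 * l then
    ((Real.pi : ℂ) ^ ((m : ℂ) / 2 - h.choose) /
      (2 ^ (2 * h.choose) * Complex.Gamma ((m : ℂ) / 2 + h.choose))) •
        negLaplacian^[h.choose] (delta m)
  else
    ((Real.pi : ℂ) ^ ((lam + m) / 2) / Complex.Gamma ((lam + m) / 2)) • T m lam

open Classical in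
/-- The normalized distribution `U*_λ`. -/
def Ustar (lam : ℂ) : Dist m :=
  if h : ∃ l : ℕ, lam = -m - 2 * l - 1 then
    (-((Real.pi : ℂ) ^ ((m : ℂ) / 2 - h.choose) /
      (2 ^ (2 * h.choose + 1) * Complex.Gamma ((m : ℂ) / 2 + h.choose + 1)))) •
        dirac^[2 * h.choose + 1] (delta m)
  else
    ((Real.pi : ℂ) ^ ((lam + m + 1) / 2) / Complex.Gamma ((lam + m + 1) / 2)) • U m lam

/-- The kernel `(-Δ_m) ^ β δ`, for `β ∉ {-m/2 - n : n = 0, 1, 2, …}`. -/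
def laplaceDelta (β : ℂ) : Dist m :=
  ((2 : ℂ) ^ (2 * β) * Complex.Gamma ((m + 2 * β) / 2) / (Real.pi : ℂ) ^ ((m - 2 * β) / 2)) •
    Tstar m (-m - 2 * β)

/-- The kernel `(-Δ_m) ^ β H`, for `β ∉ {-(m+1)/2 - n : n = 0, 1, 2, …}`. -/
def laplaceH (β : ℂ) : Dist m :=
  (-((2 : ℂ) ^ (2 * β) * Complex.Gamma ((m + 2 * β + 1) / 2) /
    (Real.pi : ℂ) ^ ((m - 2 * β + 1) / 2))) • Ustar m (-m - 2 * β)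

variable {m}

/-! ### Convolution -/

theorem hasTemperateGrowth_const_sub (x : E m) :
    Function.HasTemperateGrowth (fun y : E m => x - y) :=
  (Function.HasTemperateGrowth.const x).sub
    (ContinuousLinearMap.id ℝ (E m)).hasTemperateGrowth

theorem antilipschitz_const_sub (x : E m) : AntilipschitzWith 1 (fun y : E m => x - y) :=
  (IsometryEquiv.subLeft x).isometry.antilipschitz

/-- The Schwartz function `y ↦ φ(x - y)`. -/
def reflTranslate (x : E m) (φ : 𝓢(E m, ℂ)) : 𝓢(E m, ℂ) :=
  SchwartzMap.compCLMOfAntilipschitz ℂ (hasTemperateGrowth_const_sub x)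
    (antilipschitz_const_sub x) φ

theorem reflTranslate_apply (x y : E m) (φ : 𝓢(E m, ℂ)) : reflTranslate x φ y = φ (x - y) := rfl

/-- The regularization `(S * φ)(x) = ⟨S(y), φ(x - y)⟩` of a tempered distribution by a
test function. -/
def reg (S : Dist m) (φ : 𝓢(E m, ℂ)) (x : E m) : Cl m := S (reflTranslate x φ)

/-- `R` is the convolution `S * T` of two (Clifford valued) tempered distributions in the usual
sense of distribution theory (the definition of Chevalley and Shiraishi):
for all test functions `φ, ψ`, the convolution of the smooth functions `S * φ` and `T * ψ` exists
as an absolutely convergent integral and is equal to `(R * φ) * ψ`. Integrals of functions with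
values in the finite-dimensional space `Cl m` are taken componentwise. -/
def IsConvolution (S T R : Dist m) : Prop :=
  ∀ (φ ψ : 𝓢(E m, ℂ)) (x : E m) (ℓ : Module.Dual ℂ (Cl m)),
    Integrable (fun y => ℓ (reg S φ y * reg T ψ (x - y))) ∧
    Integrable (fun y => ℓ (ψ (x - y) • reg R φ y)) ∧
    ∫ y, ℓ (reg S φ y * reg T ψ (x - y)) = ∫ y, ℓ (ψ (x - y) • reg R φ y)

/-- A family of distributions depends holomorphically (in the weak sense) on a parameter in `D`. -/
def HolomorphicFamily (D : Set (ℂ × ℂ)) (F : ℂ × ℂ → Dist m) : Prop :=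
  ∀ (φ : 𝓢(E m, ℂ)) (ℓ : Module.Dual ℂ (Cl m)), DifferentiableOn ℂ (fun p => ℓ (F p φ)) D

/-- `C p`, for `p = (α, β) ∈ D`, is the convolution `A α * B β` of two holomorphic families in the
sense of analytic continuation: `D` is open and connected, everything is holomorphic on `D`, and
`C (α, β)` is the convolution `A α * B β` in the usual sense for all `(α, β)` in some non-empty
open subset of `D`. By the identity theorem `C` is determined by `A`, `B` and `D`. -/
def IsConvolutionByContinuation (A B : ℂ → Dist m) (D : Set (ℂ × ℂ)) (C : ℂ × ℂ → Dist m) :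
    Prop :=
  IsOpen D ∧ IsConnected D ∧
    HolomorphicFamily D (fun p => A p.1) ∧ HolomorphicFamily D (fun p => B p.2) ∧
    HolomorphicFamily D C ∧
    ∃ V ⊆ D, IsOpen V ∧ V.Nonempty ∧ ∀ p ∈ V, IsConvolution (A p.1) (B p.2) (C p)

end CliffordKernel

end

open CliffordKernel

open scoped SchwartzMap LineDeriv

noncomputable section

namespace CliffordKernel

open MeasureTheory Set

variable {m : ℕ}

/-! Put λ = -m - 2α. Each scalar component of the kernels is a constant times `fam p w λ`, the
finite part of |x|^λ w(x/|x|) multiplied by π^((λ+m+p)/2) / Γ((λ+m+p)/2), where w = 1 and p = 0, or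
w = ω_j and p = 1. This family is entire in λ (`differentiable_fam`): a pole of the finite part can
only come from a Taylor coefficient of the spherical mean whose order has the parity of p, and at
such points 1/Γ vanishes. The values there are the derivatives of δ prescribed in the definitions
(`Tstar_apply`, `Ustar_apply`).

Formally the identity is a multiplication of Fourier symbols. The Fourier transform exchanges `fam p
w λ` and `fam p w (-λ - m)` up to the factor (-i)^p (`HarmonicData.fam_fourier`). Hence (-Δ)^α H has
a symbol proportional to |ξ|^(2α) ω, while (-Δ)^γ δ has one proportional to |ξ|^(2γ), and ω² = -1
(`dual_sum_coord_mul`) cancels the sign of (-i)². The transform formula comes from writing |x|^λ w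
as a superposition of Gaussians in the strip -m < Re λ < 0, where t ↦ 1/t exchanges the two
exponents; the identity theorem extends it to all λ.

To obtain an actual convolution, the regularizations are shown to be O((1+|y|)^a) for every a > Re
λ, locally uniformly in λ (`exists_fam_le`), and rapidly decreasing at the poles
(`exists_fam_le_of_pole`). So the convolution integrals converge absolutely and are holomorphic in
the parameters if Re(α+β) > -m/2, or if one factor is supported at the origin (`vecConv_aux`). For
Re α > -m/2 and Re β > 0 the convolution theorem for functions applies
(`convDefect_eq_zero_of_base`). The identity theorem on a complex line carries the identity to
Re(α+β) > -m/2, and then to the remaining pole cases by varying the other parameter. `convDefect` is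
multiplied by reciprocal Gamma functions beforehand, so that no singularity obstructs these
continuations.

For the statement by continuation, the kernels are holomorphic away from the poles of their Gamma
factors. The admissible set is connected because the complex line through two admissible points
meets the excluded set in a countable set. -/

/-! ### Holomorphic parameter integrals and Taylor remainders -/

/-- A locally dominated integral of holomorphic functions is holomorphic. -/
theorem differentiableAt_integral_of_dominated {X : Type*} [MeasurableSpace X] {ν : Measure X}
    {f : ℂ → X → ℂ} {z₀ : ℂ} {s : Set ℂ} (hs : s ∈ nhds z₀) {bound : X → ℝ}
    (hm : ∀ z ∈ s, AEStronglyMeasurable (f z) ν)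
    (hd : ∀ᵐ x ∂ν, DifferentiableOn ℂ (fun z => f z x) s)
    (hb : ∀ᵐ x ∂ν, ∀ z ∈ s, ‖f z x‖ ≤ bound x) (hbi : Integrable bound ν) :
    DifferentiableAt ℂ (fun z => ∫ x, f z x ∂ν) z₀ := by
  obtain ⟨R, hR, hRs⟩ := Metric.mem_nhds_iff.1 hs
  have hR2 : (0 : ℝ) < R / 2 := by positivity
  have hz₀ : z₀ ∈ s := mem_of_mem_nhds hs
  have hsub : Metric.ball z₀ (R / 2) ⊆ s := (Metric.ball_subset_ball (by linarith)).trans hRs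
  have hdiff : ∀ x, DifferentiableOn ℂ (fun z => f z x) s → ∀ z ∈ Metric.ball z₀ R,
      DifferentiableAt ℂ (fun z => f z x) z := fun x hx z hz =>
    (hx.mono hRs).differentiableAt (Metric.isOpen_ball.mem_nhds hz)
  refine (hasDerivAt_integral_of_dominated_loc_of_deriv_le (𝕜 := ℂ)
    (s := Metric.ball z₀ (R / 2)) (F' := fun z x => deriv (fun z => f z x) z)
    (bound := fun x => bound x / (R / 4)) (Metric.ball_mem_nhds _ hR2) ?_
    (hbi.mono' (hm z₀ hz₀) (hb.mono fun x hx => hx z₀ hz₀)) ?_ ?_ (hbi.div_const _) ?_).2.differentiableAt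
  · filter_upwards [hs] with z hz using hm z hz
  -- The derivative at z₀ is measurable as the limit of difference quotients along the points z₀ + R
  -- / (2(n+1)), which stay in s.
  · have hmem : ∀ n : ℕ, z₀ + ((R / 2 / (n + 1) : ℝ) : ℂ) ∈ s := fun n => by
      apply hRs
      rw [Metric.mem_ball, dist_eq_norm, add_sub_cancel_left, Complex.norm_real,
        Real.norm_of_nonneg (by positivity)]
      have : R / 2 / ((n : ℝ) + 1) ≤ R / 2 := div_le_self hR2.le (by linarith [n.cast_nonneg (α := ℝ)])
      linarith
    refine aestronglyMeasurable_of_tendsto_ae Filter.atTop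
      (f := fun (n : ℕ) x => (((R / 2 / (n + 1) : ℝ) : ℂ))⁻¹ •
        (f (z₀ + ((R / 2 / (n + 1) : ℝ) : ℂ)) x - f z₀ x))
      (fun n => ((hm _ (hmem n)).sub (hm _ hz₀)).const_smul
        (((R / 2 / (n + 1) : ℝ) : ℂ))⁻¹) ?_
    filter_upwards [hd] with x hx
    have h1 := (hdiff x hx z₀ (Metric.mem_ball_self hR)).hasDerivAt.tendsto_slope_zero
    refine h1.comp (tendsto_nhdsWithin_iff.2 ⟨?_, Filter.Eventually.of_forall fun n => ?_⟩)
    · have h2 : Filter.Tendsto (fun n : ℕ => R / 2 / ((n : ℝ) + 1)) Filter.atTop (nhds 0) :=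
        tendsto_const_nhds.div_atTop
          (Filter.tendsto_atTop_add_const_right _ _ tendsto_natCast_atTop_atTop)
      have h3 := (Complex.continuous_ofReal.tendsto 0).comp h2
      rwa [Complex.ofReal_zero] at h3
    · have : (0 : ℝ) < R / 2 / ((n : ℝ) + 1) := by positivity
      simpa only [mem_compl_iff, mem_singleton_iff, Complex.ofReal_eq_zero] using this.ne'
  · filter_upwards [hd, hb] with x hx hbx z hz
    have hz' : Metric.closedBall z (R / 4) ⊆ Metric.ball z₀ R := fun w hw => by
      rw [Metric.mem_closedBall] at hw
      rw [Metric.mem_ball] at hz ⊢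
      linarith [dist_triangle w z z₀]
    -- Cauchy's estimate on a circle of radius R/4 about a point of the R/2-ball; the circle stays
    -- inside the R-ball.
    refine Complex.norm_deriv_le_of_forall_mem_sphere_norm_le (by positivity) ?_ fun w hw =>
      hbx w (hRs (hz' (Metric.sphere_subset_closedBall hw)))
    refine DifferentiableOn.diffContOnCl (s := Metric.ball z (R / 4)) (hx.mono ?_)
    exact (Metric.closure_ball_subset_closedBall.trans hz').trans hRs
  · filter_upwards [hd] with x hx z hz
    exact (hdiff x hx z (Metric.ball_subset_ball (by linarith) hz)).hasDerivAt

/-- The Taylor remainder on `[0, 1]` of a function given with its derivatives. -/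
theorem taylor_bound_Icc (N : ℕ) : ∀ (G : ℕ → ℝ → ℂ) (M : ℝ),
    (∀ k r, HasDerivAt (G k) (G (k + 1) r) r) → (∀ r ∈ Icc (0 : ℝ) 1, ‖G N r‖ ≤ M) →
    ∀ r ∈ Icc (0 : ℝ) 1,
      ‖G 0 r - ∑ k ∈ Finset.range N, G k 0 / (k.factorial : ℂ) * (r : ℂ) ^ k‖ ≤ M * r ^ N := by
  induction N with
  | zero => intro G M _ hM r hr; simpa using hM r hr
  | succ N ih =>
    intro G M hG hM r hr
    have hM0 : 0 ≤ M := (norm_nonneg _).trans (hM 0 ⟨le_rfl, zero_le_one⟩)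
    -- The derivative of the remainder of order N + 1 is the remainder of order N of the shifted
    -- family, and the mean value inequality on [0, r] gains one factor r.
    have ih' := ih (fun k => G (k + 1)) M (fun k r => hG (k + 1) r) hM
    let h : ℝ → ℂ := fun r =>
      G 0 r - ∑ k ∈ Finset.range (N + 1), G k 0 / (k.factorial : ℂ) * (r : ℂ) ^ k
    have hd : ∀ x : ℝ, HasDerivAt h
        (G 1 x - ∑ k ∈ Finset.range N, G (k + 1) 0 / (k.factorial : ℂ) * (x : ℂ) ^ k) x := by
      intro x
      refine (hG 0 x).sub ?_
      have hs : HasDerivAt (fun r : ℝ =>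
          ∑ k ∈ Finset.range (N + 1), G k 0 / (k.factorial : ℂ) * (r : ℂ) ^ k)
          (∑ k ∈ Finset.range (N + 1),
            G k 0 / (k.factorial : ℂ) * ((k : ℂ) * (x : ℂ) ^ (k - 1))) x := by
        refine HasDerivAt.fun_sum fun k _ => HasDerivAt.const_mul _ ?_
        simpa using (hasDerivAt_pow k (x : ℂ)).comp_ofReal
      refine hs.congr_deriv ?_
      rw [Finset.sum_range_succ']
      simp only [Nat.cast_zero, zero_mul, mul_zero, add_zero, Nat.add_sub_cancel]
      refine Finset.sum_congr rfl fun k _ => ?_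
      rw [Nat.factorial_succ]
      have h1 : ((k : ℂ) + 1) ≠ 0 := by exact_mod_cast Nat.succ_ne_zero k
      have h2 : (k.factorial : ℂ) ≠ 0 := by exact_mod_cast k.factorial_ne_zero
      push_cast
      field_simp
    have h0 : h 0 = 0 := by
      simp only [h]
      rw [Finset.sum_range_succ']
      simp
    have hb : ∀ x ∈ Icc (0 : ℝ) r, ‖deriv h x‖ ≤ M * r ^ N := by
      intro x hx
      rw [(hd x).deriv]
      refine (ih' x ⟨hx.1, hx.2.trans hr.2⟩).trans ?_
      exact mul_le_mul_of_nonneg_left (pow_le_pow_left₀ hx.1 hx.2 N) hM0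
    have := Convex.norm_image_sub_le_of_norm_deriv_le (f := h) (s := Icc 0 r) (x := 0) (y := r)
      (fun x _ => (hd x).differentiableAt) hb (convex_Icc 0 r) ⟨le_rfl, hr.1⟩ ⟨hr.1, le_rfl⟩
    rw [h0, sub_zero, sub_zero, Real.norm_of_nonneg hr.1] at this
    calc _ ≤ M * r ^ N * r := this
      _ = M * r ^ (N + 1) := by ring

/-! ### Homogeneous functions and polar coordinates -/

/-- The function `x ↦ w (x / |x|)`, extended by `0` to the origin. -/
def homog (w : C(Sph m, ℂ)) (x : E m) : ℂ :=
  open Classical in if h : x = 0 then 0 else w ⟨‖x‖⁻¹ • x, by simp [norm_smul, h]⟩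

theorem homog_smul (w : C(Sph m, ℂ)) (ω : Sph m) {r : ℝ} (hr : 0 < r) :
    homog w (r • (ω : E m)) = w ω := by
  have hω : (ω : E m) ≠ 0 := by
    intro h
    have := sphere_norm ω
    simp [h] at this
  rw [homog, dif_neg (smul_ne_zero hr.ne' hω)]
  congr 1
  ext1
  simp [norm_smul, abs_of_pos hr, smul_smul, hr.ne']

theorem norm_homog_le (w : C(Sph m, ℂ)) (x : E m) : ‖homog w x‖ ≤ ‖w‖ := by
  unfold homog
  split_ifs
  · simp
  · exact w.norm_coe_le_norm _

theorem continuousOn_homog (w : C(Sph m, ℂ)) : ContinuousOn (homog w) {0}ᶜ := by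
  rw [continuousOn_iff_continuous_domRestrict]
  have h : Continuous fun x : ({0}ᶜ : Set (E m)) =>
      w ⟨‖(x : E m)‖⁻¹ • (x : E m), by
        have : (x : E m) ≠ 0 := x.2
        simp [norm_smul, this]⟩ := by
    refine w.continuous.comp (Continuous.subtype_mk ?_ _)
    exact (Continuous.inv₀ (by fun_prop) fun x => norm_ne_zero_iff.2 x.2).smul continuous_subtype_val
  convert! h using 2 with x
  have : (x : E m) ≠ 0 := x.2
  simp [homog, this]

theorem measurable_homog (w : C(Sph m, ℂ)) : Measurable (homog w) :=
  measurable_of_continuousOn_compl_singleton 0 (continuousOn_homog w)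

theorem finrank_E : Module.finrank ℝ (E m) = m := by simp

/-- Integration in polar coordinates. -/
theorem integral_polar (hm : 1 ≤ m) {f : E m → ℂ} (hf : Integrable f) :
    Integrable (fun r : ℝ => ((r ^ (m - 1) : ℝ) : ℂ) * ∫ ω : Sph m, f (r • (ω : E m)) ∂(surf m))
        (volume.restrict (Ioi 0)) ∧
      ∫ x, f x = ∫ r in Ioi (0 : ℝ),
        ((r ^ (m - 1) : ℝ) : ℂ) * ∫ ω : Sph m, f (r • (ω : E m)) ∂(surf m) := by
  have hmp := (volume : Measure (E m)).measurePreserving_homeomorphUnitSphereProd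
  have hemb := (homeomorphUnitSphereProd (E m)).measurableEmbedding
  let g : Sph m × Ioi (0 : ℝ) → ℂ := fun p => f (p.2.1 • (p.1 : E m))
  have hg : g ∘ homeomorphUnitSphereProd (E m) = fun x : ({0}ᶜ : Set (E m)) => f x := by
    ext x
    have hx : (x : E m) ≠ 0 := x.2
    simp [g, smul_smul, hx]
  have hgi : Integrable g ((surf m).prod (Measure.volumeIoiPow (m - 1))) := by
    have h1 : Integrable (g ∘ homeomorphUnitSphereProd (E m))
        ((volume : Measure (E m)).comap (↑)) := by
      rw [hg]
      exact (integrableOn_iff_comap_subtypeVal (measurableSet_singleton _).compl).1 hf.integrableOn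
    rw [hmp.integrable_comp_emb hemb, finrank_E] at h1
    exact h1
  have hint : ∫ x, f x = ∫ p, g p ∂((surf m).prod (Measure.volumeIoiPow (m - 1))) := by
    have h1 := hmp.integral_comp hemb g
    rw [finrank_E] at h1
    unfold surf
    rw [← h1]
    change _ = ∫ x, (g ∘ homeomorphUnitSphereProd (E m)) x ∂_
    rw [hg, integral_subtype_comap (measurableSet_singleton _).compl (fun x => f x)]
    have : Nontrivial (E m) := by
      have : Nonempty (Fin m) := ⟨⟨0, hm⟩⟩
      infer_instance
    rw [restrict_compl_singleton]
  have hfub := hgi.integral_prod_right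
  -- The radial measure has density r^(m-1) as an extended nonnegative real; it is passed through
  -- `Real.toNNReal` to turn it into a scalar factor.
  have hcoe : ∀ r : Ioi (0 : ℝ), ∀ c : ℂ, (Real.toNNReal (r.1 ^ (m - 1))) • c
      = ((r.1 ^ (m - 1) : ℝ) : ℂ) * c := fun r c => by
    rw [NNReal.smul_def, Real.coe_toNNReal _ (pow_nonneg (le_of_lt r.2) _)]
    simp
  have hmeas : Measurable fun r : Ioi (0 : ℝ) => Real.toNNReal (r.1 ^ (m - 1)) :=
    (measurable_subtype_coe.pow_const _).real_toNNReal
  constructor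
  · rw [Measure.volumeIoiPow] at hfub
    simp only [ENNReal.ofReal] at hfub
    rw [integrable_withDensity_iff_integrable_smul hmeas] at hfub
    simp only [hcoe] at hfub
    change IntegrableOn _ _ _
    rw [integrableOn_iff_comap_subtypeVal measurableSet_Ioi]
    exact hfub
  · rw [hint, integral_prod_symm _ hgi, Measure.volumeIoiPow]
    simp only [ENNReal.ofReal]
    rw [integral_withDensity_eq_integral_smul hmeas]
    simp only [hcoe]
    exact integral_subtype_comap measurableSet_Ioi fun r : ℝ =>
      ((r ^ (m - 1) : ℝ) : ℂ) * ∫ ω : Sph m, f (r • (ω : E m)) ∂(surf m)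

/-! ### Zeros of the reciprocal Gamma function and parity on the sphere -/

/-- The function `μ ↦ 1 / Γ((μ + 1 + p) / 2)`. -/
def gammaRecip (p : ℕ) (μ : ℂ) : ℂ := (Complex.Gamma ((μ + 1 + p) / 2))⁻¹

theorem differentiable_gammaRecip (p : ℕ) : Differentiable ℂ (gammaRecip p) := by
  have h : Differentiable ℂ fun μ : ℂ => (μ + 1 + p) / 2 := by fun_prop
  exact Complex.differentiable_one_div_Gamma.comp h

/-- These are the exponents μ = -k - 1 with k = p + 2l, exactly where a Taylor coefficient of the
right parity gives the finite part a pole. -/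
theorem gammaRecip_eq_zero (p l : ℕ) : gammaRecip p (-((p + 2 * l : ℕ) : ℂ) - 1) = 0 := by
  have h : ((-((p + 2 * l : ℕ) : ℂ) - 1) + 1 + p) / 2 = -(l : ℂ) := by push_cast; ring
  rw [gammaRecip, h, Complex.Gamma_neg_nat_eq_zero, inv_zero]

/-- At c = -k - 1 with a zero of `gammaRecip p`, this slope is the quotient by μ + k + 1 with its
singularity removed. -/
theorem differentiable_dslope_gammaRecip (p : ℕ) (c : ℂ) :
    Differentiable ℂ (dslope (gammaRecip p) c) := by
  rw [← differentiableOn_univ, Complex.differentiableOn_dslope Filter.univ_mem]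
  exact (differentiable_gammaRecip p).differentiableOn

/-- The surface measure of a set is a multiple of the volume of the cone over it, and Lebesgue
measure is invariant under x ↦ -x. -/
theorem surf_map_neg : (surf m).map (fun ω => -ω) = surf m := by
  ext s hs
  rw [Measure.map_apply (by fun_prop) hs, surf, Measure.toSphere_apply' _ hs,
    Measure.toSphere_apply' _ ((measurable_neg : Measurable fun ω : Sph m => -ω) hs)]
  congr 1
  rw [← Measure.measure_neg]
  congr 1
  ext x
  simp only [Set.mem_neg, Set.mem_smul, Set.mem_image, Set.mem_preimage]
  constructor
  · rintro ⟨r, hr, _, ⟨ω, hω, rfl⟩, h⟩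
    exact ⟨r, hr, _, ⟨-ω, hω, rfl⟩, by rw [← neg_neg x, ← h]; simp⟩
  · rintro ⟨r, hr, _, ⟨ω, hω, rfl⟩, h⟩
    exact ⟨r, hr, _, ⟨-ω, by simpa using hω, rfl⟩, by rw [← h]; simp⟩

theorem integral_surf_neg (f : Sph m → ℂ) : ∫ ω, f (-ω) ∂(surf m) = ∫ ω, f ω ∂(surf m) := by
  conv_rhs => rw [← surf_map_neg]
  exact ((MeasurableEquiv.neg (Sph m)).measurableEmbedding.integral_map f).symm

/-- A function on the sphere of parity `p`. -/
def HasParity (p : ℕ) (w : C(Sph m, ℂ)) : Prop := ∀ ω, w (-ω) = (-1) ^ p * w ω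

theorem hasParity_one : HasParity 0 (1 : C(Sph m, ℂ)) := fun ω => by simp

theorem hasParity_coord (j : Fin m) : HasParity 1 (coord j) := fun ω => by simp [coord]

/-- The substitution ω ↦ -ω multiplies the integrand by (-1)^(p+k), as the k-th derivative is
k-linear in the direction. -/
theorem sphMeanDeriv_eq_zero {p : ℕ} {w : C(Sph m, ℂ)} (hw : HasParity p w) (φ : 𝓢(E m, ℂ)) {k : ℕ}
    (hk : Odd (k + p)) : sphMeanDeriv w φ k 0 = 0 := by
  have h : ∫ ω : Sph m, w ω * iteratedFDeriv ℝ k φ ((0 : ℝ) • (ω : E m)) (fun _ => (ω : E m))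
      ∂(surf m) = -∫ ω : Sph m,
        w ω * iteratedFDeriv ℝ k φ ((0 : ℝ) • (ω : E m)) (fun _ => (ω : E m)) ∂(surf m) := by
    conv_lhs => rw [← integral_surf_neg]
    rw [← integral_neg]
    congr 1
    ext ω
    have h1 : (fun _ : Fin k => ((-ω : Sph m) : E m)) = fun i : Fin k => (-1 : ℝ) • (ω : E m) := by
      ext; simp
    rw [h1, (iteratedFDeriv ℝ k φ _).map_smul_univ (fun _ => (-1 : ℝ)) (fun _ => (ω : E m)), hw ω]
    simp only [zero_smul, Finset.prod_const, Finset.card_univ, Fintype.card_fin, Complex.real_smul]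
    have h2 : (-1 : ℂ) ^ p * (-1) ^ k = -1 := by
      rw [← pow_add, add_comm, hk.neg_one_pow]
    push_cast
    linear_combination (w ω * iteratedFDeriv ℝ k φ 0 fun _ => (ω : E m)) * h2
  unfold sphMeanDeriv
  rw [self_eq_neg] at h
  rw [h, mul_zero]

/-! ### The normalized finite part as an entire family -/

/-- The integrand near the origin, with `N` subtracted Taylor terms. -/
def innerFunN (N : ℕ) (w : C(Sph m, ℂ)) (φ : 𝓢(E m, ℂ)) (μ : ℂ) (r : ℝ) : ℂ :=
  (r : ℂ) ^ μ * (sphMean w φ r - ∑ k ∈ Finset.range N,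
    sphMeanDeriv w φ k 0 / (k.factorial : ℂ) * (r : ℂ) ^ k)

/-- Since r ≤ 1, any lower bound b of Re μ may serve as exponent, so the estimate is uniform near a
given μ. The bound M is left free because it will later carry the decay under translations. -/
theorem norm_innerFunN_le (N : ℕ) (w : C(Sph m, ℂ)) (φ : 𝓢(E m, ℂ)) {M : ℝ}
    (hM : ∀ r ∈ Icc (0 : ℝ) 1, ‖sphMeanDeriv w φ N r‖ ≤ M) {μ : ℂ} {b : ℝ} (hb : b ≤ μ.re) {r : ℝ}
    (hr : r ∈ Ioc (0 : ℝ) 1) : ‖innerFunN N w φ μ r‖ ≤ M * r ^ (b + N) := by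
  have hM0 : 0 ≤ M := (norm_nonneg _).trans (hM 0 ⟨le_rfl, zero_le_one⟩)
  have h := taylor_bound_Icc N (sphMeanDeriv w φ) M (hasDerivAt_sphMeanDeriv w φ) hM r
    ⟨hr.1.le, hr.2⟩
  rw [sphMeanDeriv_zero] at h
  rw [innerFunN, norm_mul, Complex.norm_cpow_eq_rpow_re_of_pos hr.1]
  calc _ ≤ r ^ b * (M * r ^ N) := by
        refine mul_le_mul ?_ h (norm_nonneg _) (Real.rpow_nonneg hr.1.le _)
        exact Real.rpow_le_rpow_of_exponent_ge hr.1 hr.2 hb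
    _ = M * r ^ (b + N) := by rw [Real.rpow_add hr.1, Real.rpow_natCast]; ring

theorem aestronglyMeasurable_innerFunN (N : ℕ) (w : C(Sph m, ℂ)) (φ : 𝓢(E m, ℂ)) (μ : ℂ) :
    AEStronglyMeasurable (innerFunN N w φ μ) (volume.restrict (Ioc 0 1)) := by
  refine ContinuousOn.aestronglyMeasurable ?_ measurableSet_Ioc
  refine ((continuousOn_cpow μ).mono Ioc_subset_Ioi_self).mul (Continuous.continuousOn ?_)
  have := continuous_sphMean w φ
  fun_prop

theorem integrableOn_rpow_Ioc {b : ℝ} (hb : -1 < b) : IntegrableOn (fun r : ℝ => r ^ b) (Ioc 0 1) :=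
  (intervalIntegrable_iff_integrableOn_Ioc_of_le zero_le_one).1
    (intervalIntegral.intervalIntegrable_rpow' hb)

theorem norm_sphMeanDeriv_le' (w : C(Sph m, ℂ)) (φ : 𝓢(E m, ℂ)) (N : ℕ) :
    ∀ r ∈ Icc (0 : ℝ) 1, ‖sphMeanDeriv w φ N r‖ ≤ meanConst w * SchwartzMap.seminorm ℂ 0 N φ :=
  fun r _ => norm_sphMeanDeriv_le w φ N r

theorem integrableOn_innerFunN {N : ℕ} (w : C(Sph m, ℂ)) (φ : 𝓢(E m, ℂ)) {μ : ℂ}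
    (hμ : -1 < μ.re + N) : IntegrableOn (innerFunN N w φ μ) (Ioc 0 1) := by
  refine Integrable.mono' ((integrableOn_rpow_Ioc hμ).const_mul
    (meanConst w * SchwartzMap.seminorm ℂ 0 N φ))
    (aestronglyMeasurable_innerFunN N w φ μ) ?_
  exact (ae_restrict_iff' measurableSet_Ioc).2 (Filter.Eventually.of_forall fun r hr =>
    norm_innerFunN_le N w φ (norm_sphMeanDeriv_le' w φ N) le_rfl hr)

theorem differentiableAt_inner {N : ℕ} (w : C(Sph m, ℂ)) (φ : 𝓢(E m, ℂ)) {μ : ℂ}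
    (hμ : -1 < μ.re + N) :
    DifferentiableAt ℂ (fun μ => ∫ r in Ioc (0 : ℝ) 1, innerFunN N w φ μ r) μ := by
  -- Half the distance of Re μ + N from -1: on the ball of this radius the dominating exponent stays
  -- above -1.
  have hδ : 0 < (μ.re + N + 1) / 2 := by linarith
  refine differentiableAt_integral_of_dominated (Metric.ball_mem_nhds μ hδ)
    (bound := fun r => meanConst w * SchwartzMap.seminorm ℂ 0 N φ *
      r ^ (μ.re - (μ.re + N + 1) / 2 + N))
    (fun z _ => aestronglyMeasurable_innerFunN N w φ z) ?_ ?_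
    ((integrableOn_rpow_Ioc (by linarith)).const_mul _)
  · refine (ae_restrict_iff' measurableSet_Ioc).2 (Filter.Eventually.of_forall fun r hr => ?_)
    have hr0 : (r : ℂ) ≠ 0 := by exact_mod_cast hr.1.ne'
    unfold innerFunN
    refine Differentiable.differentiableOn (Differentiable.mul_const ?_ _)
    exact fun z => (differentiableAt_id.const_cpow (Or.inl hr0))
  · refine (ae_restrict_iff' measurableSet_Ioc).2 (Filter.Eventually.of_forall fun r hr z hz => ?_)
    refine norm_innerFunN_le N w φ (norm_sphMeanDeriv_le' w φ N) ?_ hr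
    rw [Metric.mem_ball, dist_eq_norm] at hz
    have := (Complex.abs_re_le_norm (z - μ)).trans hz.le
    rw [Complex.sub_re, abs_le] at this
    linarith

/-- For r > 1 and |z - μ| < 1 one has |r^z| ≤ r^(Re μ + 1), and the Schwartz decay makes this
integrable whatever μ is. -/
theorem differentiable_outer (w : C(Sph m, ℂ)) (φ : 𝓢(E m, ℂ)) :
    Differentiable ℂ (fun μ : ℂ => ∫ r in Ioi (1 : ℝ), (r : ℂ) ^ μ * sphMean w φ r) := by
  intro μ
  refine differentiableAt_integral_of_dominated (Metric.ball_mem_nhds μ one_pos)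
    (bound := fun r => ‖(r : ℂ) ^ (μ + 1) * sphMean w φ r‖)
    (fun z _ => (integrableOn_outer z w φ).aestronglyMeasurable) ?_ ?_
    (integrableOn_outer (μ + 1) w φ).norm
  · refine (ae_restrict_iff' measurableSet_Ioi).2 (Filter.Eventually.of_forall fun r hr => ?_)
    have hr0 : (r : ℂ) ≠ 0 := by exact_mod_cast (zero_lt_one.trans (mem_Ioi.1 hr)).ne'
    refine Differentiable.differentiableOn (Differentiable.mul_const ?_ _)
    exact fun z => (differentiableAt_id.const_cpow (Or.inl hr0))
  · refine (ae_restrict_iff' measurableSet_Ioi).2 (Filter.Eventually.of_forall fun r hr z hz => ?_)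
    have hr0 : 0 < r := zero_lt_one.trans (mem_Ioi.1 hr)
    rw [norm_mul, norm_mul, Complex.norm_cpow_eq_rpow_re_of_pos hr0,
      Complex.norm_cpow_eq_rpow_re_of_pos hr0]
    refine mul_le_mul_of_nonneg_right ?_ (norm_nonneg _)
    refine Real.rpow_le_rpow_of_exponent_le (le_of_lt hr) ?_
    rw [Metric.mem_ball, dist_eq_norm] at hz
    have := (Complex.abs_re_le_norm (z - μ)).trans hz.le
    rw [Complex.sub_re, abs_le] at this
    simp only [Complex.add_re, Complex.one_re]
    linarith

/-- The finite part divided by the Gamma function, with its poles removed. -/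
def starPart (p N : ℕ) (w : C(Sph m, ℂ)) (φ : 𝓢(E m, ℂ)) (μ : ℂ) : ℂ :=
  gammaRecip p μ * ((∫ r in Ioc (0 : ℝ) 1, innerFunN N w φ μ r)
      + ∫ r in Ioi (1 : ℝ), (r : ℂ) ^ μ * sphMean w φ r)
    + ∑ k ∈ Finset.range N,
        sphMeanDeriv w φ k 0 / (k.factorial : ℂ) * dslope (gammaRecip p) (-k - 1) μ

theorem differentiableAt_starPart (p : ℕ) {N : ℕ} (w : C(Sph m, ℂ)) (φ : 𝓢(E m, ℂ)) {μ : ℂ}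
    (hμ : -1 < μ.re + N) : DifferentiableAt ℂ (starPart p N w φ) μ := by
  unfold starPart
  refine ((differentiable_gammaRecip p μ).mul
    ((differentiableAt_inner w φ hμ).add (differentiable_outer w φ μ))).add ?_
  exact DifferentiableAt.fun_sum fun k _ => ((differentiable_dslope_gammaRecip p _) μ).const_mul _

theorem integral_cpow_Ioc {ν : ℂ} (hν : -1 < ν.re) :
    ∫ r in Ioc (0 : ℝ) 1, (r : ℂ) ^ ν = (ν + 1)⁻¹ := by
  rw [← intervalIntegral.integral_of_le zero_le_one, integral_cpow (Or.inl hν)]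
  have h : ν + 1 ≠ 0 := fun h => by
    have := congrArg Complex.re h
    simp at this
    linarith
  simp [Complex.zero_cpow h]

/-- Either the coefficient vanishes by parity, or `gammaRecip p` vanishes at -k - 1 and the slope is
the plain quotient `gammaRecip p μ` / (μ + k + 1). -/
theorem dslope_gammaRecip_of_parity {p : ℕ} {w : C(Sph m, ℂ)} (hw : HasParity p w)
    (φ : 𝓢(E m, ℂ)) {k : ℕ} {μ : ℂ} (hk : p ≤ k ∨ Odd (k + p)) (hμ : μ + k + 1 ≠ 0) :
    sphMeanDeriv w φ k 0 / (k.factorial : ℂ) * dslope (gammaRecip p) (-k - 1) μ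
      = gammaRecip p μ * (sphMeanDeriv w φ k 0 / (k.factorial : ℂ) * (μ + k + 1)⁻¹) := by
  by_cases hodd : Odd (k + p)
  · simp [sphMeanDeriv_eq_zero hw φ hodd]
  · have hpk : p ≤ k := hk.resolve_right hodd
    obtain ⟨l, hl⟩ : ∃ l, k = p + 2 * l := by
      obtain ⟨d, hd⟩ := Nat.exists_eq_add_of_le hpk
      rw [Nat.not_odd_iff_even] at hodd
      obtain ⟨c, hc⟩ := hodd
      exact ⟨c - p, by omega⟩
    have hne : μ ≠ -(k : ℂ) - 1 := fun h => hμ (by rw [h]; ring)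
    have hz : gammaRecip p (-(k : ℂ) - 1) = 0 := by rw [hl]; exact gammaRecip_eq_zero p l
    rw [dslope_of_ne _ hne, slope_def_field, hz]
    have : μ - (-(k : ℂ) - 1) = μ + k + 1 := by ring
    rw [this, sub_zero, div_eq_mul_inv]
    ring

/-- This is where p ≤ 1 matters: an order k < p would meet no zero of 1/Γ, but the only such pair, k
= 0 and p = 1, is killed by parity. -/
theorem le_or_odd {p : ℕ} (hp : p ≤ 1) (k : ℕ) : p ≤ k ∨ Odd (k + p) := by
  rcases Nat.eq_zero_or_pos k with rfl | hk
  · interval_cases p <;> simp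
  · left; omega

/-- The newly subtracted Taylor term r^(μ+N) integrates to 1/(μ+N+1) over (0, 1), which is what the
new summand gives back. Thus the value does not depend on N once the integral converges. -/
theorem starPart_succ {p : ℕ} (hp : p ≤ 1) {N : ℕ} {w : C(Sph m, ℂ)} (hw : HasParity p w)
    (φ : 𝓢(E m, ℂ)) {μ : ℂ} (hμ : -1 < μ.re + N) :
    starPart p (N + 1) w φ μ = starPart p N w φ μ := by
  have hμ' : -1 < (μ + N).re := by simpa using hμ
  have hne : μ + N + 1 ≠ 0 := fun h => by
    have := congrArg Complex.re h
    simp at this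
    linarith
  have h1 : ∫ r in Ioc (0 : ℝ) 1, innerFunN (N + 1) w φ μ r
      = (∫ r in Ioc (0 : ℝ) 1, innerFunN N w φ μ r)
        - sphMeanDeriv w φ N 0 / (N.factorial : ℂ) * (μ + N + 1)⁻¹ := by
    rw [← integral_cpow_Ioc hμ', ← integral_const_mul, ← integral_sub (integrableOn_innerFunN w φ hμ)]
    · refine setIntegral_congr_fun measurableSet_Ioc fun r hr => ?_
      have hr0 : (r : ℂ) ≠ 0 := by exact_mod_cast hr.1.ne'
      simp only [innerFunN, Finset.sum_range_succ]
      rw [Complex.cpow_add _ _ hr0, Complex.cpow_natCast]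
      ring
    · refine Integrable.const_mul ?_ _
      exact (intervalIntegrable_iff_integrableOn_Ioc_of_le zero_le_one).1
        (intervalIntegral.intervalIntegrable_cpow' hμ')
  unfold starPart
  rw [h1, Finset.sum_range_succ, dslope_gammaRecip_of_parity hw φ (le_or_odd hp N) hne]
  ring

theorem starPart_of_le {p : ℕ} (hp : p ≤ 1) {N N' : ℕ} {w : C(Sph m, ℂ)} (hw : HasParity p w)
    (φ : 𝓢(E m, ℂ)) {μ : ℂ} (hμ : -1 < μ.re + N) (hN : N ≤ N') :
    starPart p N' w φ μ = starPart p N w φ μ := by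
  induction N', hN using Nat.le_induction with
  | base => rfl
  | succ n hn ih =>
    rw [starPart_succ hp hw φ, ih]
    have : (N : ℝ) ≤ n := by exact_mod_cast hn
    linarith

/-- Away from the zeros of `gammaRecip p`, a logarithmic term (μ + k + 1 = 0) forces k + p to be
odd. Its coefficient is then zero, and dropping it in `finitePart` loses nothing. -/
theorem starPart_eq_finitePart {p : ℕ} (hp : p ≤ 1) {w : C(Sph m, ℂ)} (hw : HasParity p w)
    (φ : 𝓢(E m, ℂ)) {μ : ℂ} (hμ : ∀ l : ℕ, μ ≠ -((p + 2 * l : ℕ) : ℂ) - 1) :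
    starPart p ⌈-μ.re⌉₊ w φ μ = gammaRecip p μ * finitePart μ (sphMean w φ) := by
  rw [finitePart_sphMean, mul_add, starPart]
  congr 1
  rw [Finset.mul_sum]
  refine Finset.sum_congr rfl fun k _ => ?_
  split_ifs with h
  · have hodd : Odd (k + p) := by
      by_contra hodd
      have hpk := (le_or_odd hp k).resolve_right hodd
      rw [Nat.not_odd_iff_even] at hodd
      obtain ⟨c, hc⟩ := hodd
      refine hμ (c - p) ?_
      have : p + 2 * (c - p) = k := by omega
      rw [this]
      linear_combination h
    simp [sphMeanDeriv_eq_zero hw φ hodd]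
  · rw [dslope_gammaRecip_of_parity hw φ (le_or_odd hp k) h, div_eq_mul_inv _ (μ + k + 1)]

variable (m) in
/-- The factor `π ^ ((λ + m + p) / 2)`. -/
def piFactor (p : ℕ) (lam : ℂ) : ℂ := (Real.pi : ℂ) ^ ((lam + m + p) / 2)

theorem differentiable_piFactor (p : ℕ) : Differentiable ℂ (piFactor m p) := by
  intro z
  have h : (Real.pi : ℂ) ≠ 0 := by exact_mod_cast Real.pi_ne_zero
  unfold piFactor
  exact DifferentiableAt.const_cpow (by fun_prop) (Or.inl h)

/-- The entire family `π ^ ((λ + m + p) / 2) / Γ((λ + m + p) / 2) ⟨Fp |x| ^ λ w(x / |x|), φ⟩`,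
for a function `w` of parity `p` on the sphere. -/
def fam (p : ℕ) (w : C(Sph m, ℂ)) (lam : ℂ) (φ : 𝓢(E m, ℂ)) : ℂ :=
  piFactor m p lam * ((area m : ℂ) * starPart p ⌈-(lam + m - 1).re⌉₊ w φ (lam + m - 1))

/-- In the definition the number of Taylor terms jumps with λ; here it may be held fixed on a
neighbourhood, as differentiation requires. -/
theorem fam_eq_starPart {p : ℕ} (hp : p ≤ 1) {w : C(Sph m, ℂ)} (hw : HasParity p w)
    (φ : 𝓢(E m, ℂ)) {lam : ℂ} {N : ℕ} (hN : -1 < (lam + m - 1).re + N) :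
    fam p w lam φ = piFactor m p lam * ((area m : ℂ) * starPart p N w φ (lam + m - 1)) := by
  have h1 : -1 < (lam + m - 1).re + (⌈-(lam + m - 1).re⌉₊ : ℕ) := by
    have := Nat.le_ceil (-(lam + m - 1).re)
    linarith
  rw [fam, ← starPart_of_le hp hw φ h1 (le_max_left _ N),
    ← starPart_of_le hp hw φ hN (le_max_right ⌈-(lam + m - 1).re⌉₊ N)]

theorem differentiable_fam {p : ℕ} (hp : p ≤ 1) {w : C(Sph m, ℂ)} (hw : HasParity p w)
    (φ : 𝓢(E m, ℂ)) : Differentiable ℂ (fun lam => fam p w lam φ) := by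
  intro lam
  obtain ⟨N, hN⟩ := exists_nat_gt (-1 - (lam + m - 1).re)
  have hN' : -1 < (lam + m - 1).re + N := by linarith
  have hev : (fun lam => fam p w lam φ) =ᶠ[nhds lam] fun lam =>
      piFactor m p lam * ((area m : ℂ) * starPart p N w φ (lam + m - 1)) := by
    have hc : Continuous fun lam : ℂ => (lam + m - 1).re + N := by fun_prop
    filter_upwards [(hc.isOpen_preimage _ isOpen_Ioi).mem_nhds hN'] with z hz
    exact fam_eq_starPart hp hw φ hz
  refine DifferentiableAt.congr_of_eventuallyEq ?_ hev
  refine (differentiable_piFactor p lam).mul (DifferentiableAt.const_mul ?_ _)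
  have h2 : DifferentiableAt ℂ (fun lam : ℂ => lam + m - 1) lam := by fun_prop
  exact (differentiableAt_starPart p w φ hN').comp lam h2

theorem gammaRecip_shift (p : ℕ) (lam : ℂ) :
    gammaRecip p (lam + m - 1) = (Complex.Gamma ((lam + m + p) / 2))⁻¹ := by
  rw [gammaRecip, sub_add_cancel]

theorem fam_eq_fpRadial {p : ℕ} (hp : p ≤ 1) {w : C(Sph m, ℂ)} (hw : HasParity p w)
    (φ : 𝓢(E m, ℂ)) {lam : ℂ} (hlam : ∀ l : ℕ, lam ≠ -m - 2 * l - p) :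
    fam p w lam φ =
      (Real.pi : ℂ) ^ ((lam + m + p) / 2) / Complex.Gamma ((lam + m + p) / 2)
        * fpRadial w lam φ := by
  rw [fam, starPart_eq_finitePart hp hw φ, gammaRecip_shift, fpRadial_apply, piFactor]
  · ring
  · intro l h
    refine hlam l ?_
    push_cast at h
    linear_combination h

/-! ### Locally integrable exponents -/

/-- In polar coordinates the integrand is at most r^(a+m-1) near 0 and r^(a+m-1-K) at infinity; the
two hypotheses are the convergence conditions. -/
theorem integrable_norm_rpow_mul (hm : 1 ≤ m) {a K : ℝ} (ha : -(m : ℝ) < a) (hK : a + m < K) :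
    Integrable (fun x : E m => ‖x‖ ^ a * (1 + ‖x‖) ^ (-K)) := by
  have : Nontrivial (E m) := by
    have : Nonempty (Fin m) := ⟨⟨0, hm⟩⟩
    infer_instance
  rw [integrable_fun_norm_addHaar (E := E m) volume (f := fun r : ℝ => r ^ a * (1 + r) ^ (-K)),
    finrank_E, ← Ioc_union_Ioi_eq_Ioi zero_le_one]
  have hm1 : ((m - 1 : ℕ) : ℝ) = m - 1 := by push_cast [hm]; ring
  have hcont : ContinuousOn (fun r : ℝ => r ^ (m - 1) • (r ^ a * (1 + r) ^ (-K))) (Ioi 0) := by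
    simp only [smul_eq_mul]
    refine ContinuousOn.mul (by fun_prop) (ContinuousOn.mul ?_ ?_)
    · exact continuousOn_id.rpow_const fun r hr => Or.inl (ne_of_gt hr)
    · refine ContinuousOn.rpow_const (f := fun r : ℝ => 1 + r) (by fun_prop) fun r hr => Or.inl ?_
      have := mem_Ioi.1 hr
      positivity
  have hexp : ∀ r : ℝ, 0 < r → r ^ (m - 1) * r ^ a = r ^ (a + m - 1) := fun r hr => by
    rw [← Real.rpow_natCast, hm1, ← Real.rpow_add hr]
    ring_nf
  refine IntegrableOn.union ?_ ?_
  · refine (integrableOn_rpow_Ioc (b := a + m - 1) (by linarith)).mono'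
      ((hcont.mono Ioc_subset_Ioi_self).aestronglyMeasurable measurableSet_Ioc) ?_
    refine (ae_restrict_iff' measurableSet_Ioc).2 (Filter.Eventually.of_forall fun r hr => ?_)
    have h0 := hr.1
    rw [Real.norm_of_nonneg (by positivity), smul_eq_mul, ← mul_assoc, hexp r h0]
    refine mul_le_of_le_one_right (by positivity) ?_
    exact Real.rpow_le_one_of_one_le_of_nonpos (by linarith) (by linarith)
  · refine (integrableOn_Ioi_rpow_of_lt (a := a + m - 1 - K) (by linarith) zero_lt_one).mono'
      ((hcont.mono (Ioi_subset_Ioi zero_le_one)).aestronglyMeasurable measurableSet_Ioi) ?_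
    refine (ae_restrict_iff' measurableSet_Ioi).2 (Filter.Eventually.of_forall fun r hr => ?_)
    have h0 : 0 < r := zero_lt_one.trans (mem_Ioi.1 hr)
    rw [Real.norm_of_nonneg (by positivity), smul_eq_mul, ← mul_assoc, hexp r h0,
      sub_eq_add_neg (a + m - 1) K, Real.rpow_add h0]
    refine mul_le_mul_of_nonneg_left ?_ (by positivity)
    exact Real.rpow_le_rpow_of_nonpos h0 (by linarith) (by linarith)

theorem one_add_norm_mul_le (φ : 𝓢(E m, ℂ)) (k n : ℕ) :
    ∃ C : ℝ, 0 ≤ C ∧ ∀ x, ‖iteratedFDeriv ℝ n φ x‖ ≤ C * (1 + ‖x‖) ^ (-(k : ℝ)) := by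
  refine ⟨2 ^ k * ((Finset.Iic (k, n)).sup fun m => SchwartzMap.seminorm ℂ m.1 m.2) φ,
    mul_nonneg (by positivity) (apply_nonneg _ _), fun x => ?_⟩
  have h := SchwartzMap.one_add_le_sup_seminorm_apply (𝕜 := ℂ) (m := (k, n)) le_rfl le_rfl φ x
  rw [Real.rpow_neg (by positivity), Real.rpow_natCast, ← div_eq_mul_inv, le_div_iff₀ (by positivity)]
  linarith

theorem norm_schwartz_le (φ : 𝓢(E m, ℂ)) (k : ℕ) :
    ∃ C : ℝ, 0 ≤ C ∧ ∀ x, ‖φ x‖ ≤ C * (1 + ‖x‖) ^ (-(k : ℝ)) := by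
  obtain ⟨C, hC, h⟩ := one_add_norm_mul_le φ k 0
  exact ⟨C, hC, fun x => by simpa using h x⟩

/-- The function `|x| ^ λ w(x / |x|)`. -/
def radial (w : C(Sph m, ℂ)) (lam : ℂ) (x : E m) : ℂ := ((‖x‖ : ℂ) ^ lam) * homog w x

theorem measurable_radial (w : C(Sph m, ℂ)) (lam : ℂ) : Measurable (radial w lam) := by
  refine Measurable.mul ?_ (measurable_homog w)
  exact (Complex.measurable_ofReal.comp measurable_norm).pow_const lam

theorem norm_radial_le (w : C(Sph m, ℂ)) (lam : ℂ) (x : E m) :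
    ‖radial w lam x‖ ≤ ‖w‖ * ‖x‖ ^ lam.re := by
  rw [radial, norm_mul, mul_comm]
  by_cases hx : x = 0
  · simp only [hx, homog, dite_true, norm_zero, zero_mul]
    positivity
  · rw [Complex.norm_cpow_eq_rpow_re_of_pos (norm_pos_iff.2 hx)]
    exact mul_le_mul_of_nonneg_right (norm_homog_le w x) (by positivity)

theorem integrable_radial_mul (hm : 1 ≤ m) (w : C(Sph m, ℂ)) {lam : ℂ} (hlam : -(m : ℝ) < lam.re)
    (φ : 𝓢(E m, ℂ)) : Integrable (fun x => radial w lam x * φ x) := by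
  obtain ⟨K, hK⟩ := exists_nat_gt (lam.re + m)
  obtain ⟨C, hC, h⟩ := norm_schwartz_le φ K
  refine ((integrable_norm_rpow_mul hm hlam hK).const_mul (‖w‖ * C)).mono'
    ((measurable_radial w lam).aestronglyMeasurable.mul φ.continuous.aestronglyMeasurable)
    (Filter.Eventually.of_forall fun x => ?_)
  rw [norm_mul]
  calc _ ≤ (‖w‖ * ‖x‖ ^ lam.re) * (C * (1 + ‖x‖) ^ (-(K : ℝ))) :=
        mul_le_mul (norm_radial_le w lam x) (h x) (norm_nonneg _) (by positivity)
    _ = _ := by ring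

theorem area_ne_zero (hm : 1 ≤ m) : (area m : ℂ) ≠ 0 := by
  have : Nontrivial (E m) := by
    have : Nonempty (Fin m) := ⟨⟨0, hm⟩⟩
    infer_instance
  have h : (volume : Measure (E m)).toSphere ≠ 0 := Measure.toSphere_ne_zero _
  have h2 : area m ≠ 0 := by
    unfold area surf
    rw [measureReal_ne_zero_iff]
    exact fun h' => h (Measure.measure_univ_eq_zero.1 h')
  exact_mod_cast h2

theorem fam_eq_integral (hm : 1 ≤ m) {p : ℕ} (hp : p ≤ 1) {w : C(Sph m, ℂ)} (hw : HasParity p w)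
    (φ : 𝓢(E m, ℂ)) {lam : ℂ} (hlam : -(m : ℝ) < lam.re) :
    fam p w lam φ = piFactor m p lam * (Complex.Gamma ((lam + m + p) / 2))⁻¹
      * ∫ x, radial w lam x * φ x := by
  -- For Re λ > -m no Taylor term has to be subtracted, so N = 0 is allowed and only the polar
  -- integral remains.
  have hN : -1 < (lam + m - 1).re + (0 : ℕ) := by simp; linarith
  obtain ⟨h1, h2⟩ := integral_polar hm (integrable_radial_mul hm w hlam φ)
  have hpt : ∀ r ∈ Ioi (0 : ℝ), ((r ^ (m - 1) : ℝ) : ℂ) *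
      ∫ ω : Sph m, radial w lam (r • (ω : E m)) * φ (r • (ω : E m)) ∂(surf m)
      = (area m : ℂ) * ((r : ℂ) ^ (lam + m - 1) * sphMean w φ r) := fun r hr => by
    have hr0 : (r : ℂ) ≠ 0 := by exact_mod_cast (ne_of_gt hr)
    have h3 : ∀ ω : Sph m, radial w lam (r • (ω : E m)) * φ (r • (ω : E m))
        = (r : ℂ) ^ lam * (w ω * φ (r • (ω : E m))) := fun ω => by
      rw [radial, homog_smul w ω hr, norm_smul, sphere_norm, mul_one,
        Real.norm_of_nonneg (le_of_lt hr), mul_assoc]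
    simp only [h3]
    have h4 : (r : ℂ) ^ (lam + m - 1) = (r : ℂ) ^ lam * (r : ℂ) ^ (m - 1) := by
      rw [← Complex.cpow_natCast, ← Complex.cpow_add _ _ hr0]
      push_cast [hm]
      ring_nf
    rw [integral_const_mul, sphMean, h4]
    have := area_ne_zero hm
    push_cast
    field_simp
  rw [setIntegral_congr_fun measurableSet_Ioi hpt, integral_const_mul,
    ← Ioc_union_Ioi_eq_Ioi zero_le_one] at h2
  rw [fam_eq_starPart hp hw φ hN, h2, starPart, gammaRecip_shift,
    setIntegral_union Ioc_disjoint_Ioi_same measurableSet_Ioi]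
  · simp only [innerFunN, Finset.range_zero, Finset.sum_empty, sub_zero, add_zero]
    ring
  · have h5 := integrableOn_innerFunN w φ hN
    unfold innerFunN at h5
    simpa only [Finset.range_zero, Finset.sum_empty, sub_zero] using h5
  · exact integrableOn_outer _ w φ

/-! ### Gaussians and their Fourier transforms -/

open FourierTransform Real in
/-- The Fourier transform is self-adjoint. -/
theorem integral_fourier_mul {f g : E m → ℂ} (hf : Integrable f) (hg : Integrable g) :
    ∫ x, 𝓕 f x * g x = ∫ x, f x * 𝓕 g x := by
  have h := VectorFourier.integral_fourierIntegral_smul_eq_flip (L := innerₗ (E m))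
    (μ := volume) (ν := volume) Real.continuous_fourierChar continuous_inner hf hg
  rw [flip_innerₗ] at h
  exact h

/-- The Gaussian `exp (-π t |x| ^ 2)`. -/
def gauss (t : ℝ) (x : E m) : ℂ := Complex.exp (-(((Real.pi * ‖x‖ ^ 2 : ℝ) : ℂ) * t))

theorem norm_gauss (t : ℝ) (x : E m) : ‖gauss t x‖ = Real.exp (-(Real.pi * ‖x‖ ^ 2 * t)) := by
  rw [gauss, Complex.norm_exp, ← Complex.ofReal_mul, ← Complex.ofReal_neg, Complex.ofReal_re]

theorem continuous_gauss : Continuous fun q : E m × ℝ => gauss q.2 q.1 := by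
  unfold gauss
  fun_prop

theorem continuous_gauss_right (t : ℝ) : Continuous fun x : E m => gauss t x := by
  unfold gauss
  fun_prop

theorem integrable_pow_mul_gauss (hm : 1 ≤ m) (k : ℕ) {t : ℝ} (ht : 0 < t) :
    Integrable (fun x : E m => ‖x‖ ^ k * Real.exp (-(Real.pi * ‖x‖ ^ 2 * t))) := by
  have : Nontrivial (E m) := by
    have : Nonempty (Fin m) := ⟨⟨0, hm⟩⟩
    infer_instance
  rw [integrable_fun_norm_addHaar (E := E m) volume
    (f := fun r : ℝ => r ^ k * Real.exp (-(Real.pi * r ^ 2 * t))), finrank_E]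
  have hpt : 0 < Real.pi * t := mul_pos Real.pi_pos ht
  have hs : (-1 : ℝ) < ((m - 1 + k : ℕ) : ℝ) := by
    have : (0 : ℝ) ≤ ((m - 1 + k : ℕ) : ℝ) := Nat.cast_nonneg _
    linarith
  refine (integrableOn_rpow_mul_exp_neg_mul_sq hpt hs).congr_fun (fun r _ => ?_) measurableSet_Ioi
  simp only [Real.rpow_natCast, smul_eq_mul]
  rw [pow_add, mul_assoc]
  ring_nf

open FourierTransform in
/-- A function `w` on the sphere, with its extension `P` to a homogeneous polynomial of degree
`p ≤ 1`, for which the Gaussian `P exp (-π t |x| ^ 2)` has the expected Fourier transform. -/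
structure HarmonicData (p : ℕ) (w : C(Sph m, ℂ)) (P : E m → ℂ) : Prop where
  le_one : p ≤ 1
  parity : HasParity p w
  cont : Continuous P
  norm_le : ∀ x, ‖P x‖ ≤ ‖x‖ ^ p
  homog_eq : ∀ x, x ≠ 0 → P x = (‖x‖ : ℂ) ^ p * homog w x
  fourier : ∀ t : ℝ, 0 < t → ∀ ξ, 𝓕 (fun x => P x * gauss t x) ξ
    = (-Complex.I) ^ p * ((t : ℂ) ^ (-((m : ℂ) / 2 + p)) * (P ξ * gauss t⁻¹ ξ))

theorem HarmonicData.integrable (hm : 1 ≤ m) {p : ℕ} {w : C(Sph m, ℂ)} {P : E m → ℂ}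
    (h : HarmonicData p w P) {t : ℝ} (ht : 0 < t) : Integrable (fun x => P x * gauss t x) := by
  refine (integrable_pow_mul_gauss hm p ht).mono' (Continuous.aestronglyMeasurable ?_)
    (Filter.Eventually.of_forall fun x => ?_)
  · exact h.cont.mul (continuous_gauss_right t)
  · rw [norm_mul, norm_gauss]
    exact mul_le_mul_of_nonneg_right (h.norm_le x) (Real.exp_pos _).le

open FourierTransform in
theorem fourier_gauss {t : ℝ} (ht : 0 < t) (ξ : E m) :
    𝓕 (fun x : E m => gauss t x) ξ = (t : ℂ) ^ (-((m : ℂ) / 2)) * gauss t⁻¹ ξ := by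
  have hpi : (Real.pi : ℂ) ≠ 0 := by exact_mod_cast Real.pi_ne_zero
  have htc : (t : ℂ) ≠ 0 := by exact_mod_cast ht.ne'
  have hb : 0 < ((Real.pi * t : ℝ) : ℂ).re := by
    rw [Complex.ofReal_re]
    exact mul_pos Real.pi_pos ht
  have h := fourier_gaussian_innerProductSpace (V := E m) (b := ((Real.pi * t : ℝ) : ℂ)) hb ξ
  have h1 : (fun x : E m => gauss t x)
      = fun v : E m => Complex.exp (-((Real.pi * t : ℝ) : ℂ) * (‖v‖ : ℂ) ^ 2) := by
    ext v
    rw [gauss]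
    push_cast
    ring_nf
  have h3 : (Real.pi : ℂ) / ((Real.pi * t : ℝ) : ℂ) = ((t⁻¹ : ℝ) : ℂ) := by
    push_cast
    field_simp
  rw [h1, h, finrank_E, h3, gauss]
  congr 1
  · rw [Complex.cpow_neg, Complex.ofReal_inv, Complex.inv_cpow]
    rw [Complex.arg_ofReal_of_nonneg ht.le]
    exact Real.pi_ne_zero.symm
  · congr 1
    push_cast
    field_simp

theorem harmonicData_one : HarmonicData (m := m) 0 1 (fun _ => 1) where
  le_one := zero_le_one
  parity := hasParity_one
  cont := continuous_const
  norm_le x := by simp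
  homog_eq x hx := by simp [homog, hx]
  fourier t ht ξ := by simpa using fourier_gauss ht ξ

open FourierTransform in
-- The derivative of the transformed Gaussian in the direction e_j is computed twice: under the
-- integral sign it gives the factor -2πi x_j, and from the explicit Gaussian it gives -2πξ_j / t.
theorem fourier_coord_gauss (hm : 1 ≤ m) (j : Fin m) {t : ℝ} (ht : 0 < t) (ξ : E m) :
    𝓕 (fun x : E m => ((x j : ℝ) : ℂ) * gauss t x) ξ
      = (-Complex.I) ^ 1 * ((t : ℂ) ^ (-((m : ℂ) / 2 + (1 : ℕ)))
        * (((ξ j : ℝ) : ℂ) * gauss t⁻¹ ξ)) := by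
  have hpi : (Real.pi : ℂ) ≠ 0 := by exact_mod_cast Real.pi_ne_zero
  have htc : (t : ℂ) ≠ 0 := by exact_mod_cast ht.ne'
  have hcg : Continuous fun x : E m => gauss t x := continuous_gauss_right t
  have hg : Integrable (fun x : E m => gauss t x) := by
    refine (integrable_pow_mul_gauss hm 0 ht).mono' hcg.aestronglyMeasurable
      (Filter.Eventually.of_forall fun x => ?_)
    rw [norm_gauss]; simp
  have hg1 : Integrable (fun x : E m => ‖x‖ * ‖gauss t x‖) := by
    simpa [norm_gauss] using integrable_pow_mul_gauss hm 1 ht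
  set v : E m := EuclideanSpace.single j 1 with hv
  have hin : ∀ x : E m, inner ℝ x v = x j := fun x => by
    rw [hv, EuclideanSpace.inner_single_right]
    simp
  have h1 := Real.hasFDerivAt_fourier hg hg1 ξ
  have hsm : Integrable (VectorFourier.fourierSMulRight (innerSL ℝ) (fun x : E m => gauss t x)) := by
    refine (hg1.const_mul (2 * Real.pi * ‖innerSL ℝ (E := E m)‖)).mono'
      (hg.aestronglyMeasurable.fourierSMulRight (L := innerSL ℝ))
      (Filter.Eventually.of_forall fun x => ?_)
    refine (VectorFourier.norm_fourierSMulRight_le _ _ _).trans (le_of_eq ?_)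
    ring
  have h2 : HasDerivAt (fun s : ℝ => 𝓕 (fun x : E m => gauss t x) (ξ + s • v))
      (-(2 * Real.pi * Complex.I) * 𝓕 (fun x : E m => ((x j : ℝ) : ℂ) * gauss t x) ξ) 0 := by
    have hl : HasDerivAt (fun s : ℝ => ξ + s • v) v 0 := by
      simpa using ((hasDerivAt_id (0 : ℝ)).smul_const v).const_add ξ
    have h1' : HasFDerivAt (𝓕 (fun x : E m => gauss t x))
        (𝓕 (VectorFourier.fourierSMulRight (innerSL ℝ) (fun x : E m => gauss t x)) ξ)
        (ξ + (0 : ℝ) • v) := by simpa using h1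
    refine (h1'.comp_hasDerivAt 0 hl).congr_deriv ?_
    rw [Real.fourier_continuousLinearMap_apply hsm]
    rw [Real.fourier_eq, Real.fourier_eq, ← integral_const_mul]
    congr 1
    ext x
    rw [VectorFourier.fourierSMulRight_apply]
    have hx : (innerSL ℝ x) v = x j := hin x
    simp only [hx, Circle.smul_def, smul_eq_mul, Complex.real_smul]
    ring
  have h3 : HasDerivAt (fun s : ℝ => 𝓕 (fun x : E m => gauss t x) (ξ + s • v))
      ((t : ℂ) ^ (-((m : ℂ) / 2)) * (gauss t⁻¹ ξ * (-(2 * Real.pi * ξ j / t)))) 0 := by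
    have hfun : (fun s : ℝ => 𝓕 (fun x : E m => gauss t x) (ξ + s • v)) = fun s : ℝ =>
        (t : ℂ) ^ (-((m : ℂ) / 2)) * Complex.exp
          (-((Real.pi : ℂ) * (t : ℂ)⁻¹) * ((‖ξ‖ ^ 2 + 2 * s * ξ j + s ^ 2 : ℝ) : ℂ)) := by
      ext s
      rw [fourier_gauss ht, gauss]
      have hns : ‖ξ + s • v‖ ^ 2 = ‖ξ‖ ^ 2 + 2 * s * ξ j + s ^ 2 := by
        rw [norm_add_sq_real, inner_smul_right, hin, norm_smul]
        simp only [hv, PiLp.norm_single, norm_one, mul_one, Real.norm_eq_abs, sq_abs]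
        ring
      rw [hns]
      push_cast
      ring_nf
    rw [hfun]
    refine HasDerivAt.const_mul _ ?_
    have hq : HasDerivAt (fun s : ℝ => ‖ξ‖ ^ 2 + 2 * s * ξ j + s ^ 2) (2 * ξ j) 0 := by
      refine (((((hasDerivAt_id (0 : ℝ)).const_mul 2).mul_const (ξ j)).const_add
        (‖ξ‖ ^ 2)).add ((hasDerivAt_id (0 : ℝ)).fun_pow 2)).congr_deriv ?_
      simp
    have hq2 := (hq.ofReal_comp.const_mul (-((Real.pi : ℂ) * (t : ℂ)⁻¹))).cexp
    refine hq2.congr_deriv ?_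
    rw [gauss]
    push_cast
    have : -((Real.pi : ℂ) * (t : ℂ)⁻¹) * (‖ξ‖ ^ 2 + 2 * 0 * ξ j + 0 ^ 2)
        = -(Real.pi * ‖ξ‖ ^ 2 * (t : ℂ)⁻¹) := by ring
    rw [this]
    field_simp
  have h4 := h2.unique h3
  have hI : Complex.I ≠ 0 := Complex.I_ne_zero
  have h5 : (t : ℂ) ^ (-((m : ℂ) / 2 + (1 : ℕ))) = (t : ℂ) ^ (-((m : ℂ) / 2)) * (t : ℂ)⁻¹ := by
    rw [neg_add, Complex.cpow_add _ _ htc]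
    simp [Complex.cpow_neg]
  rw [h5]
  have h6 : (2 * Real.pi * Complex.I) ≠ 0 := by simp [hpi]
  apply mul_left_cancel₀ (neg_ne_zero.2 h6)
  rw [h4]
  field_simp
  rw [Complex.I_sq]
  ring

theorem harmonicData_coord (hm : 1 ≤ m) (j : Fin m) :
    HarmonicData 1 (coord j) (fun x : E m => ((x j : ℝ) : ℂ)) where
  le_one := le_rfl
  parity := hasParity_coord j
  cont := by fun_prop
  norm_le x := by
    rw [pow_one, Complex.norm_real]
    exact PiLp.norm_apply_le x j
  homog_eq x hx := by
    have : (‖x‖ : ℂ) ≠ 0 := by exact_mod_cast norm_ne_zero_iff.2 hx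
    simp only [homog, hx, dite_false, coord, ContinuousMap.coe_mk, PiLp.smul_apply, smul_eq_mul]
    push_cast
    field_simp
  fourier t ht ξ := fourier_coord_gauss hm j ht ξ

/-! ### The Fourier transform of the normalized family, by Gaussian subordination -/

/-- Euler's integral for Γ with rate π|x|², used to write a power of |x| as a superposition of
Gaussians. -/
theorem integral_cpow_mul_gauss {a : ℂ} (ha : 0 < a.re) {x : E m} (hx : x ≠ 0) :
    ∫ t in Ioi (0 : ℝ), (t : ℂ) ^ (a - 1) * gauss t x
      = (Real.pi : ℂ) ^ (-a) * (‖x‖ : ℂ) ^ (-2 * a) * Complex.Gamma a := by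
  have hx0 : 0 < ‖x‖ := norm_pos_iff.2 hx
  have hr : 0 < Real.pi * ‖x‖ ^ 2 := by positivity
  have h := Complex.integral_cpow_mul_exp_neg_mul_Ioi ha hr
  unfold gauss
  rw [h]
  congr 1
  have h1 : (1 / ((Real.pi * ‖x‖ ^ 2 : ℝ) : ℂ)) ^ a = (((Real.pi * ‖x‖ ^ 2 : ℝ) : ℂ)) ^ (-a) := by
    rw [one_div, Complex.inv_cpow, Complex.cpow_neg]
    rw [Complex.arg_ofReal_of_nonneg hr.le]
    exact Real.pi_ne_zero.symm
  rw [h1, Complex.ofReal_mul, Complex.mul_cpow_ofReal_nonneg Real.pi_pos.le (by positivity)]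
  congr 1
  have h2 : -2 * a = (2 : ℕ) * (-a) := by push_cast; ring
  rw [h2, Complex.cpow_nat_mul']
  · push_cast; rfl
  · rw [Complex.arg_ofReal_of_nonneg hx0.le]; simpa using Real.pi_pos
  · rw [Complex.arg_ofReal_of_nonneg hx0.le]; simpa using Real.pi_pos.le

/-- The pairing of a test function with `P exp (-π t |x| ^ 2)`. -/
def gaussPairing (P : E m → ℂ) (g : 𝓢(E m, ℂ)) (t : ℝ) : ℂ := ∫ x, P x * gauss t x * g x

theorem norm_cpow_mul_gauss {a : ℂ} (x : E m) {t : ℝ} (ht : t ∈ Ioi (0 : ℝ)) :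
    ‖(t : ℂ) ^ (a - 1) * gauss t x‖ = t ^ (a.re - 1) * Real.exp (-(Real.pi * ‖x‖ ^ 2 * t)) := by
  rw [norm_mul, norm_gauss, Complex.norm_cpow_eq_rpow_re_of_pos ht]
  simp

theorem integral_rpow_mul_gauss {a : ℝ} (ha : 0 < a) {x : E m} (hx : x ≠ 0) :
    ∫ t in Ioi (0 : ℝ), t ^ (a - 1) * Real.exp (-(Real.pi * ‖x‖ ^ 2 * t))
      = (Real.pi ^ (-a) * Real.Gamma a) * ‖x‖ ^ (-2 * a) := by
  have hx0 : 0 < ‖x‖ := norm_pos_iff.2 hx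
  rw [Real.integral_rpow_mul_exp_neg_mul_Ioi ha (by positivity), one_div,
    Real.inv_rpow (by positivity), ← Real.rpow_neg (by positivity),
    Real.mul_rpow Real.pi_pos.le (by positivity), ← Real.rpow_natCast ‖x‖ 2,
    ← Real.rpow_mul hx0.le]
  have : ((2 : ℕ) : ℝ) * -a = -2 * a := by push_cast; ring
  rw [this]
  ring

/-- Tonelli: integrating the norm over t first leaves a constant times |x|^(Re λ - p) |P x|, which
is at most |x|^(Re λ) and hence integrable against a Schwartz function for Re λ > -m. -/
theorem HarmonicData.integrable_prod (hm : 1 ≤ m) {p : ℕ} {w : C(Sph m, ℂ)} {P : E m → ℂ}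
    (h : HarmonicData p w P) {lam : ℂ} (h1 : -(m : ℝ) < lam.re) (h2 : lam.re < p)
    (g : 𝓢(E m, ℂ)) :
    Integrable (fun q : E m × ℝ => (q.2 : ℂ) ^ ((p - lam) / 2 - 1) * gauss q.2 q.1
      * (P q.1 * g q.1)) (volume.prod (volume.restrict (Ioi 0))) := by
  have : Nontrivial (E m) := by
    have : Nonempty (Fin m) := ⟨⟨0, hm⟩⟩
    infer_instance
  have ha : 0 < ((p - lam) / 2).re := by simp; linarith
  have hre : ((p - lam) / 2).re = (p - lam.re) / 2 := by simp
  have hne : ∀ᵐ x : E m, x ≠ 0 := by simp [ae_iff]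
  have hmeas : Measurable fun q : E m × ℝ => (q.2 : ℂ) ^ ((p - lam) / 2 - 1) * gauss q.2 q.1
      * (P q.1 * g q.1) := by
    refine (Measurable.mul ?_ continuous_gauss.measurable).mul
      (((h.cont.mul g.continuous).comp continuous_fst).measurable)
    exact (Complex.measurable_ofReal.comp measurable_snd).pow_const _
  have hnorm : ∀ x : E m, x ≠ 0 → ∫ t in Ioi (0 : ℝ), ‖(t : ℂ) ^ ((p - lam) / 2 - 1) * gauss t x
      * (P x * g x)‖ = (Real.pi ^ (-((p - lam) / 2).re) * Real.Gamma ((p - lam) / 2).re) *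
        ‖x‖ ^ (-2 * ((p - lam) / 2).re) * ‖P x * g x‖ := fun x hx => by
    rw [← integral_rpow_mul_gauss ha hx, ← integral_mul_const]
    refine setIntegral_congr_fun measurableSet_Ioi fun t ht => ?_
    rw [← norm_cpow_mul_gauss x ht, norm_mul _ (P x * g x)]
  refine (integrable_prod_iff hmeas.aestronglyMeasurable).2 ⟨?_, ?_⟩
  · filter_upwards [hne] with x hx
    refine Integrable.mul_const ?_ _
    -- The integral of a non-integrable function is 0 by convention, so a nonzero value proves
    -- integrability.
    refine Integrable.of_integral_ne_zero ?_
    rw [integral_cpow_mul_gauss ha hx]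
    have hpi : (Real.pi : ℂ) ≠ 0 := by exact_mod_cast Real.pi_ne_zero
    have hx0 : (‖x‖ : ℂ) ≠ 0 := by exact_mod_cast norm_ne_zero_iff.2 hx
    exact mul_ne_zero (mul_ne_zero (by simp [Complex.cpow_eq_zero_iff, hpi])
      (by simp [Complex.cpow_eq_zero_iff, hx0])) (Complex.Gamma_ne_zero_of_re_pos ha)
  · have hI := (integrable_radial_mul hm (1 : C(Sph m, ℂ)) h1 g).norm.const_mul
      (Real.pi ^ (-((p - lam) / 2).re) * Real.Gamma ((p - lam) / 2).re)
    refine hI.mono' hmeas.norm.aestronglyMeasurable.integral_prod_right' ?_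
    filter_upwards [hne] with x hx
    have hx0 : 0 < ‖x‖ := norm_pos_iff.2 hx
    rw [hnorm x hx, Real.norm_of_nonneg (by
      have := Real.Gamma_pos_of_pos ha
      positivity), mul_assoc]
    refine mul_le_mul_of_nonneg_left ?_ (by
      have := Real.Gamma_pos_of_pos ha
      positivity)
    have h3 : ‖radial (1 : C(Sph m, ℂ)) lam x‖ = ‖x‖ ^ lam.re := by
      rw [radial, norm_mul, Complex.norm_cpow_eq_rpow_re_of_pos hx0]
      simp [homog, hx]
    rw [norm_mul, norm_mul, h3, ← mul_assoc]
    refine mul_le_mul_of_nonneg_right ?_ (norm_nonneg _)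
    calc _ ≤ ‖x‖ ^ (-2 * ((p - lam) / 2).re) * ‖x‖ ^ p :=
          mul_le_mul_of_nonneg_left (h.norm_le x) (by positivity)
      _ = ‖x‖ ^ lam.re := by
          rw [← Real.rpow_natCast, ← Real.rpow_add hx0, hre]
          congr 1; ring

/-- Away from 0, |x|^λ w(x/|x|) = |x|^(λ-p) P(x). The power is replaced by its Gaussian integral,
where Re λ < p makes the Gamma argument positive, and the integrals are interchanged. -/
theorem HarmonicData.subordination (hm : 1 ≤ m) {p : ℕ} {w : C(Sph m, ℂ)} {P : E m → ℂ}
    (h : HarmonicData p w P) {lam : ℂ} (h1 : -(m : ℝ) < lam.re) (h2 : lam.re < p)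
    (g : 𝓢(E m, ℂ)) :
    Complex.Gamma ((p - lam) / 2) * (Real.pi : ℂ) ^ (-((p - lam) / 2)) * ∫ x, radial w lam x * g x
      = ∫ t in Ioi (0 : ℝ), (t : ℂ) ^ ((p - lam) / 2 - 1) * gaussPairing P g t := by
  have : Nontrivial (E m) := by
    have : Nonempty (Fin m) := ⟨⟨0, hm⟩⟩
    infer_instance
  have ha : 0 < ((p - lam) / 2).re := by simp; linarith
  have hne : ∀ᵐ x : E m, x ≠ 0 := by simp [ae_iff]
  have hswap := integral_integral_swap
    (f := fun (x : E m) (t : ℝ) => (t : ℂ) ^ ((p - lam) / 2 - 1) * gauss t x * (P x * g x)) (h.integrable_prod hm h1 h2 g)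
  have hr : ∀ t : ℝ, ∫ x, (t : ℂ) ^ ((p - lam) / 2 - 1) * gauss t x * (P x * g x)
      = (t : ℂ) ^ ((p - lam) / 2 - 1) * gaussPairing P g t := fun t => by
    rw [gaussPairing, ← integral_const_mul]
    congr 1
    ext x
    ring
  simp only [hr] at hswap
  rw [← hswap, ← integral_const_mul]
  refine integral_congr_ae ?_
  filter_upwards [hne] with x hx
  have hx0 : (‖x‖ : ℂ) ≠ 0 := by exact_mod_cast norm_ne_zero_iff.2 hx
  rw [integral_mul_const, integral_cpow_mul_gauss ha hx, h.homog_eq x hx, radial]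
  have h3 : (‖x‖ : ℂ) ^ lam = (‖x‖ : ℂ) ^ (-2 * ((p - lam) / 2)) * (‖x‖ : ℂ) ^ p := by
    rw [← Complex.cpow_natCast, ← Complex.cpow_add _ _ hx0]
    congr 1; ring
  rw [h3]
  ring

open FourierTransform in
theorem HarmonicData.gaussPairing_fourier (hm : 1 ≤ m) {p : ℕ} {w : C(Sph m, ℂ)} {P : E m → ℂ}
    (h : HarmonicData p w P) (φ : 𝓢(E m, ℂ)) {t : ℝ} (ht : 0 < t) :
    gaussPairing P (𝓕 φ) t
      = (-Complex.I) ^ p * ((t : ℂ) ^ (-((m : ℂ) / 2 + p)) * gaussPairing P φ t⁻¹) := by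
  have h1 := integral_fourier_mul (h.integrable hm ht) φ.integrable
  simp only [gaussPairing]
  rw [SchwartzMap.fourier_coe, ← h1, ← integral_const_mul, ← integral_const_mul]
  congr 1
  ext ξ
  rw [h.fourier t ht ξ]
  ring

open FourierTransform in
-- Transforming the Gaussians replaces t by 1/t. The substitution s = 1/t then turns the
-- subordination integral for λ into the one for -λ - m; in the strip both exponents are locally
-- integrable.
theorem HarmonicData.fam_fourier_of_strip (hm : 1 ≤ m) {p : ℕ} {w : C(Sph m, ℂ)} {P : E m → ℂ}
    (h : HarmonicData p w P) (φ : 𝓢(E m, ℂ)) {lam : ℂ} (h1 : -(m : ℝ) < lam.re) (h2 : lam.re < 0) :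
    fam p w lam (𝓕 φ) = (-Complex.I) ^ p * fam p w (-lam - m) φ := by
  have hp0 : (0 : ℝ) ≤ p := Nat.cast_nonneg p
  have h1' : -(m : ℝ) < (-lam - m).re := by simp; linarith
  have ha : 0 < ((p - lam) / 2).re := by simp; linarith
  have hb : 0 < ((p - (-lam - m)) / 2).re := by simp; linarith
  have hs1 := h.subordination hm h1 (h2.trans_le hp0) (𝓕 φ)
  have hs2 := h.subordination hm h1' (by simp; linarith) φ
  have hcv := integral_comp_rpow_Ioi
    (fun s : ℝ => (s : ℂ) ^ ((p - (-lam - m)) / 2 - 1) * gaussPairing P φ s) (p := -1) (by norm_num)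
  have hkey : ∫ t in Ioi (0 : ℝ), (t : ℂ) ^ ((p - lam) / 2 - 1) * gaussPairing P (𝓕 φ) t
      = (-Complex.I) ^ p *
        ∫ t in Ioi (0 : ℝ), (t : ℂ) ^ ((p - (-lam - m)) / 2 - 1) * gaussPairing P φ t := by
    rw [← hcv, ← integral_const_mul]
    refine setIntegral_congr_fun measurableSet_Ioi fun t ht => ?_
    have ht0 : (t : ℂ) ≠ 0 := by exact_mod_cast (ne_of_gt ht)
    have ht1 : (((t ^ (-1 : ℝ)) : ℝ) : ℂ) = (t : ℂ)⁻¹ := by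
      rw [Real.rpow_neg_one]; push_cast; rfl
    have ht2 : ((t ^ ((-1 : ℝ) - 1) : ℝ) : ℂ) = (t : ℂ) ^ (-2 : ℂ) := by
      rw [Complex.ofReal_cpow (le_of_lt ht)]
      norm_num
    simp only [h.gaussPairing_fourier hm φ ht, Complex.real_smul]
    rw [Complex.ofReal_mul, ht1, ht2, Complex.inv_cpow _ _ (by
      rw [Complex.arg_ofReal_of_nonneg (le_of_lt ht)]
      exact Real.pi_ne_zero.symm), ← Complex.cpow_neg, Real.rpow_neg_one]
    have h5 : (t : ℂ) ^ ((p - lam) / 2 - 1) * (t : ℂ) ^ (-((m : ℂ) / 2 + p))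
        = (t : ℂ) ^ (-2 : ℂ) * (t : ℂ) ^ (-((p - (-lam - m)) / 2 - 1)) := by
      rw [← Complex.cpow_add _ _ ht0, ← Complex.cpow_add _ _ ht0]
      congr 1; ring
    simp only [abs_neg, abs_one, Complex.ofReal_one, one_mul]
    linear_combination ((-Complex.I) ^ p * gaussPairing P φ t⁻¹) * h5
  rw [hkey, ← hs2] at hs1
  rw [fam_eq_integral hm h.le_one h.parity _ h1, fam_eq_integral hm h.le_one h.parity _ h1']
  have hpi : (Real.pi : ℂ) ≠ 0 := by exact_mod_cast Real.pi_ne_zero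
  have e1 : (lam + m + p) / 2 = (p - (-lam - m)) / 2 := by ring
  have e2 : (-lam - m + m + p) / 2 = (p - lam) / 2 := by ring
  simp only [piFactor]
  rw [e1, e2]
  have hΓa := Complex.Gamma_ne_zero_of_re_pos ha
  have hΓb := Complex.Gamma_ne_zero_of_re_pos hb
  have hpa : (Real.pi : ℂ) ^ ((p - lam) / 2) ≠ 0 := by simp [Complex.cpow_eq_zero_iff, hpi]
  have hpb : (Real.pi : ℂ) ^ ((p - (-lam - m)) / 2) ≠ 0 := by simp [Complex.cpow_eq_zero_iff, hpi]
  rw [Complex.cpow_neg, Complex.cpow_neg] at hs1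
  field_simp at hs1 ⊢
  linear_combination hs1

open FourierTransform in
/-- The Fourier transform of the normalized distributions `Fp |x| ^ λ w(x / |x|)`. -/
theorem HarmonicData.fam_fourier (hm : 1 ≤ m) {p : ℕ} {w : C(Sph m, ℂ)} {P : E m → ℂ}
    (h : HarmonicData p w P) (φ : 𝓢(E m, ℂ)) (lam : ℂ) :
    fam p w lam (𝓕 φ) = (-Complex.I) ^ p * fam p w (-lam - m) φ := by
  have d1 : Differentiable ℂ fun lam => fam p w lam (𝓕 φ) := differentiable_fam h.le_one h.parity _
  have d2 : Differentiable ℂ fun lam : ℂ => (-Complex.I) ^ p * fam p w (-lam - m) φ := by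
    refine Differentiable.const_mul ?_ _
    have : Differentiable ℂ fun lam : ℂ => -lam - m := by fun_prop
    exact (differentiable_fam h.le_one h.parity φ).comp this
  -- Both sides are entire and agree near -m/2, the centre of the strip.
  have heq := AnalyticOnNhd.eq_of_eventuallyEq (𝕜 := ℂ) (z₀ := -(m : ℂ) / 2)
    (d1.differentiableOn.analyticOnNhd isOpen_univ) (d2.differentiableOn.analyticOnNhd isOpen_univ) ?_
  · exact congrFun heq lam
  · have hm0 : (1 : ℝ) ≤ m := by exact_mod_cast hm
    have hopen : IsOpen {z : ℂ | -(m : ℝ) < z.re ∧ z.re < 0} :=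
      (isOpen_lt continuous_const Complex.continuous_re).inter
        (isOpen_lt Complex.continuous_re continuous_const)
    have hre : (-(m : ℂ) / 2).re = -(m : ℝ) / 2 := by simp
    filter_upwards [hopen.mem_nhds (show -(m : ℂ) / 2 ∈ _ by
      simp only [Set.mem_ofPred_eq, hre]; constructor <;> linarith)] with z hz
    exact h.fam_fourier_of_strip hm φ hz.1 hz.2

/-! ### Growth of the regularizations -/

theorem one_add_norm_le_mul (x y : E m) : 1 + ‖y‖ ≤ (1 + ‖x‖) * (1 + ‖y - x‖) := by
  have h : ‖y‖ ≤ ‖x‖ + ‖y - x‖ := by simpa using norm_add_le x (y - x)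
  nlinarith [norm_nonneg x, norm_nonneg (y - x)]

/-- Peetre's inequality. -/
theorem peetre (a : ℝ) (x y : E m) :
    (1 + ‖x‖) ^ a ≤ (1 + ‖y‖) ^ a * (1 + ‖y - x‖) ^ |a| := by
  have hx : 0 < 1 + ‖x‖ := by positivity
  have hy : 0 < 1 + ‖y‖ := by positivity
  have hyx : 0 < 1 + ‖y - x‖ := by positivity
  rcases le_total 0 a with ha | ha
  · rw [abs_of_nonneg ha, ← Real.mul_rpow hy.le hyx.le]
    have := one_add_norm_le_mul y x
    rw [norm_sub_rev] at this
    exact Real.rpow_le_rpow hx.le this ha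
  · rw [abs_of_nonpos ha]
    have h1 : (1 + ‖y‖) ^ (-a) ≤ (1 + ‖x‖) ^ (-a) * (1 + ‖y - x‖) ^ (-a) := by
      rw [← Real.mul_rpow hx.le hyx.le]
      exact Real.rpow_le_rpow hy.le (one_add_norm_le_mul x y) (by linarith)
    have h2 : (1 + ‖x‖) ^ a * (1 + ‖x‖) ^ (-a) = 1 := by
      rw [← Real.rpow_add hx]; simp
    have h3 : (1 + ‖y‖) ^ a * (1 + ‖y‖) ^ (-a) = 1 := by
      rw [← Real.rpow_add hy]; simp
    calc (1 + ‖x‖) ^ a = (1 + ‖x‖) ^ a * ((1 + ‖y‖) ^ a * (1 + ‖y‖) ^ (-a)) := by rw [h3, mul_one]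
      _ ≤ (1 + ‖x‖) ^ a * ((1 + ‖y‖) ^ a * ((1 + ‖x‖) ^ (-a) * (1 + ‖y - x‖) ^ (-a))) := by gcongr
      _ = ((1 + ‖x‖) ^ a * (1 + ‖x‖) ^ (-a)) * ((1 + ‖y‖) ^ a * (1 + ‖y - x‖) ^ (-a)) := by ring
      _ = _ := by rw [h2, one_mul]

theorem norm_iteratedFDeriv_reflTranslate (φ : 𝓢(E m, ℂ)) (k : ℕ) (x y : E m) :
    ‖iteratedFDeriv ℝ k (reflTranslate y φ) x‖ = ‖iteratedFDeriv ℝ k φ (y - x)‖ := by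
  have h : (⇑(reflTranslate y φ)) = (fun z => φ (y + z)) ∘ LinearIsometryEquiv.neg ℝ (E := E m) := by
    ext z
    simp [reflTranslate_apply, sub_eq_add_neg]
  rw [h, LinearIsometryEquiv.norm_iteratedFDeriv_comp_right, iteratedFDeriv_comp_add_left]
  simp [sub_eq_add_neg]

/-- For |x| ≤ 1 one has 1 + |y| ≤ 2(1 + |y - x|), so the Schwartz decay of φ becomes decay in y. The
order a is arbitrary: near the origin the regularization sees only the tail of φ. -/
theorem exists_sphMeanDeriv_reflTranslate_le (w : C(Sph m, ℂ)) (φ : 𝓢(E m, ℂ)) (k : ℕ) (a : ℝ) :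
    ∃ C : ℝ, 0 ≤ C ∧ ∀ y : E m, ∀ r ∈ Icc (0 : ℝ) 1,
      ‖sphMeanDeriv w (reflTranslate y φ) k r‖ ≤ C * (1 + ‖y‖) ^ a := by
  obtain ⟨K, hK⟩ := exists_nat_gt (-a)
  obtain ⟨C, hC, h⟩ := one_add_norm_mul_le φ K k
  refine ⟨|(area m)⁻¹| * (‖w‖ * (C * 2 ^ (K : ℝ)) * area m), by
    have := area_nonneg m
    positivity, fun y r hr => ?_⟩
  have hpt : ∀ ω : Sph m, ‖w ω * iteratedFDeriv ℝ k (reflTranslate y φ) (r • (ω : E m))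
      (fun _ => (ω : E m))‖ ≤ ‖w‖ * (C * 2 ^ (K : ℝ) * (1 + ‖y‖) ^ a) := fun ω => by
    rw [norm_mul]
    refine mul_le_mul (w.norm_coe_le_norm ω) ?_ (norm_nonneg _) (norm_nonneg _)
    refine (ContinuousMultilinearMap.le_opNorm _ _).trans ?_
    simp only [sphere_norm, Finset.prod_const_one, mul_one]
    rw [norm_iteratedFDeriv_reflTranslate]
    refine (h _).trans ?_
    rw [mul_assoc]
    refine mul_le_mul_of_nonneg_left ?_ hC
    have h1 := one_add_norm_le_mul (r • (ω : E m)) y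
    rw [norm_smul, sphere_norm, mul_one, Real.norm_of_nonneg hr.1] at h1
    have hpos : 0 < 1 + ‖y - r • (ω : E m)‖ := by positivity
    have h2 : 1 + ‖y‖ ≤ 2 * (1 + ‖y - r • (ω : E m)‖) :=
      h1.trans (mul_le_mul_of_nonneg_right (by linarith [hr.2]) hpos.le)
    have h3 : (1 + ‖y‖) ^ (K : ℝ) ≤ 2 ^ (K : ℝ) * (1 + ‖y - r • (ω : E m)‖) ^ (K : ℝ) := by
      rw [← Real.mul_rpow zero_le_two hpos.le]
      exact Real.rpow_le_rpow (by positivity) h2 (Nat.cast_nonneg K)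
    have h4 : (1 + ‖y‖) ^ (-(K : ℝ)) ≤ (1 + ‖y‖) ^ a :=
      Real.rpow_le_rpow_of_exponent_le (by linarith [norm_nonneg y]) (by linarith)
    refine le_trans ?_ (mul_le_mul_of_nonneg_left h4 (by positivity))
    rw [Real.rpow_neg (by positivity), Real.rpow_neg (by positivity), ← div_eq_mul_inv,
      inv_eq_one_div, div_le_div_iff₀ (by positivity) (by positivity), one_mul]
    exact h3
  unfold sphMeanDeriv
  rw [norm_mul]
  have h5 := norm_integral_le_of_norm_le_const (μ := surf m) (Filter.Eventually.of_forall hpt)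
  calc _ ≤ |(area m)⁻¹| * (‖w‖ * (C * 2 ^ (K : ℝ) * (1 + ‖y‖) ^ a) * (surf m).real univ) := by
        refine mul_le_mul (by simp) h5 (norm_nonneg _) (abs_nonneg _)
    _ = _ := by unfold area; ring

/-- Returning to Cartesian coordinates makes Peetre's inequality available for the outer part; no
condition on λ is needed as the singularity is cut off. -/
theorem area_mul_outer_eq (hm : 1 ≤ m) (w : C(Sph m, ℂ)) (φ : 𝓢(E m, ℂ)) (lam : ℂ) :
    (area m : ℂ) * ∫ r in Ioi (1 : ℝ), (r : ℂ) ^ (lam + m - 1) * sphMean w φ r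
      = ∫ x in {x : E m | 1 < ‖x‖}, radial w lam x * φ x := by
  have hs : MeasurableSet {x : E m | 1 < ‖x‖} := measurableSet_lt measurable_const measurable_norm
  -- For |x| > 1 a larger exponent dominates, and a nonnegative one is locally integrable, so the
  -- indicator function is dominated by an integrable function on the whole space.
  set μ0 : ℝ := max lam.re 0 with hμ0
  have hI : Integrable ({x : E m | 1 < ‖x‖}.indicator fun x => radial w lam x * φ x) := by
    have hJ := ((integrable_radial_mul hm (1 : C(Sph m, ℂ)) (lam := (μ0 : ℂ)) (by
      rw [Complex.ofReal_re]
      have : (1 : ℝ) ≤ m := by exact_mod_cast hm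
      linarith [le_max_right lam.re 0]) φ).norm.const_mul ‖w‖)
    refine hJ.mono' (((measurable_radial w lam).mul φ.continuous.measurable).indicator
      hs).aestronglyMeasurable (Filter.Eventually.of_forall fun x => ?_)
    by_cases hx : x ∈ {x : E m | 1 < ‖x‖}
    · rw [indicator_of_mem hx]
      have hx1 : 1 < ‖x‖ := hx
      have hx0 : 0 < ‖x‖ := zero_lt_one.trans hx1
      have hne : x ≠ 0 := norm_pos_iff.1 hx0
      have h3 : ‖radial (1 : C(Sph m, ℂ)) (μ0 : ℂ) x‖ = ‖x‖ ^ μ0 := by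
        rw [radial, norm_mul, Complex.norm_cpow_eq_rpow_re_of_pos hx0]
        simp [homog, hne]
      rw [norm_mul, norm_mul, h3, ← mul_assoc]
      refine mul_le_mul_of_nonneg_right ((norm_radial_le w lam x).trans ?_) (norm_nonneg _)
      exact mul_le_mul_of_nonneg_left
        (Real.rpow_le_rpow_of_exponent_le hx1.le (le_max_left _ _)) (norm_nonneg _)
    · rw [indicator_of_notMem hx, norm_zero]
      positivity
  obtain ⟨-, h2⟩ := integral_polar hm hI
  rw [integral_indicator hs] at h2
  rw [h2, ← integral_const_mul, ← integral_indicator measurableSet_Ioi,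
    ← integral_indicator measurableSet_Ioi]
  congr 1
  ext r
  by_cases hr0 : r ∈ Ioi (0 : ℝ)
  · rw [indicator_of_mem hr0]
    have hrc : (r : ℂ) ≠ 0 := by exact_mod_cast (ne_of_gt hr0)
    have hnorm : ∀ ω : Sph m, ‖r • (ω : E m)‖ = r := fun ω => by
      rw [norm_smul, sphere_norm, mul_one, Real.norm_of_nonneg (le_of_lt hr0)]
    by_cases hr : r ∈ Ioi (1 : ℝ)
    · rw [indicator_of_mem hr]
      have h3 : ∀ ω : Sph m, ({x : E m | 1 < ‖x‖}.indicator fun x => radial w lam x * φ x)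
          (r • (ω : E m)) = (r : ℂ) ^ lam * (w ω * φ (r • (ω : E m))) := fun ω => by
        rw [indicator_of_mem (by rw [Set.mem_ofPred_eq, hnorm]; exact hr), radial,
          homog_smul w ω hr0, hnorm, mul_assoc]
      simp only [h3]
      have h4 : (r : ℂ) ^ (lam + m - 1) = (r : ℂ) ^ lam * (r : ℂ) ^ (m - 1) := by
        rw [← Complex.cpow_natCast, ← Complex.cpow_add _ _ hrc]
        push_cast [hm]
        ring_nf
      rw [integral_const_mul, sphMean, h4]
      have := area_ne_zero hm
      push_cast
      field_simp
    · rw [indicator_of_notMem hr]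
      have h3 : ∀ ω : Sph m, ({x : E m | 1 < ‖x‖}.indicator fun x => radial w lam x * φ x)
          (r • (ω : E m)) = 0 := fun ω =>
        indicator_of_notMem (by rw [Set.mem_ofPred_eq, hnorm]; exact hr) _
      simp [h3]
  · have hr : r ∉ Ioi (1 : ℝ) := fun h => hr0 (zero_lt_one.trans (mem_Ioi.1 h))
    rw [indicator_of_notMem hr0, indicator_of_notMem hr]

theorem rpow_norm_le_of_one_lt {a : ℝ} {x : E m} (hx : 1 < ‖x‖) :
    ‖x‖ ^ a ≤ 2 ^ |a| * (1 + ‖x‖) ^ a := by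
  have hx0 : 0 < ‖x‖ := zero_lt_one.trans hx
  rcases le_total 0 a with ha | ha
  · calc ‖x‖ ^ a ≤ (1 + ‖x‖) ^ a := Real.rpow_le_rpow hx0.le (by linarith) ha
      _ ≤ 2 ^ |a| * (1 + ‖x‖) ^ a :=
        le_mul_of_one_le_left (by positivity) (Real.one_le_rpow one_le_two (abs_nonneg a))
  · rw [abs_of_nonpos ha]
    calc ‖x‖ ^ a ≤ ((1 + ‖x‖) / 2) ^ a :=
          Real.rpow_le_rpow_of_nonpos (by positivity) (by linarith) ha
      _ = 2 ^ (-a) * (1 + ‖x‖) ^ a := by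
          rw [Real.div_rpow (by positivity) zero_le_two, Real.rpow_neg zero_le_two, div_eq_mul_inv,
            mul_comm]

/-- Peetre's inequality extracts (1+|y|)^a at the cost of (1+|y-x|)^|a|, which K > |a| + m powers of
decay of φ absorb. Because |x| > 1, an upper bound on Re λ suffices and gives uniformity. -/
theorem exists_outer_reflTranslate_le (w : C(Sph m, ℂ)) (φ : 𝓢(E m, ℂ)) (a : ℝ) :
    ∃ C : ℝ, 0 ≤ C ∧ ∀ (lam : ℂ), lam.re ≤ a → ∀ y : E m,
      ‖∫ x in {x : E m | 1 < ‖x‖}, radial w lam x * reflTranslate y φ x‖ ≤ C * (1 + ‖y‖) ^ a := by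
  have hs : MeasurableSet {x : E m | 1 < ‖x‖} := measurableSet_lt measurable_const measurable_norm
  obtain ⟨K, hK⟩ := exists_nat_gt (|a| + m)
  obtain ⟨C, hC, h⟩ := norm_schwartz_le φ K
  have hint : Integrable fun x : E m => (1 + ‖x‖) ^ (-((K : ℝ) - |a|)) :=
    integrable_one_add_norm (by rw [finrank_E]; linarith)
  have hnn : ∀ x : E m, 0 ≤ (1 + ‖x‖) ^ (-((K : ℝ) - |a|)) := fun x => by positivity
  have hJ : 0 ≤ ∫ x : E m, (1 + ‖x‖) ^ (-((K : ℝ) - |a|)) := integral_nonneg hnn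
  refine ⟨‖w‖ * 2 ^ |a| * C * ∫ x : E m, (1 + ‖x‖) ^ (-((K : ℝ) - |a|)), by positivity,
    fun lam hlam y => ?_⟩
  have hint' : Integrable fun x : E m => (1 + ‖y - x‖) ^ (-((K : ℝ) - |a|)) :=
    hint.comp_sub_left y
  calc _ ≤ ∫ x in {x : E m | 1 < ‖x‖},
        (‖w‖ * 2 ^ |a| * C * (1 + ‖y‖) ^ a) * (1 + ‖y - x‖) ^ (-((K : ℝ) - |a|)) := by
        refine norm_integral_le_of_norm_le (hint'.const_mul _).integrableOn ?_
        refine (ae_restrict_iff' hs).2 (Filter.Eventually.of_forall fun x hx => ?_)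
        have hx1 : 1 < ‖x‖ := hx
        rw [norm_mul, reflTranslate_apply]
        have e1 : ‖radial w lam x‖ ≤ ‖w‖ * (2 ^ |a| * ((1 + ‖y‖) ^ a * (1 + ‖y - x‖) ^ |a|)) := by
          refine (norm_radial_le w lam x).trans (mul_le_mul_of_nonneg_left ?_ (norm_nonneg _))
          refine (Real.rpow_le_rpow_of_exponent_le hx1.le hlam).trans ?_
          refine (rpow_norm_le_of_one_lt hx1).trans ?_
          exact mul_le_mul_of_nonneg_left (peetre a x y) (by positivity)
        have e2 : (1 + ‖y - x‖) ^ (-((K : ℝ) - |a|))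
            = (1 + ‖y - x‖) ^ |a| * (1 + ‖y - x‖) ^ (-(K : ℝ)) := by
          rw [← Real.rpow_add (by positivity)]; ring_nf
        calc _ ≤ (‖w‖ * (2 ^ |a| * ((1 + ‖y‖) ^ a * (1 + ‖y - x‖) ^ |a|)))
              * (C * (1 + ‖y - x‖) ^ (-(K : ℝ))) :=
              mul_le_mul e1 (h _) (norm_nonneg _) (by positivity)
          _ = _ := by rw [e2]; ring
    _ ≤ ∫ x : E m, (‖w‖ * 2 ^ |a| * C * (1 + ‖y‖) ^ a) * (1 + ‖y - x‖) ^ (-((K : ℝ) - |a|)) := by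
        refine setIntegral_le_integral (hint'.const_mul _)
          (Filter.Eventually.of_forall fun x => ?_)
        positivity
    _ = _ := by
        rw [integral_const_mul,
          integral_sub_left_eq_self (fun x : E m => (1 + ‖x‖) ^ (-((K : ℝ) - |a|)))]
        ring

/-- The Taylor terms of the finite part are rapidly decreasing under translation. -/
theorem exists_taylorSum_le (p N : ℕ) (w : C(Sph m, ℂ)) (φ : 𝓢(E m, ℂ)) (a : ℝ) (μ₀ : ℂ) :
    ∃ C : ℝ, 0 ≤ C ∧ ∀ᶠ μ in nhds μ₀, ∀ y : E m,
      ‖∑ k ∈ Finset.range N, sphMeanDeriv w (reflTranslate y φ) k 0 / (k.factorial : ℂ) *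
        dslope (gammaRecip p) (-k - 1) μ‖ ≤ C * (1 + ‖y‖) ^ a := by
  choose C hC h using fun k => exists_sphMeanDeriv_reflTranslate_le w φ k a
  have hev : ∀ᶠ μ in nhds μ₀, ∀ k ∈ Finset.range N, ‖dslope (gammaRecip p) (-(k : ℂ) - 1) μ‖
      ≤ ‖dslope (gammaRecip p) (-(k : ℂ) - 1) μ₀‖ + 1 := by
    rw [Filter.eventually_all_finset]
    intro k _
    have hc := (differentiable_dslope_gammaRecip p (-(k : ℂ) - 1)).continuous.norm
    exact (hc.tendsto μ₀).eventually_le_const (by linarith)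
  refine ⟨∑ k ∈ Finset.range N, C k * (‖dslope (gammaRecip p) (-(k : ℂ) - 1) μ₀‖ + 1),
    Finset.sum_nonneg fun k _ => mul_nonneg (hC k) (by positivity), ?_⟩
  filter_upwards [hev] with μ hμ y
  refine (norm_sum_le _ _).trans ?_
  rw [Finset.sum_mul]
  refine Finset.sum_le_sum fun k hk => ?_
  have h1 := h k y 0 ⟨le_rfl, zero_le_one⟩
  have h2 : ‖sphMeanDeriv w (reflTranslate y φ) k 0 / (k.factorial : ℂ)‖ ≤ C k * (1 + ‖y‖) ^ a := by
    rw [norm_div, Complex.norm_natCast]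
    refine (div_le_self (norm_nonneg _) ?_).trans h1
    exact_mod_cast k.factorial_pos
  rw [norm_mul]
  calc _ ≤ (C k * (1 + ‖y‖) ^ a) * (‖dslope (gammaRecip p) (-(k : ℂ) - 1) μ₀‖ + 1) :=
        mul_le_mul h2 (hμ k hk) (norm_nonneg _) (mul_nonneg (hC k) (by positivity))
    _ = _ := by ring

/-- Near μ₀ the real part stays above Re μ₀ - 1, which serves as the uniform exponent; this is why
the condition on N is shifted by 1. -/
theorem exists_inner_le (N : ℕ) (w : C(Sph m, ℂ)) (φ : 𝓢(E m, ℂ)) (a : ℝ) {μ₀ : ℂ}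
    (hN : -1 < μ₀.re - 1 + N) :
    ∃ C : ℝ, 0 ≤ C ∧ ∀ᶠ μ in nhds μ₀, ∀ y : E m,
      ‖∫ r in Ioc (0 : ℝ) 1, innerFunN N w (reflTranslate y φ) μ r‖ ≤ C * (1 + ‖y‖) ^ a := by
  obtain ⟨C, hC, h⟩ := exists_sphMeanDeriv_reflTranslate_le w φ N a
  have hJ : 0 ≤ ∫ r in Ioc (0 : ℝ) 1, r ^ (μ₀.re - 1 + N) :=
    setIntegral_nonneg measurableSet_Ioc fun r hr => Real.rpow_nonneg hr.1.le _
  refine ⟨C * ∫ r in Ioc (0 : ℝ) 1, r ^ (μ₀.re - 1 + N), mul_nonneg hC hJ, ?_⟩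
  have hev : ∀ᶠ μ : ℂ in nhds μ₀, μ₀.re - 1 ≤ μ.re :=
    (Complex.continuous_re.tendsto μ₀).eventually_const_le (by linarith)
  filter_upwards [hev] with μ hμ y
  have h1 : ‖∫ r in Ioc (0 : ℝ) 1, innerFunN N w (reflTranslate y φ) μ r‖
      ≤ ∫ r in Ioc (0 : ℝ) 1, (C * (1 + ‖y‖) ^ a) * r ^ (μ₀.re - 1 + N) := by
    refine norm_integral_le_of_norm_le ((integrableOn_rpow_Ioc hN).const_mul _) ?_
    exact (ae_restrict_iff' measurableSet_Ioc).2 (Filter.Eventually.of_forall fun r hr =>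
      norm_innerFunN_le N w _ (h y) hμ hr)
  refine h1.trans (le_of_eq ?_)
  rw [integral_const_mul]
  ring

/-- The regularizations of `Fp |x| ^ λ w(x / |x|)` grow at most like `|y| ^ (Re λ)`, locally
uniformly in `λ`. -/
theorem exists_fam_le (hm : 1 ≤ m) {p : ℕ} (hp : p ≤ 1) {w : C(Sph m, ℂ)} (hw : HasParity p w)
    (φ : 𝓢(E m, ℂ)) {lam₀ : ℂ} {a : ℝ} (ha : lam₀.re < a) :
    ∃ C : ℝ, 0 ≤ C ∧ ∀ᶠ lam in nhds lam₀, ∀ y : E m,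
      ‖fam p w lam (reflTranslate y φ)‖ ≤ C * (1 + ‖y‖) ^ a := by
  -- One Taylor term more than convergence at λ₀ requires, to leave room for the neighbourhood.
  obtain ⟨N, hN⟩ := exists_nat_gt (-(lam₀ + m - 1).re)
  obtain ⟨C₁, hC₁, h₁⟩ := exists_taylorSum_le p N w φ a (lam₀ + m - 1)
  obtain ⟨C₂, hC₂, h₂⟩ := exists_inner_le N w φ a (μ₀ := lam₀ + m - 1) (by linarith)
  obtain ⟨C₃, hC₃, h₃⟩ := exists_outer_reflTranslate_le w φ a
  have hc : Continuous fun lam : ℂ => lam + m - 1 := by fun_prop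
  have hpi := ((differentiable_piFactor (m := m) p).continuous.norm.tendsto lam₀).eventually_le_const
    (lt_add_one _)
  have hg := (((differentiable_gammaRecip p).continuous.comp hc).norm.tendsto
    lam₀).eventually_le_const (lt_add_one _)
  have hre : ∀ᶠ lam : ℂ in nhds lam₀, lam.re ≤ a :=
    (Complex.continuous_re.tendsto lam₀).eventually_le_const ha
  have hNev : ∀ᶠ lam : ℂ in nhds lam₀, -1 < (lam + m - 1).re + N :=
    ((Complex.continuous_re.comp hc).tendsto lam₀).eventually_const_lt
      (show -1 - (N : ℝ) < (lam₀ + m - 1).re by linarith) |>.mono fun z hz => by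
        simp only [Function.comp] at hz
        linarith
  set A := ‖(area m : ℂ)‖
  set Bp := ‖piFactor m p lam₀‖ + 1
  set Bg := ‖(gammaRecip p ∘ fun lam : ℂ => lam + m - 1) lam₀‖ + 1
  refine ⟨Bp * (Bg * (A * C₂ + C₃) + A * C₁), by positivity, ?_⟩
  filter_upwards [hpi, hg, hre, hNev, (hc.tendsto lam₀).eventually h₁,
    (hc.tendsto lam₀).eventually h₂] with lam hpi hg hre hN h₁ h₂ y
  have hy : 0 ≤ (1 + ‖y‖) ^ a := by positivity
  have e : fam p w lam (reflTranslate y φ) = piFactor m p lam * (gammaRecip p (lam + m - 1) *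
      ((area m : ℂ) * (∫ r in Ioc (0 : ℝ) 1, innerFunN N w (reflTranslate y φ) (lam + m - 1) r)
        + ∫ x in {x : E m | 1 < ‖x‖}, radial w lam x * reflTranslate y φ x)
      + (area m : ℂ) * ∑ k ∈ Finset.range N, sphMeanDeriv w (reflTranslate y φ) k 0 /
        (k.factorial : ℂ) * dslope (gammaRecip p) (-k - 1) (lam + m - 1)) := by
    rw [fam_eq_starPart hp hw _ hN, starPart, ← area_mul_outer_eq hm]
    ring
  rw [e, norm_mul]
  have i1 : ‖(area m : ℂ) * (∫ r in Ioc (0 : ℝ) 1, innerFunN N w (reflTranslate y φ)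
      (lam + m - 1) r)‖ ≤ A * (C₂ * (1 + ‖y‖) ^ a) := by
    rw [norm_mul]
    exact mul_le_mul_of_nonneg_left (h₂ y) (norm_nonneg _)
  have i2 := (norm_add_le _ _).trans (add_le_add i1 (h₃ lam hre y))
  have i3 : ‖gammaRecip p (lam + m - 1) *
      ((area m : ℂ) * (∫ r in Ioc (0 : ℝ) 1, innerFunN N w (reflTranslate y φ) (lam + m - 1) r)
        + ∫ x in {x : E m | 1 < ‖x‖}, radial w lam x * reflTranslate y φ x)‖
      ≤ Bg * (A * (C₂ * (1 + ‖y‖) ^ a) + C₃ * (1 + ‖y‖) ^ a) := by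
    rw [norm_mul]
    exact mul_le_mul hg i2 (norm_nonneg _) (by positivity)
  have i4 : ‖(area m : ℂ) * ∑ k ∈ Finset.range N, sphMeanDeriv w (reflTranslate y φ) k 0 /
        (k.factorial : ℂ) * dslope (gammaRecip p) (-k - 1) (lam + m - 1)‖
      ≤ A * (C₁ * (1 + ‖y‖) ^ a) := by
    rw [norm_mul]
    exact mul_le_mul_of_nonneg_left (h₁ y) (norm_nonneg _)
  have i5 := (norm_add_le _ _).trans (add_le_add i3 i4)
  calc _ ≤ Bp * (Bg * (A * (C₂ * (1 + ‖y‖) ^ a) + C₃ * (1 + ‖y‖) ^ a)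
        + A * (C₁ * (1 + ‖y‖) ^ a)) := mul_le_mul hpi i5 (norm_nonneg _) (by positivity)
    _ = _ := by ring

/-- At the poles of the finite part the normalized distribution is supported at the origin, and its
regularizations are rapidly decreasing. -/
theorem exists_fam_le_of_pole {p : ℕ} (hp : p ≤ 1) {w : C(Sph m, ℂ)} (hw : HasParity p w)
    (φ : 𝓢(E m, ℂ)) {lam : ℂ} {l : ℕ} (hlam : lam = -m - 2 * l - p) (a : ℝ) :
    ∃ C : ℝ, 0 ≤ C ∧ ∀ y : E m, ‖fam p w lam (reflTranslate y φ)‖ ≤ C * (1 + ‖y‖) ^ a := by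
  obtain ⟨N, hN⟩ := exists_nat_gt (-(lam + m - 1).re)
  obtain ⟨C, hC, h⟩ := exists_taylorSum_le p N w φ a (lam + m - 1)
  have hμ : lam + m - 1 = -((p + 2 * l : ℕ) : ℂ) - 1 := by rw [hlam]; push_cast; ring
  refine ⟨‖piFactor m p lam‖ * (‖(area m : ℂ)‖ * C), by positivity, fun y => ?_⟩
  rw [fam_eq_starPart hp hw _ (N := N) (by linarith), starPart]
  -- The vanishing factor 1/Γ removes both integrals; the Taylor terms alone survive.
  have hz : gammaRecip p (lam + m - 1) = 0 := by rw [hμ, gammaRecip_eq_zero]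
  rw [hz, zero_mul, zero_add, norm_mul, norm_mul, mul_assoc, mul_assoc]
  exact mul_le_mul_of_nonneg_left (mul_le_mul_of_nonneg_left (h.self_of_nhds y) (norm_nonneg _))
    (norm_nonneg _)

/-! ### Regularizations as inverse Fourier transforms, and their convolution -/

open FourierTransform RealInnerProductSpace in
theorem fourierInv_reflTranslate (φ : 𝓢(E m, ℂ)) (y ξ : E m) :
    (𝓕⁻ (reflTranslate y φ)) ξ = (Real.fourierChar (inner ℝ y ξ) : ℂ) * (𝓕 φ) ξ := by
  rw [SchwartzMap.fourierInv_coe, SchwartzMap.fourier_coe, Real.fourierInv_eq, Real.fourier_eq,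
    ← integral_const_mul, ← integral_sub_left_eq_self _ _ y]
  congr 1
  ext x
  simp only [reflTranslate_apply, sub_sub_cancel, inner_sub_left, Circle.smul_def, smul_eq_mul]
  rw [sub_eq_add_neg, AddChar.map_add_eq_mul, Circle.coe_mul, mul_assoc]

open FourierTransform in
/-- The regularizations of `Fp |x| ^ λ w(x / |x|)`, in terms of Fourier transforms. -/
theorem HarmonicData.fam_reflTranslate (hm : 1 ≤ m) {p : ℕ} {w : C(Sph m, ℂ)} {P : E m → ℂ}
    (h : HarmonicData p w P) (φ : 𝓢(E m, ℂ)) {lam : ℂ} (hlam : lam.re < 0) (y : E m) :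
    fam p w lam (reflTranslate y φ) = (-Complex.I) ^ p *
      (piFactor m p (-lam - m) * (Complex.Gamma ((-lam + p) / 2))⁻¹) *
      ∫ ξ, radial w (-lam - m) ξ * ((Real.fourierChar (inner ℝ y ξ) : ℂ) * (𝓕 φ) ξ) := by
  have h1 := h.fam_fourier hm (𝓕⁻ (reflTranslate y φ)) lam
  rw [FourierTransform.fourier_fourierInv_eq] at h1
  rw [h1, fam_eq_integral hm h.le_one h.parity _ (by simpa using hlam)]
  simp only [fourierInv_reflTranslate]
  have e : (-lam - m + m + p) / 2 = (-lam + p) / 2 := by ring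
  rw [e]
  ring

/-- Each of the half planes Re λ < 0 (Fourier side) and Re λ ≥ 0 (direct integral) provides an
integral, depending on y, of a jointly measurable function. -/
theorem HarmonicData.stronglyMeasurable_fam (hm : 1 ≤ m) {p : ℕ} {w : C(Sph m, ℂ)}
    {P : E m → ℂ} (h : HarmonicData p w P) (φ : 𝓢(E m, ℂ)) (lam : ℂ) :
    StronglyMeasurable fun y : E m => fam p w lam (reflTranslate y φ) := by
  rcases lt_or_ge lam.re 0 with h0 | h0
  · simp only [h.fam_reflTranslate hm φ h0]
    refine StronglyMeasurable.const_mul ?_ _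
    have hmeas : Measurable fun q : E m × E m => radial w (-lam - m) q.2 *
        ((Real.fourierChar (inner ℝ q.1 q.2) : ℂ) * (FourierTransform.fourier φ) q.2) := by
      refine ((measurable_radial w _).comp measurable_snd).mul (Continuous.measurable ?_)
      refine Continuous.mul ?_ ((SchwartzMap.continuous _).comp continuous_snd)
      exact (show Continuous ((↑) : Circle → ℂ) by fun_prop).comp (Real.continuous_fourierChar.comp continuous_inner)
    exact hmeas.stronglyMeasurable.integral_prod_right'
  · have hm1 : (1 : ℝ) ≤ m := by exact_mod_cast hm
    have h1 : -(m : ℝ) < lam.re := by linarith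
    simp only [fam_eq_integral hm h.le_one h.parity _ h1, reflTranslate_apply]
    refine StronglyMeasurable.const_mul ?_ _
    have hmeas : Measurable fun q : E m × E m => radial w lam q.2 * φ (q.1 - q.2) := by
      refine ((measurable_radial w _).comp measurable_snd).mul (Continuous.measurable ?_)
      exact φ.continuous.comp (by fun_prop)
    exact hmeas.stronglyMeasurable.integral_prod_right'

/-- Convolutions of holomorphic families with sufficient joint decay are holomorphic. -/
theorem convolution_of_decay {u v : ℂ → E m → ℂ} {z₀ : ℂ}
    (hu : ∀ z, StronglyMeasurable (u z)) (hv : ∀ z, StronglyMeasurable (v z))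
    (du : ∀ y, Differentiable ℂ fun z => u z y) (dv : ∀ y, Differentiable ℂ fun z => v z y)
    {a b C C' : ℝ} (hab : a + b < -(m : ℝ))
    (bu : ∀ᶠ z in nhds z₀, ∀ y, ‖u z y‖ ≤ C * (1 + ‖y‖) ^ a)
    (bv : ∀ᶠ z in nhds z₀, ∀ y, ‖v z y‖ ≤ C' * (1 + ‖y‖) ^ b) (x : E m) :
    Integrable (fun y => u z₀ y * v z₀ (x - y)) ∧
      DifferentiableAt ℂ (fun z => ∫ y, u z y * v z (x - y)) z₀ := by
  have hC : 0 ≤ C := by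
    have := (norm_nonneg _).trans (bu.self_of_nhds 0)
    simpa using this
  have hC' : 0 ≤ C' := by
    have := (norm_nonneg _).trans (bv.self_of_nhds 0)
    simpa using this
  have hmeas : ∀ z, AEStronglyMeasurable (fun y => u z y * v z (x - y)) volume := fun z =>
    (hu z).aestronglyMeasurable.mul
      ((hv z).comp_measurable (measurable_const.sub measurable_id)).aestronglyMeasurable
  have hint : Integrable fun y : E m => (C * C' * (1 + ‖x‖) ^ |b|) * (1 + ‖y‖) ^ (-(-(a + b))) :=
    (integrable_one_add_norm (by rw [finrank_E]; linarith)).const_mul _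
  have hbd : ∀ᶠ z in nhds z₀, ∀ y, ‖u z y * v z (x - y)‖
      ≤ (C * C' * (1 + ‖x‖) ^ |b|) * (1 + ‖y‖) ^ (-(-(a + b))) := by
    filter_upwards [bu, bv] with z h1 h2 y
    -- The points x - y and -y differ by x, so (1+|x-y|)^b ≤ (1+|y|)^b (1+|x|)^|b|.
    have h3 := peetre b (x - y) (-y)
    rw [norm_neg, show -y - (x - y) = -x by abel, norm_neg] at h3
    rw [norm_mul, neg_neg, Real.rpow_add (by positivity)]
    calc _ ≤ (C * (1 + ‖y‖) ^ a) * (C' * ((1 + ‖y‖) ^ b * (1 + ‖x‖) ^ |b|)) :=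
          mul_le_mul (h1 y) ((h2 _).trans (mul_le_mul_of_nonneg_left h3 hC')) (norm_nonneg _)
            (by positivity)
      _ = _ := by ring
  refine ⟨hint.mono' (hmeas z₀) (Filter.Eventually.of_forall hbd.self_of_nhds), ?_⟩
  refine differentiableAt_integral_of_dominated hbd (fun z _ => hmeas z)
    (Filter.Eventually.of_forall fun y => ?_) (Filter.Eventually.of_forall fun y z hz => hz y) hint
  exact ((du y).mul (dv (x - y))).differentiableOn

open FourierTransform in
/-- The convolution of two inverse Fourier transforms. -/
theorem integral_fourierInv_mul_fourierInv {f g : E m → ℂ} (hf : Integrable f) (hg : Integrable g)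
    (hg' : Integrable (𝓕⁻ g)) (hc : ∀ ξ : E m, ξ ≠ 0 → ContinuousAt g ξ) (hm : 1 ≤ m) (x : E m) :
    ∫ y, 𝓕⁻ f y * 𝓕⁻ g (x - y)
      = ∫ ξ, f ξ * g ξ * (Real.fourierChar (inner ℝ x ξ) : ℂ) := by
  have : Nontrivial (E m) := by
    have : Nonempty (Fin m) := ⟨⟨0, hm⟩⟩
    infer_instance
  have hne : ∀ᵐ x : E m, x ≠ 0 := by simp [ae_iff]
  have hg2 : Integrable (fun y => 𝓕⁻ g (x + y)) := hg'.comp_add_left x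
  -- After y ↦ -y the first factor becomes a Fourier transform, which self-adjointness moves onto
  -- the translated second factor.
  have h1 : ∫ y, 𝓕⁻ f y * 𝓕⁻ g (x - y) = ∫ y, 𝓕 f y * 𝓕⁻ g (x + y) := by
    rw [← integral_neg_eq_self]
    congr 1
    ext y
    rw [Real.fourierInv_eq_fourier_neg f, neg_neg, sub_neg_eq_add]
  rw [h1, integral_fourier_mul hf hg2]
  refine integral_congr_ae ?_
  filter_upwards [hne] with ξ hξ
  have h2 : 𝓕 (fun y => 𝓕⁻ g (x + y)) ξ = (Real.fourierChar (inner ℝ x ξ) : ℂ) * 𝓕 (𝓕⁻ g) ξ := by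
    rw [Real.fourier_eq, Real.fourier_eq, ← integral_const_mul, ← integral_sub_right_eq_self _ x]
    congr 1
    ext y
    simp only [add_sub_cancel, inner_sub_left, Circle.smul_def, smul_eq_mul]
    rw [neg_sub, sub_eq_add_neg, AddChar.map_add_eq_mul, Circle.coe_mul, mul_assoc]
  have h3 : Integrable (𝓕 g) := by
    have := hg'.comp_neg
    simpa only [Real.fourierInv_eq_fourier_neg, neg_neg] using this
  -- Inversion is applied pointwise off the origin only, since the symbols of interest may be
  -- discontinuous there.
  rw [h2, hg.fourier_fourierInv_eq h3 (hc ξ hξ)]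
  ring

theorem radial_mul (w w' : C(Sph m, ℂ)) (a b : ℂ) (x : E m) :
    radial w a x * radial w' b x = radial (w * w') (a + b) x := by
  by_cases hx : x = 0
  · simp [radial, homog, hx]
  · have hx0 : (‖x‖ : ℂ) ≠ 0 := by exact_mod_cast norm_ne_zero_iff.2 hx
    simp only [radial, homog, hx, dite_false, ContinuousMap.mul_apply]
    rw [Complex.cpow_add _ _ hx0]
    ring

theorem continuousAt_radial (w : C(Sph m, ℂ)) (lam : ℂ) {x : E m} (hx : x ≠ 0) :
    ContinuousAt (radial w lam) x := by
  refine ContinuousAt.mul ?_ ((continuousOn_homog w).continuousAt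
    (isOpen_compl_singleton.mem_nhds hx))
  exact (Complex.continuous_ofReal.continuousAt.comp continuous_norm.continuousAt).cpow
    continuousAt_const (Complex.ofReal_mem_slitPlane.2 (norm_pos_iff.2 hx))

/-! ### The convolution identity on the Fourier side -/

/-- The normalizing constant of the symbol of `(-Δ) ^ α H` (`p = 1`) and `(-Δ) ^ α δ` (`p = 0`). -/
def symbolConst (m p : ℕ) (α : ℂ) : ℂ :=
  piFactor m p (2 * α) * (Complex.Gamma ((m + 2 * α + p) / 2))⁻¹

open FourierTransform in
-- With λ = -m - 2α the symbol has degree 2α, and Re α > -m/2 is exactly its local integrability.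
theorem HarmonicData.fam_eq_fourierInv (hm : 1 ≤ m) {p : ℕ} {w : C(Sph m, ℂ)} {P : E m → ℂ}
    (h : HarmonicData p w P) (φ : 𝓢(E m, ℂ)) {α : ℂ} (hα : -(m : ℝ) / 2 < α.re) (y : E m) :
    fam p w (-m - 2 * α) (reflTranslate y φ) = (-Complex.I) ^ p * symbolConst m p α *
      𝓕⁻ (fun ξ => radial w (2 * α) ξ * (𝓕 φ) ξ) y := by
  have h0 : (-(m : ℂ) - 2 * α).re < 0 := by
    simp only [Complex.sub_re, Complex.neg_re, Complex.natCast_re, Complex.mul_re, Complex.re_ofNat,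
      Complex.im_ofNat, zero_mul, sub_zero]
    linarith
  have e1 : -(-(m : ℂ) - 2 * α) - m = 2 * α := by ring
  have e2 : (-(-(m : ℂ) - 2 * α) + p) / 2 = (m + 2 * α + p) / 2 := by ring
  rw [h.fam_reflTranslate hm φ h0, e1, e2, Real.fourierInv_eq, symbolConst]
  congr 1
  refine integral_congr_ae (Filter.Eventually.of_forall fun ξ => ?_)
  simp only [Circle.smul_def, smul_eq_mul, real_inner_comm y ξ]
  ring

theorem two_mul_re {α : ℂ} : (2 * α).re = 2 * α.re := by simp

theorem neg_sub_two_mul_re {α : ℂ} : (-(m : ℂ) - 2 * α).re = -m - 2 * α.re := by simp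

theorem symbolConst_ne_zero {p : ℕ} {α : ℂ} (hα : -(m : ℝ) / 2 < α.re) : symbolConst m p α ≠ 0 := by
  have hpi : (Real.pi : ℂ) ≠ 0 := by exact_mod_cast Real.pi_ne_zero
  refine mul_ne_zero (by simp [piFactor, Complex.cpow_eq_zero_iff, hpi]) (inv_ne_zero ?_)
  refine Complex.Gamma_ne_zero_of_re_pos ?_
  have : (0 : ℝ) ≤ p := Nat.cast_nonneg p
  simp
  linarith

open FourierTransform in
theorem integrable_symbol (hm : 1 ≤ m) (w : C(Sph m, ℂ)) (φ : 𝓢(E m, ℂ)) {α : ℂ}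
    (hα : -(m : ℝ) / 2 < α.re) : Integrable (fun ξ => radial w (2 * α) ξ * (𝓕 φ) ξ) :=
  integrable_radial_mul hm w (by rw [two_mul_re]; linarith) _

open FourierTransform in
-- The convolution theorem requires one factor to be integrable, which Re β > 0 guarantees. The two
-- factors (-i)^p combine to (-1)^p.
theorem HarmonicData.integral_fam_mul_fam (hm : 1 ≤ m) {p : ℕ} {w w' : C(Sph m, ℂ)}
    {P P' : E m → ℂ} (h : HarmonicData p w P) (h' : HarmonicData p w' P') (φ ψ : 𝓢(E m, ℂ))
    {α β : ℂ} (hα : -(m : ℝ) / 2 < α.re) (hβ : 0 < β.re) (x : E m) :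
    ∫ y, fam p w (-m - 2 * α) (reflTranslate y φ) * fam p w' (-m - 2 * β) (reflTranslate (x - y) ψ)
      = (-1) ^ p * (symbolConst m p α * symbolConst m p β) *
        ∫ ξ, radial (w * w') (2 * (α + β)) ξ *
          ((𝓕 φ) ξ * (𝓕 ψ) ξ * (Real.fourierChar (inner ℝ x ξ) : ℂ)) := by
  have hm1 : (1 : ℝ) ≤ m := by exact_mod_cast hm
  have hβ' : -(m : ℝ) / 2 < β.re := by linarith
  have hg' : Integrable (𝓕⁻ (fun ξ => radial w' (2 * β) ξ * (𝓕 ψ) ξ)) := by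
    -- The exponent -m - Re β lies strictly between Re λ = -m - 2 Re β and -m.
    obtain ⟨C, hC, hb⟩ := exists_fam_le hm h'.le_one h'.parity ψ (lam₀ := -m - 2 * β)
      (a := -m - β.re) (by rw [neg_sub_two_mul_re]; linarith)
    have hi : Integrable fun y : E m => fam p w' (-m - 2 * β) (reflTranslate y ψ) := by
      refine ((integrable_one_add_norm (r := m + β.re)
        (by rw [finrank_E]; linarith)).const_mul C).mono'
        (h'.stronglyMeasurable_fam hm ψ _).aestronglyMeasurable
        (Filter.Eventually.of_forall fun y => (hb.self_of_nhds y).trans (le_of_eq ?_))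
      ring_nf
    have hk : (-Complex.I) ^ p * symbolConst m p β ≠ 0 :=
      mul_ne_zero (pow_ne_zero _ (neg_ne_zero.2 Complex.I_ne_zero)) (symbolConst_ne_zero hβ')
    refine (hi.const_mul ((-Complex.I) ^ p * symbolConst m p β)⁻¹).congr
      (Filter.Eventually.of_forall fun y => ?_)
    simp only
    rw [h'.fam_eq_fourierInv hm ψ hβ', inv_mul_cancel_left₀ hk]
  have hI : ((-Complex.I) ^ p) * ((-Complex.I) ^ p) = (-1) ^ p := by
    rw [← mul_pow]; simp
  simp only [h.fam_eq_fourierInv hm φ hα, h'.fam_eq_fourierInv hm ψ hβ']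
  have e : ∀ y, (-Complex.I) ^ p * symbolConst m p α *
      𝓕⁻ (fun ξ => radial w (2 * α) ξ * (𝓕 φ) ξ) y * ((-Complex.I) ^ p * symbolConst m p β *
      𝓕⁻ (fun ξ => radial w' (2 * β) ξ * (𝓕 ψ) ξ) (x - y))
      = ((-1) ^ p * (symbolConst m p α * symbolConst m p β)) *
        (𝓕⁻ (fun ξ => radial w (2 * α) ξ * (𝓕 φ) ξ) y *
          𝓕⁻ (fun ξ => radial w' (2 * β) ξ * (𝓕 ψ) ξ) (x - y)) := fun y => by
    rw [← hI]; ring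
  simp only [e]
  rw [integral_const_mul, integral_fourierInv_mul_fourierInv (integrable_symbol hm w φ hα)
    (integrable_symbol hm w' ψ hβ') hg' (fun ξ hξ => (continuousAt_radial w' _ hξ).mul
      (SchwartzMap.continuous _).continuousAt) hm]
  congr 1
  refine integral_congr_ae (Filter.Eventually.of_forall fun ξ => ?_)
  simp only
  rw [mul_add, ← radial_mul]
  ring

open FourierTransform in
theorem integral_fam_mul_schwartz (hm : 1 ≤ m) (φ ψ : 𝓢(E m, ℂ)) {γ : ℂ}
    (hγ : -(m : ℝ) / 2 < γ.re) (x : E m) :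
    ∫ y, fam 0 1 (-m - 2 * γ) (reflTranslate y φ) * ψ (x - y)
      = symbolConst m 0 γ * ∫ ξ, radial 1 (2 * γ) ξ *
          ((𝓕 φ) ξ * (𝓕 ψ) ξ * (Real.fourierChar (inner ℝ x ξ) : ℂ)) := by
  have hψ : 𝓕⁻ (⇑(𝓕 ψ : 𝓢(E m, ℂ))) = ψ := by
    rw [← SchwartzMap.fourierInv_coe, FourierTransform.fourierInv_fourier_eq]
  have h1 := integral_fourierInv_mul_fourierInv (integrable_symbol hm 1 φ hγ)
    (𝓕 ψ : 𝓢(E m, ℂ)).integrable (by rw [hψ]; exact ψ.integrable)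
    (fun ξ _ => (SchwartzMap.continuous _).continuousAt) hm x
  rw [hψ] at h1
  simp only [harmonicData_one.fam_eq_fourierInv hm φ hγ, pow_zero, one_mul, mul_assoc]
  rw [integral_const_mul, h1]
  congr 1
  refine integral_congr_ae (Filter.Eventually.of_forall fun ξ => ?_)
  simp only
  ring

/-! ### Analytic continuation of the convolution identity -/

/-- The convolution integral of two vector components. -/
def vecConv (j k : Fin m) (φ ψ : 𝓢(E m, ℂ)) (x : E m) (α β : ℂ) : ℂ :=
  ∫ y, fam 1 (coord j) (-m - 2 * α) (reflTranslate y φ) *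
    fam 1 (coord k) (-m - 2 * β) (reflTranslate (x - y) ψ)

/-- The convolution integral of the scalar kernel with a test function. -/
def scalConv (φ ψ : 𝓢(E m, ℂ)) (x : E m) (γ : ℂ) : ℂ :=
  ∫ y, fam 0 1 (-m - 2 * γ) (reflTranslate y φ) * ψ (x - y)

theorem recipGamma_differentiable {f : ℂ → ℂ} (hf : Differentiable ℂ f) :
    Differentiable ℂ fun z => (Complex.Gamma (f z))⁻¹ :=
  Complex.differentiable_one_div_Gamma.comp hf

/-- The rapid decay of ψ compensates polynomial growth of any order, so γ is unrestricted. -/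
theorem scalConv_aux (hm : 1 ≤ m) (φ ψ : 𝓢(E m, ℂ)) (x : E m) {γ : ℂ → ℂ}
    (hγ : Differentiable ℂ γ) (z : ℂ) :
    Integrable (fun y => fam 0 1 (-m - 2 * γ z) (reflTranslate y φ) * ψ (x - y)) ∧
      DifferentiableAt ℂ (fun z => scalConv φ ψ x (γ z)) z := by
  have hd : Differentiable ℂ fun z : ℂ => -(m : ℂ) - 2 * γ z := by fun_prop
  obtain ⟨C, -, hC⟩ := exists_fam_le hm zero_le_one (hasParity_one (m := m)) φ
    (lam₀ := -m - 2 * γ z) (lt_add_one _)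
  obtain ⟨K, hK⟩ := exists_nat_gt ((-(m : ℂ) - 2 * γ z).re + 1 + m)
  obtain ⟨C', -, hC'⟩ := norm_schwartz_le ψ K
  exact convolution_of_decay (v := fun _ => ψ)
    (fun z => harmonicData_one.stronglyMeasurable_fam hm φ _)
    (fun _ => ψ.continuous.stronglyMeasurable)
    (fun y => (differentiable_fam zero_le_one hasParity_one _).comp hd)
    (fun y => differentiable_const _) (b := -(K : ℝ)) (by linarith)
    ((hd.continuous.tendsto z).eventually hC) (Filter.Eventually.of_forall fun _ => hC') x

/-- Sufficient joint decay of the kernels with parameters `α z`, `β z` near `z₀`. -/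
def JointDecay (φ ψ : 𝓢(E m, ℂ)) (α β : ℂ → ℂ) (z₀ : ℂ) : Prop :=
  ∃ a b : ℝ, a + b < -(m : ℝ) ∧
    (∀ j, ∃ C, ∀ᶠ z in nhds z₀, ∀ y,
      ‖fam 1 (coord j) (-m - 2 * α z) (reflTranslate y φ)‖ ≤ C * (1 + ‖y‖) ^ a) ∧
    (∀ j, ∃ C, ∀ᶠ z in nhds z₀, ∀ y,
      ‖fam 1 (coord j) (-m - 2 * β z) (reflTranslate y ψ)‖ ≤ C * (1 + ‖y‖) ^ b)

theorem vecConv_aux (hm : 1 ≤ m) (j k : Fin m) {φ ψ : 𝓢(E m, ℂ)} (x : E m) {α β : ℂ → ℂ}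
    (hα : Differentiable ℂ α) (hβ : Differentiable ℂ β) {z : ℂ} (h : JointDecay φ ψ α β z) :
    Integrable (fun y => fam 1 (coord j) (-m - 2 * α z) (reflTranslate y φ) *
      fam 1 (coord k) (-m - 2 * β z) (reflTranslate (x - y) ψ)) ∧
      DifferentiableAt ℂ (fun z => vecConv j k φ ψ x (α z) (β z)) z := by
  obtain ⟨a, b, hab, h1, h2⟩ := h
  obtain ⟨C, hC⟩ := h1 j
  obtain ⟨C', hC'⟩ := h2 k
  have hdα : Differentiable ℂ fun z : ℂ => -(m : ℂ) - 2 * α z := by fun_prop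
  have hdβ : Differentiable ℂ fun z : ℂ => -(m : ℂ) - 2 * β z := by fun_prop
  exact convolution_of_decay
    (v := fun z y => fam 1 (coord k) (-m - 2 * β z) (reflTranslate y ψ))
    (fun z => (harmonicData_coord hm j).stronglyMeasurable_fam hm φ _)
    (fun z => (harmonicData_coord hm k).stronglyMeasurable_fam hm ψ _)
    (fun y => (differentiable_fam le_rfl (hasParity_coord j) _).comp hdα)
    (fun y => (differentiable_fam le_rfl (hasParity_coord k) _).comp hdβ) hab hC hC' x

theorem jointDecay_of_re (hm : 1 ≤ m) (φ ψ : 𝓢(E m, ℂ)) {α β : ℂ → ℂ} (hα : Continuous α)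
    (hβ : Continuous β) {z : ℂ} (h : -(m : ℝ) / 2 < (α z + β z).re) : JointDecay φ ψ α β z := by
  have hre : (α z + β z).re = (α z).re + (β z).re := Complex.add_re _ _
  -- The exponents add up to -2m - 2 Re(α+β) + 2δ, and this δ spends only half of the available
  -- margin 2 Re(α+β) + m below -m.
  set δ : ℝ := ((α z + β z).re + m / 2) / 2 with hδ
  have hδ0 : 0 < δ := by rw [hδ]; linarith
  refine ⟨(-(m : ℂ) - 2 * α z).re + δ, (-(m : ℂ) - 2 * β z).re + δ, ?_, fun j => ?_, fun j => ?_⟩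
  · rw [neg_sub_two_mul_re, neg_sub_two_mul_re]
    linarith
  · obtain ⟨C, -, hC⟩ := exists_fam_le hm le_rfl (hasParity_coord j) φ
      (lam₀ := -m - 2 * α z) (lt_add_of_pos_right _ hδ0)
    have hc : Continuous fun z => -(m : ℂ) - 2 * α z := by fun_prop
    exact ⟨C, (hc.tendsto z).eventually hC⟩
  · obtain ⟨C, -, hC⟩ := exists_fam_le hm le_rfl (hasParity_coord j) ψ
      (lam₀ := -m - 2 * β z) (lt_add_of_pos_right _ hδ0)
    have hc : Continuous fun z => -(m : ℂ) - 2 * β z := by fun_prop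
    exact ⟨C, (hc.tendsto z).eventually hC⟩

/-- For α = l + 1/2 the exponent is the pole -m - 2l - 1. The first regularization decays to any
order, in particular fast enough for the growth belonging to β. -/
theorem jointDecay_of_left_pole (hm : 1 ≤ m) (φ ψ : 𝓢(E m, ℂ)) {α : ℂ} {β : ℂ → ℂ}
    (hβ : Continuous β) {l : ℕ} (hα : α = l + 1 / 2) (z : ℂ) : JointDecay φ ψ (fun _ => α) β z := by
  refine ⟨-m - ((-(m : ℂ) - 2 * β z).re + 1) - 1, (-(m : ℂ) - 2 * β z).re + 1, by linarith,
    fun j => ?_, fun j => ?_⟩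
  · obtain ⟨C, -, hC⟩ := exists_fam_le_of_pole le_rfl (hasParity_coord j) φ
      (lam := -m - 2 * α) (l := l) (by rw [hα]; push_cast; ring)
      (-m - ((-(m : ℂ) - 2 * β z).re + 1) - 1)
    exact ⟨C, Filter.Eventually.of_forall fun _ => hC⟩
  · obtain ⟨C, -, hC⟩ := exists_fam_le hm le_rfl (hasParity_coord j) ψ
      (lam₀ := -m - 2 * β z) (lt_add_one _)
    have hc : Continuous fun z => -(m : ℂ) - 2 * β z := by fun_prop
    exact ⟨C, (hc.tendsto z).eventually hC⟩

theorem jointDecay_of_right_pole (hm : 1 ≤ m) (φ ψ : 𝓢(E m, ℂ)) {α : ℂ → ℂ} {β : ℂ}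
    (hα : Continuous α) {l : ℕ} (hβ : β = l + 1 / 2) (z : ℂ) :
    JointDecay φ ψ α (fun _ => β) z := by
  obtain ⟨a, b, hab, h1, h2⟩ := jointDecay_of_left_pole hm ψ φ hα hβ z
  exact ⟨b, a, by linarith, h2, h1⟩

/-- The difference of the two sides of the convolution identity, divided by the Gamma functions
in it. Here `c` and `c₁` are the values of a linear functional at `e_j e_k` and `1`. -/
def convDefect (c : Fin m → Fin m → ℂ) (c₁ : ℂ) (φ ψ : 𝓢(E m, ℂ)) (x : E m) (α β : ℂ) : ℂ :=
  (Complex.Gamma (m / 2 + (α + β)))⁻¹ * ∑ j, ∑ k, c j k * vecConv j k φ ψ x α β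
    - (Real.pi : ℂ) ^ ((m : ℂ) / 2 + 1) * c₁ * ((Complex.Gamma ((m + 1) / 2 + α))⁻¹ *
      (Complex.Gamma ((m + 1) / 2 + β))⁻¹) * scalConv φ ψ x (α + β)

theorem differentiableAt_convDefect (hm : 1 ≤ m) (c : Fin m → Fin m → ℂ) (c₁ : ℂ)
    {φ ψ : 𝓢(E m, ℂ)} (x : E m) {α β : ℂ → ℂ} (hα : Differentiable ℂ α) (hβ : Differentiable ℂ β)
    {z : ℂ} (h : JointDecay φ ψ α β z) :
    DifferentiableAt ℂ (fun z => convDefect c c₁ φ ψ x (α z) (β z)) z := by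
  unfold convDefect
  refine DifferentiableAt.sub (DifferentiableAt.mul ?_ ?_) (DifferentiableAt.mul
    (DifferentiableAt.const_mul (DifferentiableAt.mul ?_ ?_) _) ?_)
  · exact recipGamma_differentiable (f := fun z => m / 2 + (α z + β z)) (by fun_prop) z
  · exact DifferentiableAt.fun_sum fun j _ => DifferentiableAt.fun_sum fun k _ =>
      (vecConv_aux hm j k x hα hβ h).2.const_mul _
  · exact recipGamma_differentiable (f := fun z => (m + 1) / 2 + α z) (by fun_prop) z
  · exact recipGamma_differentiable (f := fun z => (m + 1) / 2 + β z) (by fun_prop) z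
  · exact (scalConv_aux hm φ ψ x (hα.add hβ) z).2

open FourierTransform in
theorem integrable_radial_mul_mul (hm : 1 ≤ m) (w : C(Sph m, ℂ)) (φ ψ : 𝓢(E m, ℂ)) {γ : ℂ}
    (hγ : -(m : ℝ) / 2 < γ.re) (x : E m) :
    Integrable fun ξ => radial w (2 * γ) ξ *
      ((𝓕 φ) ξ * (𝓕 ψ) ξ * (Real.fourierChar (inner ℝ x ξ) : ℂ)) := by
  obtain ⟨C, hC, h⟩ := norm_schwartz_le (𝓕 ψ) 0
  have hb : Integrable fun ξ => (radial w (2 * γ) ξ * (𝓕 φ) ξ) *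
      ((𝓕 ψ) ξ * (Real.fourierChar (inner ℝ x ξ) : ℂ)) := by
    refine (integrable_symbol hm w φ hγ).mul_bdd (c := C) (Continuous.aestronglyMeasurable ?_)
      (Filter.Eventually.of_forall fun ξ => ?_)
    · refine (SchwartzMap.continuous _).mul ?_
      exact (show Continuous ((↑) : Circle → ℂ) by fun_prop).comp
        (Real.continuous_fourierChar.comp (continuous_const.inner continuous_id))
    · rw [norm_mul, Circle.norm_coe, mul_one]
      simpa using h ξ
  refine hb.congr (Filter.Eventually.of_forall fun ξ => ?_)
  simp only
  ring

/-- On the Fourier side the products ω_j ω_k contract with c to -c₁, leaving on both sides the same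
scalar integral X. Only the constants have to be compared; the spare power of π is the one put into
`convDefect`. -/
theorem convDefect_eq_zero_of_base (hm : 1 ≤ m) {c : Fin m → Fin m → ℂ} {c₁ : ℂ}
    (hc : ∀ ω : Sph m, ∑ j, ∑ k, c j k * (coord j ω * coord k ω) = -c₁) (φ ψ : 𝓢(E m, ℂ))
    (x : E m) {α β : ℂ} (hα : -(m : ℝ) / 2 < α.re) (hβ : 0 < β.re) :
    convDefect c c₁ φ ψ x α β = 0 := by
  have hγ : -(m : ℝ) / 2 < (α + β).re := by rw [Complex.add_re]; linarith
  set X : ℂ := ∫ ξ, radial 1 (2 * (α + β)) ξ * ((FourierTransform.fourier φ) ξ *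
    (FourierTransform.fourier ψ) ξ * (Real.fourierChar (inner ℝ x ξ) : ℂ)) with hX
  have h1 : ∀ j k, vecConv j k φ ψ x α β = -(symbolConst m 1 α * symbolConst m 1 β) *
      ∫ ξ, radial (coord j * coord k) (2 * (α + β)) ξ * ((FourierTransform.fourier φ) ξ *
    (FourierTransform.fourier ψ) ξ * (Real.fourierChar (inner ℝ x ξ) : ℂ)) := fun j k => by
    rw [vecConv, (harmonicData_coord hm j).integral_fam_mul_fam hm (harmonicData_coord hm k) φ ψ
      hα hβ]
    ring
  have h2 : ∑ j, ∑ k, c j k * ∫ ξ, radial (coord j * coord k) (2 * (α + β)) ξ *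
      ((FourierTransform.fourier φ) ξ * (FourierTransform.fourier ψ) ξ *
        (Real.fourierChar (inner ℝ x ξ) : ℂ)) = -c₁ * X := by
    simp only [← integral_const_mul, hX]
    rw [Finset.sum_congr rfl fun j _ => (integral_finsetSum Finset.univ fun k _ =>
      (integrable_radial_mul_mul hm (coord j * coord k) φ ψ hγ x).const_mul (c j k)).symm]
    rw [← integral_finsetSum Finset.univ (fun j _ => integrable_finsetSum _ fun k _ =>
      (integrable_radial_mul_mul hm (coord j * coord k) φ ψ hγ x).const_mul (c j k))]
    refine integral_congr_ae (Filter.Eventually.of_forall fun ξ => ?_)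
    by_cases hξ : ξ = 0
    · simp [radial, homog, hξ]
    · simp only [radial, homog, hξ, dite_false, ContinuousMap.mul_apply, ContinuousMap.one_apply]
      rw [← hc]
      simp only [Finset.sum_mul]
      refine Finset.sum_congr rfl fun j _ => Finset.sum_congr rfl fun k _ => ?_
      ring
  have h3 : ∑ j, ∑ k, c j k * vecConv j k φ ψ x α β
      = symbolConst m 1 α * symbolConst m 1 β * c₁ * X := by
    simp only [h1]
    have : ∀ j k, ∀ Y : ℂ, c j k * (-(symbolConst m 1 α * symbolConst m 1 β) * Y)
        = -(symbolConst m 1 α * symbolConst m 1 β) * (c j k * Y) := fun j k Y => by ring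
    simp only [this, ← Finset.mul_sum]
    rw [h2]
    ring
  have hpi : (Real.pi : ℂ) ≠ 0 := by exact_mod_cast Real.pi_ne_zero
  have hpow : (Real.pi : ℂ) ^ ((2 * α + m + (1 : ℕ)) / 2) * (Real.pi : ℂ) ^ ((2 * β + m + (1 : ℕ)) / 2)
      = (Real.pi : ℂ) ^ ((m : ℂ) / 2 + 1) * (Real.pi : ℂ) ^ ((2 * (α + β) + m + (0 : ℕ)) / 2) := by
    rw [← Complex.cpow_add _ _ hpi, ← Complex.cpow_add _ _ hpi]
    congr 1; push_cast; ring
  have g1 : ((m : ℂ) + 2 * α + (1 : ℕ)) / 2 = (m + 1) / 2 + α := by push_cast; ring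
  have g2 : ((m : ℂ) + 2 * β + (1 : ℕ)) / 2 = (m + 1) / 2 + β := by push_cast; ring
  have g3 : ((m : ℂ) + 2 * (α + β) + (0 : ℕ)) / 2 = m / 2 + (α + β) := by push_cast; ring
  rw [convDefect, h3, scalConv, integral_fam_mul_schwartz hm φ ψ hγ x, ← hX]
  simp only [symbolConst, piFactor]
  rw [g1, g2, g3]
  linear_combination ((Complex.Gamma (m / 2 + (α + β)))⁻¹ * (Complex.Gamma ((m + 1) / 2 + α))⁻¹ *
    (Complex.Gamma ((m + 1) / 2 + β))⁻¹ * c₁ * X) * hpow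

/-- The complex line z ↦ (zα, 1 + z(β-1)) joins (0, 1), interior to the region where the Fourier
computation is valid, to (α, β). The parameters z for which the sum of the two coordinates has real
part above -m/2 form a half plane or all of ℂ, on which the identity theorem applies. -/
theorem convDefect_eq_zero_of_re (hm : 1 ≤ m) {c : Fin m → Fin m → ℂ} {c₁ : ℂ}
    (hc : ∀ ω : Sph m, ∑ j, ∑ k, c j k * (coord j ω * coord k ω) = -c₁) (φ ψ : 𝓢(E m, ℂ))
    (x : E m) {α β : ℂ} (h : -(m : ℝ) / 2 < (α + β).re) : convDefect c c₁ φ ψ x α β = 0 := by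
  have hm1 : (1 : ℝ) ≤ m := by exact_mod_cast hm
  let Z : Set ℂ := {z | -(m : ℝ) / 2 - 1 < (z * (α + β - 1)).re}
  have hlin : IsLinearMap ℝ fun z : ℂ => (z * (α + β - 1)).re :=
    ⟨fun a b => by rw [add_mul, Complex.add_re], fun t a => by simp; ring⟩
  have hZc : Convex ℝ Z := convex_halfSpace_gt hlin _
  have hZo : IsOpen Z := isOpen_lt continuous_const (by fun_prop)
  have hα : Differentiable ℂ fun z : ℂ => z * α := by fun_prop
  have hβ : Differentiable ℂ fun z : ℂ => 1 + z * (β - 1) := by fun_prop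
  have hd : DifferentiableOn ℂ (fun z => convDefect c c₁ φ ψ x (z * α) (1 + z * (β - 1))) Z := by
    intro z hz
    refine (differentiableAt_convDefect hm c c₁ x hα hβ (jointDecay_of_re hm φ ψ hα.continuous
      hβ.continuous ?_)).differentiableWithinAt
    have hz' : -(m : ℝ) / 2 - 1 < (z * (α + β - 1)).re := hz
    have : z * α + (1 + z * (β - 1)) = 1 + z * (α + β - 1) := by ring
    rw [this, Complex.add_re, Complex.one_re]
    linarith
  have h0 : (0 : ℂ) ∈ Z := by
    change -(m : ℝ) / 2 - 1 < ((0 : ℂ) * (α + β - 1)).re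
    rw [zero_mul, Complex.zero_re]
    linarith
  have h1 : (1 : ℂ) ∈ Z := by
    change -(m : ℝ) / 2 - 1 < ((1 : ℂ) * (α + β - 1)).re
    rw [one_mul, Complex.sub_re, Complex.one_re]
    linarith
  have hev : (fun z => convDefect c c₁ φ ψ x (z * α) (1 + z * (β - 1))) =ᶠ[nhds 0] 0 := by
    have ha : ∀ᶠ z : ℂ in nhds 0, -(m : ℝ) / 2 < (z * α).re :=
      (Complex.continuous_re.comp hα.continuous).tendsto 0 |>.eventually_const_lt
        (by simp; linarith)
    have hb : ∀ᶠ z : ℂ in nhds 0, 0 < (1 + z * (β - 1)).re :=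
      (Complex.continuous_re.comp hβ.continuous).tendsto 0 |>.eventually_const_lt (by simp)
    filter_upwards [ha, hb] with z ha hb
    exact convDefect_eq_zero_of_base hm hc φ ψ x ha hb
  have := (hd.analyticOnNhd hZo).eqOn_zero_of_preconnected_of_eventuallyEq_zero
    hZc.isPreconnected h0 hev h1
  simpa using this

theorem eq_zero_of_differentiable_of_re {f : ℂ → ℂ} (hf : Differentiable ℂ f) {a : ℝ}
    (h : ∀ z : ℂ, a < z.re → f z = 0) (z : ℂ) : f z = 0 := by
  have hev : f =ᶠ[nhds ((a + 1 : ℝ) : ℂ)] fun _ => 0 := by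
    filter_upwards [Complex.continuous_re.continuousAt.eventually_const_lt
      (show a < (((a + 1 : ℝ) : ℂ)).re by simp)] with z hz using h z hz
  exact congrFun (AnalyticOnNhd.eq_of_eventuallyEq (hf.differentiableOn.analyticOnNhd isOpen_univ)
    (analyticOnNhd_const) hev) z

/-- With α fixed at a pole the defect is entire in β, and it vanishes as soon as Re β is large. -/
theorem convDefect_eq_zero_of_left_pole (hm : 1 ≤ m) {c : Fin m → Fin m → ℂ} {c₁ : ℂ}
    (hc : ∀ ω : Sph m, ∑ j, ∑ k, c j k * (coord j ω * coord k ω) = -c₁) (φ ψ : 𝓢(E m, ℂ))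
    (x : E m) {α β : ℂ} {l : ℕ} (hα : α = l + 1 / 2) : convDefect c c₁ φ ψ x α β = 0 := by
  refine eq_zero_of_differentiable_of_re (f := fun β => convDefect c c₁ φ ψ x α β)
    (a := -(m : ℝ) / 2 - α.re) (fun z => ?_) (fun z hz => ?_) β
  · exact differentiableAt_convDefect hm c c₁ x (differentiable_const α) differentiable_id
      (jointDecay_of_left_pole hm φ ψ continuous_id hα z)
  · exact convDefect_eq_zero_of_re hm hc φ ψ x (by rw [Complex.add_re]; linarith)

theorem convDefect_eq_zero_of_right_pole (hm : 1 ≤ m) {c : Fin m → Fin m → ℂ} {c₁ : ℂ}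
    (hc : ∀ ω : Sph m, ∑ j, ∑ k, c j k * (coord j ω * coord k ω) = -c₁) (φ ψ : 𝓢(E m, ℂ))
    (x : E m) {α β : ℂ} {l : ℕ} (hβ : β = l + 1 / 2) : convDefect c c₁ φ ψ x α β = 0 := by
  refine eq_zero_of_differentiable_of_re (f := fun α => convDefect c c₁ φ ψ x α β)
    (a := -(m : ℝ) / 2 - β.re) (fun z => ?_) (fun z hz => ?_) α
  · exact differentiableAt_convDefect hm c c₁ x differentiable_id (differentiable_const β)
      (jointDecay_of_right_pole hm φ ψ continuous_id hβ z)
  · exact convDefect_eq_zero_of_re hm hc φ ψ x (by rw [Complex.add_re]; linarith)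

/-! ### Dirac and Laplace operators, and powers of them applied to δ -/

theorem Dist.ofScalar_apply (S : 𝓢'(E m, ℂ)) (a : Cl m) (φ : 𝓢(E m, ℂ)) :
    Dist.ofScalar S a φ = S φ • a := rfl

theorem delta_apply (φ : 𝓢(E m, ℂ)) : delta m φ = φ 0 • (1 : Cl m) := rfl

theorem Dist.sum_apply {ι : Type*} (s : Finset ι) (F : ι → Dist m) (φ : 𝓢(E m, ℂ)) :
    (∑ i ∈ s, F i) φ = ∑ i ∈ s, F i φ := by
  classical
  induction s using Finset.induction_on with
  | empty => rfl
  | insert i s hi ih =>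
    rw [Finset.sum_insert hi, Finset.sum_insert hi, ← ih]
    rfl

theorem dirac_apply (S : Dist m) (φ : 𝓢(E m, ℂ)) :
    dirac S φ = -∑ j, e j * S (∂_{EuclideanSpace.single j (1 : ℝ)} φ) := by
  rw [dirac, Dist.sum_apply, ← Finset.sum_neg_distrib]
  refine Finset.sum_congr rfl fun j _ => ?_
  change e j * S (-∂_{EuclideanSpace.single j (1 : ℝ)} φ) = _
  rw [map_neg, mul_neg]

instance : LineDerivLeftSMul ℝ (E m) (Dist m) (Dist m) where
  lineDerivOp_left_smul r x S := by
    ext φ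
    change S (-∂_{r • x} φ) = r • S (-∂_{x} φ)
    rw [LineDeriv.lineDerivOp_left_smul, ← smul_neg]
    exact S.toLinearMap.map_smul_of_tower r _

theorem negLaplacian_apply (S : Dist m) (φ : 𝓢(E m, ℂ)) :
    negLaplacian S φ = -∑ j : Fin m, S (∂_{EuclideanSpace.single j (1 : ℝ)}
      (∂_{EuclideanSpace.single j (1 : ℝ)} φ)) := by
  have h : Laplacian.laplacian S = _ :=
    LineDeriv.laplacianCLM_eq_sum (V₁ := Dist m) (EuclideanSpace.basisFun (Fin m) ℝ) S
  rw [negLaplacian, h]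
  change -((∑ j : Fin m, _ : Dist m) φ) = _
  rw [Dist.sum_apply]
  congr 1
  refine Finset.sum_congr rfl fun j _ => ?_
  rw [TemperedDistribution.lineDerivOp_apply_apply, TemperedDistribution.lineDerivOp_apply_apply]
  simp [LineDeriv.lineDerivOp_neg]

/-- Contraction of a symmetric matrix with the products of the generators. -/
theorem sum_e_mul_e_smul {A : Fin m → Fin m → Cl m} (hA : ∀ j k, A j k = A k j) :
    ∑ j, ∑ k, e j * e k * A j k = -∑ j, A j j := by
  -- Twice the sum is symmetrized in j and k, so that only the anticommutators of the generators
  -- occur.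
  have h2 : (2 : ℂ) • ∑ j, ∑ k, e j * e k * A j k = (2 : ℂ) • -∑ j, A j j := by
    calc (2 : ℂ) • ∑ j, ∑ k, e j * e k * A j k
        = ∑ j, ∑ k, e j * e k * A j k + ∑ j, ∑ k, e k * e j * A j k := by
          rw [two_smul]
          congr 1
          rw [Finset.sum_comm]
          exact Finset.sum_congr rfl fun j _ => Finset.sum_congr rfl fun k _ => by rw [hA]
      _ = ∑ j, ∑ k, (if j = k then (-2 : ℂ) else 0) • A j k := by
          rw [← Finset.sum_add_distrib]
          refine Finset.sum_congr rfl fun j _ => ?_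
          rw [← Finset.sum_add_distrib]
          refine Finset.sum_congr rfl fun k _ => ?_
          rw [← add_mul, e_mul_e_add, Algebra.smul_def]
      _ = (2 : ℂ) • -∑ j, A j j := by
          simp [Finset.smul_sum]
  exact smul_right_injective (Cl m) (two_ne_zero' ℂ) h2

open FourierTransform in
theorem fourier_lineDeriv_single (φ : 𝓢(E m, ℂ)) (j : Fin m) (ξ : E m) :
    (𝓕 (∂_{EuclideanSpace.single j (1 : ℝ)} φ)) ξ = 2 * Real.pi * Complex.I * ξ j * (𝓕 φ) ξ := by
  rw [SchwartzMap.fourier_lineDerivOp_eq, _root_.smul_apply,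
    SchwartzMap.smulLeftCLM_apply_apply (by fun_prop)]
  simp [EuclideanSpace.inner_single_right]
  ring

open FourierTransform in
theorem schwartz_fourier_injective {φ ψ : 𝓢(E m, ℂ)} (h : ∀ ξ, (𝓕 φ) ξ = (𝓕 ψ) ξ) : φ = ψ := by
  have h' : 𝓕 φ = 𝓕 ψ := SchwartzMap.ext h
  rw [← FourierTransform.fourierInv_fourier_eq (F := 𝓢(E m, ℂ)) φ, h',
    FourierTransform.fourierInv_fourier_eq]

/-- Both orders have the same Fourier symbol. -/
theorem lineDeriv_single_comm (φ : 𝓢(E m, ℂ)) (j k : Fin m) :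
    ∂_{EuclideanSpace.single j (1 : ℝ)} (∂_{EuclideanSpace.single k (1 : ℝ)} φ)
      = ∂_{EuclideanSpace.single k (1 : ℝ)} (∂_{EuclideanSpace.single j (1 : ℝ)} φ) := by
  refine schwartz_fourier_injective fun ξ => ?_
  simp only [fourier_lineDeriv_single]
  ring

/-- Mixed derivatives are symmetric, so the double sum of e_j e_k against them contracts to the
diagonal. -/
theorem dirac_dirac (S : Dist m) : dirac (dirac S) = negLaplacian S := by
  ext φ
  rw [dirac_apply, negLaplacian_apply]
  simp only [dirac_apply, mul_neg, Finset.sum_neg_distrib, neg_neg, Finset.mul_sum, ← mul_assoc]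
  exact sum_e_mul_e_smul fun j k => by rw [lineDeriv_single_comm]

theorem dirac_iterate_two_mul (l : ℕ) (S : Dist m) : dirac^[2 * l] S = negLaplacian^[l] S := by
  rw [Function.iterate_mul]
  congr 1
  exact funext dirac_dirac

open FourierTransform in
theorem schwartz_zero_eq (φ : 𝓢(E m, ℂ)) : φ 0 = ∫ ξ, (𝓕 φ) ξ := by
  conv_lhs => rw [← FourierTransform.fourierInv_fourier_eq (F := 𝓢(E m, ℂ)) φ]
  rw [SchwartzMap.fourierInv_coe, Real.fourierInv_eq']
  simp

open FourierTransform in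
-- -Δ has symbol 4π²|ξ|² for the transform with kernel exp(-2πi⟨x, ξ⟩). This Fourier form is what
-- can be compared with the family at its poles.
theorem negLaplacian_iterate_delta (l : ℕ) (φ : 𝓢(E m, ℂ)) :
    negLaplacian^[l] (delta m) φ
      = ((4 * Real.pi ^ 2) ^ l * ∫ ξ, (‖ξ‖ : ℂ) ^ (2 * l) * (𝓕 φ) ξ) • (1 : Cl m) := by
  induction l generalizing φ with
  | zero => simp [delta_apply, schwartz_zero_eq φ]
  | succ l ih =>
    rw [Function.iterate_succ_apply', negLaplacian_apply]
    simp only [ih, ← Finset.sum_smul, ← neg_smul, ← Finset.mul_sum]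
    congr 1
    have hint : ∀ ψ : 𝓢(E m, ℂ), Integrable fun ξ => (‖ξ‖ : ℂ) ^ (2 * l) * (𝓕 ψ) ξ := fun ψ => by
      refine ((𝓕 ψ).integrable_pow_mul volume (2 * l)).mono' ?_
        (Filter.Eventually.of_forall fun ξ => by simp)
      exact Continuous.aestronglyMeasurable ((by fun_prop : Continuous fun ξ : E m =>
        (‖ξ‖ : ℂ) ^ (2 * l)).mul (SchwartzMap.continuous _))
    rw [← integral_finsetSum _ fun j _ => hint _, pow_succ (4 * (Real.pi : ℂ) ^ 2) l,
      mul_assoc ((4 * (Real.pi : ℂ) ^ 2) ^ l), ← mul_neg]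
    congr 1
    rw [← integral_neg, ← integral_const_mul]
    refine integral_congr_ae (Filter.Eventually.of_forall fun ξ => ?_)
    have hn : ∑ j, (ξ j : ℂ) ^ 2 = (‖ξ‖ : ℂ) ^ 2 := by
      have := EuclideanSpace.real_norm_sq_eq ξ
      exact_mod_cast this.symm
    have hterm : ∀ j : Fin m, (‖ξ‖ : ℂ) ^ (2 * l) * (𝓕 (∂_{EuclideanSpace.single j (1 : ℝ)}
        (∂_{EuclideanSpace.single j (1 : ℝ)} φ))) ξ
        = (‖ξ‖ : ℂ) ^ (2 * l) * (-(4 * Real.pi ^ 2) * (𝓕 φ) ξ) * (ξ j : ℂ) ^ 2 := fun j => by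
      rw [fourier_lineDeriv_single, fourier_lineDeriv_single]
      linear_combination ((‖ξ‖ : ℂ) ^ (2 * l) * 4 * Real.pi ^ 2 * ξ j ^ 2 * (𝓕 φ) ξ) *
        Complex.I_sq
    simp only [hterm, ← Finset.mul_sum, hn]
    ring

open FourierTransform in
theorem dirac_iterate_delta (l : ℕ) (φ : 𝓢(E m, ℂ)) :
    dirac^[2 * l + 1] (delta m) φ = ∑ j, (-(2 * Real.pi * Complex.I) * (4 * Real.pi ^ 2) ^ l *
      ∫ ξ, (‖ξ‖ : ℂ) ^ (2 * l) * (ξ j : ℂ) * (𝓕 φ) ξ) • (e j : Cl m) := by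
  rw [Function.iterate_succ_apply', dirac_iterate_two_mul, dirac_apply, ← Finset.sum_neg_distrib]
  refine Finset.sum_congr rfl fun j _ => ?_
  rw [negLaplacian_iterate_delta, mul_smul_comm, mul_one, ← neg_smul]
  congr 1
  simp only [fourier_lineDeriv_single]
  have : ∀ ξ : E m, (‖ξ‖ : ℂ) ^ (2 * l) * (2 * Real.pi * Complex.I * ξ j * (𝓕 φ) ξ)
      = (2 * Real.pi * Complex.I) * ((‖ξ‖ : ℂ) ^ (2 * l) * (ξ j : ℂ) * (𝓕 φ) ξ) := fun ξ => by ring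
  simp only [this, integral_const_mul]
  ring

theorem Dist.smul_apply (c : ℂ) (S : Dist m) (φ : 𝓢(E m, ℂ)) : (c • S) φ = c • S φ := rfl

/-! ### Identification of T* and U* with the entire families -/

open FourierTransform in
/-- The value of a normalized distribution at a pole of `Fp |x| ^ λ w(x / |x|)`. -/
theorem HarmonicData.fam_pole (hm : 1 ≤ m) {p : ℕ} {w : C(Sph m, ℂ)} {P : E m → ℂ}
    (h : HarmonicData p w P) (φ : 𝓢(E m, ℂ)) (l : ℕ) :
    fam p w (-m - 2 * l - p) φ = (-Complex.I) ^ p *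
      ((Real.pi : ℂ) ^ ((m : ℂ) / 2 + l + p) * (Complex.Gamma (m / 2 + l + p))⁻¹) *
      ∫ ξ, (‖ξ‖ : ℂ) ^ (2 * l) * P (-ξ) * (𝓕 φ) ξ := by
  have hm1 : (1 : ℝ) ≤ m := by exact_mod_cast hm
  have hnt : Nontrivial (E m) :=
    Module.nontrivial_of_finrank_pos (R := ℝ) (by rw [finrank_E]; omega)
  have h0 : (-(m : ℂ) - 2 * l - p).re < 0 := by
    simp only [Complex.sub_re, Complex.neg_re, Complex.natCast_re, Complex.mul_re, Complex.re_ofNat,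
      Complex.im_ofNat, zero_mul, sub_zero]
    have : (0 : ℝ) ≤ l := by positivity
    have : (0 : ℝ) ≤ p := by positivity
    linarith
  -- The regularization at y = 0 pairs with the reflected test function, so φ is reflected
  -- beforehand; this is the origin of P(-ξ).
  have hφ : reflTranslate 0 (reflTranslate 0 φ) = φ := by
    ext x
    simp [reflTranslate_apply]
  have hF : ∀ ξ, (𝓕 (reflTranslate 0 φ)) ξ = (𝓕 φ) (-ξ) := fun ξ => by
    have h1 := fourierInv_reflTranslate (reflTranslate 0 φ) 0 ξ
    rw [hφ] at h1
    simp only [inner_zero_left, AddChar.map_zero_eq_one, Circle.coe_one, one_mul] at h1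
    rw [← h1, SchwartzMap.fourierInv_coe, SchwartzMap.fourier_coe, Real.fourierInv_eq_fourier_neg]
  have key := h.fam_reflTranslate hm (reflTranslate 0 φ) h0 0
  rw [hφ] at key
  rw [key]
  have e1 : -(-(m : ℂ) - 2 * l - p) - m = ((2 * l + p : ℕ) : ℂ) := by push_cast; ring
  have e2 : (-(-(m : ℂ) - 2 * l - p) + p) / 2 = m / 2 + l + p := by ring
  have e3 : (((2 * l + p : ℕ) : ℂ) + m + p) / 2 = m / 2 + l + p := by push_cast; ring
  rw [e1, e2, piFactor, e3]
  congr 1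
  rw [← integral_neg_eq_self]
  refine integral_congr_ae ?_
  filter_upwards [compl_mem_ae_iff.2 (measure_singleton (0 : E m))] with ξ hξ
  have hξ' : -ξ ≠ 0 := neg_ne_zero.2 hξ
  simp only [inner_zero_left, AddChar.map_zero_eq_one, Circle.coe_one, one_mul, hF, neg_neg]
  rw [h.homog_eq _ hξ', radial, Complex.cpow_natCast, norm_neg, pow_add]
  ring

/-- The prescribed multiples of (-Δ)^l δ are the values of the entire family at its exceptional
points, so both branches of the definition become one formula. -/
theorem Tstar_apply (hm : 1 ≤ m) (lam : ℂ) (φ : 𝓢(E m, ℂ)) :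
    Tstar m lam φ = fam 0 1 lam φ • (1 : Cl m) := by
  have hpi : (Real.pi : ℂ) ≠ 0 := by exact_mod_cast Real.pi_ne_zero
  by_cases h : ∃ l : ℕ, lam = -m - 2 * l
  · rw [Tstar, dif_pos h]
    -- Only the defining equation of the chosen l is used.
    generalize hl : h.choose = l
    have hlam : lam = -m - 2 * l - (0 : ℕ) := by rw [← hl, Nat.cast_zero, sub_zero, ← h.choose_spec]
    rw [Dist.smul_apply, negLaplacian_iterate_delta, smul_smul, hlam, harmonicData_one.fam_pole hm]
    congr 1
    have hp : (Real.pi : ℂ) ^ ((m : ℂ) / 2 - l) * (Real.pi : ℂ) ^ (2 * l)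
        = (Real.pi : ℂ) ^ ((m : ℂ) / 2 + l) := by
      rw [← Complex.cpow_natCast, ← Complex.cpow_add _ _ hpi]
      congr 1; push_cast; ring
    have h4 : ((4 : ℂ) * (Real.pi : ℂ) ^ 2) ^ l = 2 ^ (2 * l) * (Real.pi : ℂ) ^ (2 * l) := by
      rw [mul_pow, ← pow_mul, pow_mul 2]; norm_num
    have h2 : (2 : ℂ) ^ (2 * l) ≠ 0 := pow_ne_zero _ two_ne_zero
    simp only [pow_zero, one_mul, Nat.cast_zero, add_zero, mul_one]
    rw [h4, ← hp]
    field_simp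
  · rw [Tstar, dif_neg h]
    rw [Dist.smul_apply, T, Dist.ofScalar_apply, smul_smul, fam_eq_fpRadial zero_le_one hasParity_one]
    · simp
    · intro l hl
      exact h ⟨l, by simpa using hl⟩

/-- At the poles the sign of P(-ξ) = -P(ξ) and the factor -i match the minus sign in the definition
and the symbol of the Dirac operator. -/
theorem Ustar_apply (hm : 1 ≤ m) (lam : ℂ) (φ : 𝓢(E m, ℂ)) :
    Ustar m lam φ = ∑ j, fam 1 (coord j) lam φ • (e j : Cl m) := by
  have hpi : (Real.pi : ℂ) ≠ 0 := by exact_mod_cast Real.pi_ne_zero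
  by_cases h : ∃ l : ℕ, lam = -m - 2 * l - 1
  · rw [Ustar, dif_pos h]
    generalize hl : h.choose = l
    have hlam : lam = -m - 2 * l - (1 : ℕ) := by rw [← hl, Nat.cast_one, ← h.choose_spec]
    rw [Dist.smul_apply, dirac_iterate_delta, Finset.smul_sum]
    refine Finset.sum_congr rfl fun j _ => ?_
    rw [smul_smul, hlam, (harmonicData_coord hm j).fam_pole hm]
    congr 1
    have hp : (Real.pi : ℂ) ^ ((m : ℂ) / 2 - l) * (Real.pi : ℂ) ^ (2 * l + 1)
        = (Real.pi : ℂ) ^ ((m : ℂ) / 2 + l + 1) := by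
      rw [← Complex.cpow_natCast, ← Complex.cpow_add _ _ hpi]
      congr 1; push_cast; ring
    have h4 : ((4 : ℂ) * (Real.pi : ℂ) ^ 2) ^ l = 2 ^ (2 * l) * (Real.pi : ℂ) ^ (2 * l) := by
      rw [mul_pow, ← pow_mul, pow_mul 2]; norm_num
    have h2 : (2 : ℂ) ^ (2 * l) ≠ 0 := pow_ne_zero _ two_ne_zero
    simp only [pow_one, Nat.cast_one, PiLp.neg_apply, Complex.ofReal_neg, mul_neg, neg_mul,
      integral_neg]
    rw [h4, ← hp]
    field_simp
    ring
  · rw [Ustar, dif_neg h]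
    rw [Dist.smul_apply, U, Dist.sum_apply, Finset.smul_sum]
    refine Finset.sum_congr rfl fun j _ => ?_
    rw [Dist.ofScalar_apply, smul_smul, fam_eq_fpRadial le_rfl (hasParity_coord j)]
    · simp
    · intro l hl
      exact h ⟨l, by simpa using hl⟩

/-! ### Constants and the convolution of the kernels -/

/-- The constant in the definition of `laplaceH`. -/
def vecConst (m : ℕ) (α : ℂ) : ℂ :=
  -((2 : ℂ) ^ (2 * α) * Complex.Gamma ((m + 2 * α + 1) / 2) /
    (Real.pi : ℂ) ^ ((m - 2 * α + 1) / 2))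

/-- The constant in the definition of `laplaceDelta`. -/
def scalConst (m : ℕ) (γ : ℂ) : ℂ :=
  (2 : ℂ) ^ (2 * γ) * Complex.Gamma ((m + 2 * γ) / 2) / (Real.pi : ℂ) ^ ((m - 2 * γ) / 2)

theorem laplaceH_apply (hm : 1 ≤ m) (α : ℂ) (φ : 𝓢(E m, ℂ)) :
    laplaceH m α φ = vecConst m α • ∑ j, fam 1 (coord j) (-m - 2 * α) φ • (e j : Cl m) := by
  rw [← Ustar_apply hm]
  rfl

theorem laplaceDelta_apply (hm : 1 ≤ m) (γ : ℂ) (φ : 𝓢(E m, ℂ)) :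
    laplaceDelta m γ φ = (scalConst m γ * fam 0 1 (-m - 2 * γ) φ) • (1 : Cl m) := by
  rw [mul_smul, ← Tstar_apply hm]
  rfl

/-- The relation ω² = -|ω|² = -1, read through a linear functional; it supplies the hypothesis on c
and c₁ in the vanishing of `convDefect`. -/
theorem dual_sum_coord_mul (ℓ : Module.Dual ℂ (Cl m)) (ω : Sph m) :
    ∑ j, ∑ k, ℓ (e j * e k) * (coord j ω * coord k ω) = -ℓ 1 := by
  have h := congrArg ℓ (sum_e_mul_e_smul (m := m)
    (A := fun j k => (coord j ω * coord k ω) • (1 : Cl m)) fun j k => by rw [mul_comm])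
  simp only [mul_smul_comm, mul_one, map_sum, map_smul, map_neg, smul_eq_mul,
    ← Finset.sum_mul] at h
  have hs : ∑ j, coord j ω * coord j ω = 1 := by
    have h1 := EuclideanSpace.real_norm_sq_eq (ω : E m)
    rw [sphere_norm] at h1
    have h2 : ∑ j, coord j ω * coord j ω = ((∑ j, (ω : E m) j ^ 2 : ℝ) : ℂ) := by
      push_cast
      exact Finset.sum_congr rfl fun j _ => (sq _).symm
    rw [h2, ← h1]
    norm_num
  rw [hs, one_mul] at h
  rw [← h]
  exact Finset.sum_congr rfl fun j _ => Finset.sum_congr rfl fun k _ => mul_comm _ _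

/-- Γ is assigned the value 0 at its poles, so the excluded points are the zeros of the entire
function 1/Γ. This serves both to cancel Gamma factors and to prove openness. -/
theorem forall_ne_sub_natCast_iff (b z : ℂ) :
    (∀ n : ℕ, z ≠ b - n) ↔ (Complex.Gamma (z - b))⁻¹ ≠ 0 := by
  rw [ne_eq, inv_eq_zero, Complex.Gamma_eq_zero_iff, not_exists]
  refine forall_congr' fun n => not_congr ?_
  rw [sub_eq_iff_eq_add, neg_add_eq_sub]

theorem vecConst_mul_vecConst (α β : ℂ) :
    vecConst m α * vecConst m β * (Real.pi : ℂ) ^ ((m : ℂ) / 2 + 1) *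
      Complex.Gamma (m / 2 + (α + β)) = scalConst m (α + β) *
        (Complex.Gamma ((m + 1) / 2 + α) * Complex.Gamma ((m + 1) / 2 + β)) := by
  have hpi : (Real.pi : ℂ) ≠ 0 := by exact_mod_cast Real.pi_ne_zero
  have e1 : ((m : ℂ) + 2 * α + 1) / 2 = (m + 1) / 2 + α := by ring
  have e2 : ((m : ℂ) + 2 * β + 1) / 2 = (m + 1) / 2 + β := by ring
  have e3 : ((m : ℂ) + 2 * (α + β)) / 2 = m / 2 + (α + β) := by ring
  have h2 : (2 : ℂ) ^ (2 * α) * (2 : ℂ) ^ (2 * β) = (2 : ℂ) ^ (2 * (α + β)) := by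
    rw [← Complex.cpow_add _ _ two_ne_zero, mul_add]
  have h1 : (Real.pi : ℂ) ^ ((m - 2 * α + 1) / 2) * (Real.pi : ℂ) ^ ((m - 2 * β + 1) / 2)
      = (Real.pi : ℂ) ^ ((m : ℂ) / 2 + 1) * (Real.pi : ℂ) ^ ((m - 2 * (α + β)) / 2) := by
    rw [← Complex.cpow_add _ _ hpi, ← Complex.cpow_add _ _ hpi]
    congr 1; ring
  have n1 : (Real.pi : ℂ) ^ ((m - 2 * α + 1) / 2) ≠ 0 := by simp [Complex.cpow_eq_zero_iff, hpi]
  have n2 : (Real.pi : ℂ) ^ ((m - 2 * β + 1) / 2) ≠ 0 := by simp [Complex.cpow_eq_zero_iff, hpi]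
  have n3 : (Real.pi : ℂ) ^ ((m - 2 * (α + β)) / 2) ≠ 0 := by
    simp [Complex.cpow_eq_zero_iff, hpi]
  rw [vecConst, vecConst, scalConst, e1, e2, e3, ← h2, neg_mul_neg, div_mul_div_comm,
    div_mul_eq_mul_div, div_mul_eq_mul_div, div_mul_eq_mul_div, div_eq_div_iff (mul_ne_zero n1 n2) n3,
    h1]
  ring

/-- The convolution identity, if the kernels have sufficient joint decay. -/
theorem isConvolution_of_jointDecay (hm : 1 ≤ m) {α β : ℂ}
    (hα : ∀ n : ℕ, α ≠ -((m : ℂ) + 1) / 2 - n) (hβ : ∀ n : ℕ, β ≠ -((m : ℂ) + 1) / 2 - n)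
    (hγ : ∀ n : ℕ, α + β ≠ -(m : ℂ) / 2 - n)
    (hJ : ∀ φ ψ : 𝓢(E m, ℂ), JointDecay φ ψ (fun _ => α) (fun _ => β) 0)
    (h0 : ∀ (φ ψ : 𝓢(E m, ℂ)) (x : E m) (ℓ : Module.Dual ℂ (Cl m)),
      convDefect (fun j k => ℓ (e j * e k)) (ℓ 1) φ ψ x α β = 0) :
    IsConvolution (laplaceH m α) (laplaceH m β) (laplaceDelta m (α + β)) := by
  intro φ ψ x ℓ
  have hl : ∀ y, ℓ (reg (laplaceH m α) φ y * reg (laplaceH m β) ψ (x - y))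
      = vecConst m α * vecConst m β * ∑ j, ∑ k, ℓ (e j * e k) *
        (fam 1 (coord j) (-m - 2 * α) (reflTranslate y φ) *
          fam 1 (coord k) (-m - 2 * β) (reflTranslate (x - y) ψ)) := fun y => by
    rw [reg, reg, laplaceH_apply hm, laplaceH_apply hm, smul_mul_smul_comm, Finset.sum_mul_sum]
    simp only [map_smul, map_sum, smul_eq_mul, smul_mul_smul_comm]
    congr 1
    exact Finset.sum_congr rfl fun j _ => Finset.sum_congr rfl fun k _ => mul_comm _ _
  have hr : ∀ y, ℓ (ψ (x - y) • reg (laplaceDelta m (α + β)) φ y)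
      = scalConst m (α + β) * ℓ 1 *
        (fam 0 1 (-m - 2 * (α + β)) (reflTranslate y φ) * ψ (x - y)) := fun y => by
    rw [reg, laplaceDelta_apply hm]
    simp only [map_smul, smul_eq_mul]
    ring
  have hv : ∀ j k, Integrable fun y => ℓ (e j * e k) *
      (fam 1 (coord j) (-m - 2 * α) (reflTranslate y φ) *
        fam 1 (coord k) (-m - 2 * β) (reflTranslate (x - y) ψ)) := fun j k =>
    (vecConv_aux hm j k x (differentiable_const α) (differentiable_const β) (hJ φ ψ)).1.const_mul _
  have hs := (scalConv_aux hm φ ψ x (differentiable_const (α + β)) 0).1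
  simp only [hl, hr]
  refine ⟨(integrable_finsetSum _ fun j _ => integrable_finsetSum _ fun k _ => hv j k).const_mul _,
    hs.const_mul _, ?_⟩
  rw [integral_const_mul, integral_const_mul,
    integral_finsetSum _ fun j _ => integrable_finsetSum _ fun k _ => hv j k]
  have hsum : ∑ j, ∫ y, ∑ k, ℓ (e j * e k) *
      (fam 1 (coord j) (-m - 2 * α) (reflTranslate y φ) *
        fam 1 (coord k) (-m - 2 * β) (reflTranslate (x - y) ψ))
      = ∑ j, ∑ k, ℓ (e j * e k) * vecConv j k φ ψ x α β := by
    refine Finset.sum_congr rfl fun j _ => ?_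
    rw [integral_finsetSum _ fun k _ => hv j k]
    exact Finset.sum_congr rfl fun k _ => integral_const_mul _ _
  rw [hsum]
  have key := h0 φ ψ x ℓ
  rw [forall_ne_sub_natCast_iff, ne_eq, inv_eq_zero] at hα hβ hγ
  have e1 : α - -((m : ℂ) + 1) / 2 = (m + 1) / 2 + α := by ring
  have e2 : β - -((m : ℂ) + 1) / 2 = (m + 1) / 2 + β := by ring
  have e3 : α + β - -(m : ℂ) / 2 = m / 2 + (α + β) := by ring
  rw [e1] at hα
  rw [e2] at hβ
  rw [e3] at hγ
  -- Admissibility of α + β makes the prefactor 1/Γ nonzero, so the vanishing defect can be solved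
  -- for the vector convolution.
  rw [convDefect, sub_eq_zero, inv_mul_eq_iff_eq_mul₀ hγ] at key
  rw [key]
  change _ = _ * scalConv φ ψ x (α + β)
  have hc := vecConst_mul_vecConst (m := m) α β
  have hc' : vecConst m α * vecConst m β * (Real.pi : ℂ) ^ ((m : ℂ) / 2 + 1) *
      Complex.Gamma (m / 2 + (α + β)) * ((Complex.Gamma ((m + 1) / 2 + α))⁻¹ *
        (Complex.Gamma ((m + 1) / 2 + β))⁻¹) = scalConst m (α + β) := by
    rw [hc, ← mul_inv, mul_inv_cancel_right₀ (mul_ne_zero hα hβ)]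
  linear_combination (ℓ 1 * scalConv φ ψ x (α + β)) * hc'

/-- Admissibility of α + β is automatic here: its excluded values have real part at most -m/2, and
if one parameter is l + 1/2, then α + β = -m/2 - n would put the other at the excluded value
-(m+1)/2 - (n+l). -/
theorem isConvolution_laplaceH (hm : 1 ≤ m) {α β : ℂ}
    (hα : ∀ n : ℕ, α ≠ -((m : ℂ) + 1) / 2 - n) (hβ : ∀ n : ℕ, β ≠ -((m : ℂ) + 1) / 2 - n)
    (h : -(m : ℝ) / 2 < (α + β).re ∨ (∃ l : ℕ, α = l + 1 / 2) ∨ (∃ l : ℕ, β = l + 1 / 2)) :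
    IsConvolution (laplaceH m α) (laplaceH m β) (laplaceDelta m (α + β)) := by
  rcases h with h | ⟨l, hl⟩ | ⟨l, hl⟩
  · refine isConvolution_of_jointDecay hm hα hβ (fun n hn => ?_)
      (fun φ ψ => jointDecay_of_re hm φ ψ continuous_const continuous_const h)
      (fun φ ψ x ℓ => convDefect_eq_zero_of_re hm (dual_sum_coord_mul ℓ) φ ψ x h)
    have hre : (-(m : ℂ) / 2 - n).re = -(m : ℝ) / 2 - n := by
      rw [show -(m : ℂ) / 2 - n = ((-(m : ℝ) / 2 - n : ℝ) : ℂ) by push_cast; ring,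
        Complex.ofReal_re]
    rw [hn, hre] at h
    have : (0 : ℝ) ≤ n := by positivity
    linarith
  · refine isConvolution_of_jointDecay hm hα hβ (fun n hn => hβ (n + l) ?_)
      (fun φ ψ => jointDecay_of_left_pole hm φ ψ continuous_const hl 0)
      (fun φ ψ x ℓ => convDefect_eq_zero_of_left_pole hm (dual_sum_coord_mul ℓ) φ ψ x hl)
    push_cast
    linear_combination hn - hl
  · refine isConvolution_of_jointDecay hm hα hβ (fun n hn => hα (n + l) ?_)
      (fun φ ψ => jointDecay_of_right_pole hm φ ψ continuous_const hl 0)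
      (fun φ ψ x ℓ => convDefect_eq_zero_of_right_pole hm (dual_sum_coord_mul ℓ) φ ψ x hl)
    push_cast
    linear_combination hn - hl

/-! ### Holomorphy of the kernels and topology of the admissible set -/

theorem differentiableAt_laplaceH (hm : 1 ≤ m) (φ : 𝓢(E m, ℂ)) (ℓ : Module.Dual ℂ (Cl m)) {α : ℂ}
    (hα : ∀ n : ℕ, α ≠ -((m : ℂ) + 1) / 2 - n) :
    DifferentiableAt ℂ (fun α => ℓ (laplaceH m α φ)) α := by
  have hpi : (Real.pi : ℂ) ≠ 0 := by exact_mod_cast Real.pi_ne_zero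
  simp only [laplaceH_apply hm, map_smul, map_sum, smul_eq_mul, vecConst]
  have hΓ : DifferentiableAt ℂ (fun α : ℂ => Complex.Gamma ((m + 2 * α + 1) / 2)) α := by
    refine DifferentiableAt.fun_comp' α (Complex.differentiableAt_Gamma _ fun n hn => hα n ?_)
      (by fun_prop)
    linear_combination hn
  have h2 : Differentiable ℂ fun α : ℂ => (2 : ℂ) ^ (2 * α) :=
    (by fun_prop : Differentiable ℂ fun α : ℂ => 2 * α).const_cpow (Or.inl two_ne_zero)
  have h1 : Differentiable ℂ fun α : ℂ => (Real.pi : ℂ) ^ ((m - 2 * α + 1) / 2) :=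
    (by fun_prop : Differentiable ℂ fun α : ℂ => ((m : ℂ) - 2 * α + 1) / 2).const_cpow
      (Or.inl hpi)
  refine DifferentiableAt.mul (((h2 α).mul hΓ).div (h1 α) ?_).neg ?_
  · simp [Complex.cpow_eq_zero_iff, hpi]
  · refine DifferentiableAt.fun_sum fun j _ => DifferentiableAt.mul_const ?_ _
    exact ((differentiable_fam le_rfl (hasParity_coord j) φ).comp
      (by fun_prop : Differentiable ℂ fun α : ℂ => -(m : ℂ) - 2 * α)) α

theorem differentiableAt_laplaceDelta (hm : 1 ≤ m) (φ : 𝓢(E m, ℂ)) (ℓ : Module.Dual ℂ (Cl m))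
    {γ : ℂ} (hγ : ∀ n : ℕ, γ ≠ -(m : ℂ) / 2 - n) :
    DifferentiableAt ℂ (fun γ => ℓ (laplaceDelta m γ φ)) γ := by
  have hpi : (Real.pi : ℂ) ≠ 0 := by exact_mod_cast Real.pi_ne_zero
  simp only [laplaceDelta_apply hm, map_smul, smul_eq_mul, scalConst]
  have hΓ : DifferentiableAt ℂ (fun γ : ℂ => Complex.Gamma ((m + 2 * γ) / 2)) γ := by
    refine DifferentiableAt.fun_comp' γ (Complex.differentiableAt_Gamma _ fun n hn => hγ n ?_)
      (by fun_prop)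
    linear_combination hn
  have h2 : Differentiable ℂ fun γ : ℂ => (2 : ℂ) ^ (2 * γ) :=
    (by fun_prop : Differentiable ℂ fun γ : ℂ => 2 * γ).const_cpow (Or.inl two_ne_zero)
  have h1 : Differentiable ℂ fun γ : ℂ => (Real.pi : ℂ) ^ ((m - 2 * γ) / 2) :=
    (by fun_prop : Differentiable ℂ fun γ : ℂ => ((m : ℂ) - 2 * γ) / 2).const_cpow (Or.inl hpi)
  refine DifferentiableAt.mul_const (DifferentiableAt.mul (((h2 γ).mul hΓ).div (h1 γ) ?_) ?_) _
  · simp [Complex.cpow_eq_zero_iff, hpi]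
  · exact ((differentiable_fam zero_le_one hasParity_one φ).comp
      (by fun_prop : Differentiable ℂ fun γ : ℂ => -(m : ℂ) - 2 * γ)) γ

/-- The set of pairs that avoid three sequences of complex lines. -/
def avoidSet (a b c : ℂ) : Set (ℂ × ℂ) :=
  {p | (∀ n : ℕ, p.1 ≠ a - n) ∧ (∀ n : ℕ, p.2 ≠ b - n) ∧ (∀ n : ℕ, p.1 + p.2 ≠ c - n)}

theorem isOpen_avoidSet (a b c : ℂ) : IsOpen (avoidSet a b c) := by
  have h : ∀ (d : ℂ) {f : ℂ × ℂ → ℂ}, Continuous f → IsOpen {p | ∀ n : ℕ, f p ≠ d - n} := by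
    intro d f hf
    simp only [forall_ne_sub_natCast_iff]
    have hc : Continuous fun z => (Complex.Gamma z)⁻¹ :=
      Complex.differentiable_one_div_Gamma.continuous
    exact isOpen_ne_fun (hc.comp (hf.sub continuous_const)) continuous_const
  exact (h a continuous_fst).inter ((h b continuous_snd).inter (h c continuous_add))

/-- A nonconstant affine function takes each excluded value at most once; a constant one never does,
by admissibility at t = 0. -/
theorem countable_setOf_exists_affine_eq {u v d : ℂ} (h : ∀ n : ℕ, u ≠ d - n) :
    {t : ℂ | ∃ n : ℕ, u + t * v = d - n}.Countable := by
  rw [Set.ofPred_exists]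
  refine Set.countable_iUnion fun n => Set.Subsingleton.countable ?_
  intro s hs t ht
  have hs' : u + s * v = d - n := hs
  have ht' : u + t * v = d - n := ht
  by_cases hv : v = 0
  · exact absurd (by simpa [hv] using hs') (h n)
  · exact mul_right_cancel₀ hv (by linear_combination hs' - ht')

/-- On the complex line through p and q the inadmissible parameters are countable, and ℂ, having
real dimension 2, stays connected when a countable set is removed. -/
theorem isPreconnected_avoidSet (a b c : ℂ) : IsPreconnected (avoidSet a b c) := by
  refine isPreconnected_of_forall_pair fun p hp q hq => ?_
  let N : Set ℂ := {t | ∃ n : ℕ, p.1 + t * (q.1 - p.1) = a - n} ∪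
    ({t | ∃ n : ℕ, p.2 + t * (q.2 - p.2) = b - n} ∪
      {t | ∃ n : ℕ, p.1 + p.2 + t * (q.1 - p.1 + (q.2 - p.2)) = c - n})
  have hN : N.Countable := (countable_setOf_exists_affine_eq hp.1).union
    ((countable_setOf_exists_affine_eq hp.2.1).union (countable_setOf_exists_affine_eq hp.2.2))
  let f : ℂ → ℂ × ℂ := fun t => (p.1 + t * (q.1 - p.1), p.2 + t * (q.2 - p.2))
  have hf : ∀ t, t ∈ Nᶜ ↔ f t ∈ avoidSet a b c := by
    intro t
    have e : p.1 + t * (q.1 - p.1) + (p.2 + t * (q.2 - p.2))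
        = p.1 + p.2 + t * (q.1 - p.1 + (q.2 - p.2)) := by ring
    simp only [N, f, avoidSet, Set.mem_compl_iff, Set.mem_union, Set.mem_ofPred_eq, not_or,
      not_exists, ne_eq, e]
  have h0 : f 0 = p := by simp [f]
  have h1 : f 1 = q := by simp [f]
  refine ⟨f '' Nᶜ, ?_, ?_, ?_, ?_⟩
  · rintro _ ⟨t, ht, rfl⟩
    exact (hf t).1 ht
  · exact ⟨0, (hf 0).2 (h0 ▸ hp), h0⟩
  · exact ⟨1, (hf 1).2 (h1 ▸ hq), h1⟩
  · refine (Set.Countable.isConnected_compl_of_one_lt_rank ?_ hN).isPreconnected.image f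
      (by fun_prop)
    rw [Complex.rank_real_complex]
    norm_num

end CliffordKernel

end

open CliffordKernel

/-! ### The proposition -/

theorem proposition7p1 (m : ℕ) (hm : 1 ≤ m) :
    -- the convolution in the usual sense of distribution theory, where it exists
    (∀ α β : ℂ, (∀ n : ℕ, α ≠ -((m : ℂ) + 1) / 2 - n) → (∀ n : ℕ, β ≠ -((m : ℂ) + 1) / 2 - n) →
      (-(m : ℝ) / 2 < (α + β).re ∨ (∃ l : ℕ, α = l + 1 / 2) ∨ (∃ l : ℕ, β = l + 1 / 2)) →
      IsConvolution (laplaceH m α) (laplaceH m β) (laplaceDelta m (α + β))) ∧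
    -- the convolution in the sense of analytic continuation, for all admissible parameters
    IsConvolutionByContinuation (laplaceH m) (laplaceH m)
      {p : ℂ × ℂ | (∀ n : ℕ, p.1 ≠ -((m : ℂ) + 1) / 2 - n) ∧
        (∀ n : ℕ, p.2 ≠ -((m : ℂ) + 1) / 2 - n) ∧ (∀ n : ℕ, p.1 + p.2 ≠ -(m : ℂ) / 2 - n)}
      (fun p => laplaceDelta m (p.1 + p.2)) := by
  refine ⟨fun α β hα hβ h => isConvolution_laplaceH hm hα hβ h, ?_⟩
  change IsConvolutionByContinuation _ _
    (avoidSet (-((m : ℂ) + 1) / 2) (-((m : ℂ) + 1) / 2) (-(m : ℂ) / 2)) _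
  have hm1 : (1 : ℝ) ≤ m := by exact_mod_cast hm
  have h0 : ∀ (d : ℝ), d < 0 → ∀ n : ℕ, (0 : ℂ) ≠ (d : ℂ) - n := by
    intro d hd n h
    have h1 : (0 : ℝ) = d - n := by exact_mod_cast h
    have h2 : (0 : ℝ) ≤ n := by positivity
    linarith
  -- All excluded values have negative real part, so the origin is admissible; it also lies in the
  -- open set where the usual convolution exists.
  have hz : ((0 : ℂ), (0 : ℂ)) ∈
      avoidSet (-((m : ℂ) + 1) / 2) (-((m : ℂ) + 1) / 2) (-(m : ℂ) / 2) := by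
    have ha := h0 (-((m : ℝ) + 1) / 2) (by linarith)
    have hb := h0 (-(m : ℝ) / 2) (by linarith)
    push_cast at ha hb
    exact ⟨ha, ha, by simpa using hb⟩
  refine ⟨isOpen_avoidSet _ _ _, ⟨⟨_, hz⟩, isPreconnected_avoidSet _ _ _⟩, ?_, ?_, ?_, ?_⟩
  · intro φ ℓ p hp
    exact (DifferentiableAt.fun_comp' p (differentiableAt_laplaceH hm φ ℓ hp.1)
      differentiableAt_fst).differentiableWithinAt
  · intro φ ℓ p hp
    exact (DifferentiableAt.fun_comp' p (differentiableAt_laplaceH hm φ ℓ hp.2.1)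
      differentiableAt_snd).differentiableWithinAt
  · intro φ ℓ p hp
    exact (DifferentiableAt.fun_comp' p (differentiableAt_laplaceDelta hm φ ℓ hp.2.2)
      (differentiableAt_fst.add differentiableAt_snd)).differentiableWithinAt
  · refine ⟨avoidSet (-((m : ℂ) + 1) / 2) (-((m : ℂ) + 1) / 2) (-(m : ℂ) / 2) ∩
      {p | -(m : ℝ) / 2 < (p.1 + p.2).re}, Set.inter_subset_left,
      (isOpen_avoidSet _ _ _).inter (isOpen_lt continuous_const (by fun_prop)),
      ⟨(0, 0), hz, ?_⟩, fun p hp => isConvolution_laplaceH hm hp.1.1 hp.1.2.1 (Or.inl hp.2)⟩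
    change -(m : ℝ) / 2 < ((0 : ℂ) + 0).re
    rw [add_zero, Complex.zero_re]
    linarith
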